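/- Let $\mathbf{F}$ be a finite field of odd cardinality $q$. Write $\mathbf{Z}_n=\mathbf{Z}[1/n]$. Let $\mathbf{V}$ be the $\mathbf{F}$-vector space with basis $\{e_i,f_i\}_{i\ge 1}$ and symmetric bilinear form $\langle e_i,e_j\rangle=\langle f_i,f_j\rangle=0$, $\langle e_i,f_j\rangle=\delta_{ij}$, and let $G$ be the group of linear automorphisms of $\mathbf{V}$ preserving the form. A transitive (in particular non-empty) $G$-set is called $\mathbf{V}$-smooth if each point stabilizer is the pointwise stabilizer in $G$ of some finite subset of $\mathbf{V}$. A measure on $(G,\mathbf{V})$ with values in a commutative ring $k$ assigns to each $G$-map $f\colon Y\to X$ of transitive $\mathbf{V}$-smooth $G$-sets an element $\mu(f)\in k$ such that: (a) $\mu(f)=1$ if $f$ is an isomorphism; (b) $\mu(f\circ g)=\mu(f)\mu(g)$ for composable $f,g$; (c) if $X'\to X$ is a map of transitive $\mathbf{V}$-smooth $G$-sets, $Y\times_X X'=\bigsqcup_{i=1}^n Y_i'$ is the orbit decomposition and $f_i'\colon Y'_i\to X'$ are the projections, then $\mu(f)=\sum_{i=1}^n\mu(f'_i)$. Let $\Theta(G,\mathbf{V})$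 be the ring carrying the universal measure $f\mapsto[f]$ (the commutative ring generated by symbols $[f]$ subject to (a)-(c)), and put $[X]=[X\to\mathrm{pt}]$. The modified discriminant of a quadratic space of dimension $2r$ or $2r+1$ is $(-1)^r$ times its discriminant. Let $V_{m,\delta,n}$ be the orthogonal direct sum of the non-degenerate quadratic space of dimension $m$ and modified discriminant $\delta\in\mathbf{F}^\times/(\mathbf{F}^\times)^2$ and an $n$-dimensional space with zero form. Let $X_{m,\delta,n}$ be the set of embeddings (injective form-preserving linear maps) $V_{m,\delta,n}\to\mathbf{V}$; it is a transitive $\mathbf{V}$-smooth $G$-set. Let $N_{a,\epsilon,b}^{\ell,\delta,n}$ be the number of embeddings $V_{a,\epsilon,b}\to V_{\ell,\delta,n}$. **Theorem.** There are ring homomorphisms $\phi^{\rm even},\phi^{\rm odd}\colon\Theta(G,\mathbf{V})\to\mathbf{Z}_q[t]$, the counting measures, with the following property, where $\Delta_r=X_{2r,1,0}$ in the even case and $\Delta_r=X_{2r+1,1,0}$ in the odd case: for each map $f\colon Y\to X$ of transitive $\mathbf{V}$-smooth $G$-sets and all but finitely many $r\ge 0$, the set $\mathrm{Hom}_G(\Delta_r,X)$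 is non-empty and every fibre of $\mathrm{Hom}_G(\Delta_r,Y)\to\mathrm{Hom}_G(\Delta_r,X)$ is finite with exactly $\phi^*([f])(q^r)$ elements. Moreover $\phi^*([X_{a,\epsilon,b}])=P^*_{a,\epsilon,b}$, where $P^{\rm even}_{a,\epsilon,b}(q^r)=N^{2r,1,0}_{a,\epsilon,b}$ and $P^{\rm odd}_{a,\epsilon,b}(q^r)=N^{2r+1,1,0}_{a,\epsilon,b}$ for all $r\ge 0$. The induced homomorphism $$\phi^{\rm even}\times\phi^{\rm odd}\colon\Theta(G,\mathbf{V})[1/2q]\to\mathbf{Z}_{2q}[t]\times\mathbf{Z}_{2q}[t]$$ is injective, and its image is the set of pairs $(f,g)$ with $f(0)=g(0)$. In particular, there is a ring isomorphism $$\Theta(G,\mathbf{V})[1/2q]\cong\mathbf{Z}_{2q}[t,t']/(tt').$$ Thus there are two one-parameter families of measures: for a field $k$ of characteristic $0$ and $t\in k$, let $\mu_t^*$ be the composite of $\phi^*$ with the map $\mathbf{Z}_q[t]\to k$ sending the variable to $t$. Then all $\mu_t^{\rm even}$ and $\mu_t^{\rm odd}$ are measures, every $k$-valued measure is one of them, and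 they are pairwise distinct except for the coincidence $\mu_0^{\rm even}=\mu_0^{\rm odd}$. -/

import Mathlib

open Polynomial Filter

universe u v w

/-! ### Transitive smooth sets, measures and the universal measure ring -/

section Measures

variable (G : Type u) [Group G] (Ω : Type u) [MulAction G Ω]

/-- `X` is a transitive `Ω`-smooth `G`-set: it is non-empty, has a single orbit, and every point
stabilizer is the pointwise stabilizer `G(A)` of some finite subset `A` of `Ω`. -/
structure IsTransSmooth (X : Type u) [MulAction G X] : Prop where
  nonempty : Nonempty X
  pretransitive : MulAction.IsPretransitive G X
  smooth : ∀ x : X, ∃ A : Finset Ω, MulAction.stabilizer G x = fixingSubgroup G (A : Set Ω)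

/-- A bundled transitive `Ω`-smooth `G`-set. -/
structure TransSet where
  carrier : Type u
  [action : MulAction G carrier]
  isTransSmooth : IsTransSmooth G Ω carrier

instance : CoeSort (TransSet G Ω) (Type u) := ⟨TransSet.carrier⟩

instance (X : TransSet G Ω) : MulAction G X := X.action

theorem isTransSmooth_punit : IsTransSmooth G Ω PUnit.{u + 1} where
  nonempty := ⟨PUnit.unit⟩
  pretransitive := ⟨fun _ _ => ⟨1, rfl⟩⟩
  smooth := fun x => ⟨∅, by ext g; simp⟩

/-- The one-point `G`-set. -/
def TransSet.pt : TransSet G Ω := ⟨PUnit.{u + 1}, isTransSmooth_punit G Ω⟩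

variable {G Ω} in
/-- The unique map from `X` to the one-point `G`-set. -/
def TransSet.toPt (X : TransSet G Ω) : X →[G] (TransSet.pt G Ω) where
  toFun _ := PUnit.unit
  map_smul' _ _ := rfl

/-- A map `src → tgt` of transitive `Ω`-smooth `G`-sets. -/
structure TransMap where
  src : TransSet G Ω
  tgt : TransSet G Ω
  map : src →[G] tgt

variable {G Ω} in
/-- Given `f : Y → X` and `h : X' → X`, the maps `f' i : Y' i → X'`, together with
`h' i : Y' i → Y`, present the orbit decomposition of the base change `Y ×_X X' → X'` of `f`
along `h`: the induced map from the disjoint union of the (transitive) `Y' i` to `Y ×_X X'`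
is well defined and bijective. -/
def IsOrbitBaseChange {Y X X' : TransSet G Ω} (f : Y →[G] X) (h : X' →[G] X) {n : ℕ}
    (Y' : Fin n → TransSet G Ω) (f' : ∀ i, Y' i →[G] X') (h' : ∀ i, Y' i →[G] Y) : Prop :=
  (∀ i (y' : Y' i), f (h' i y') = h (f' i y')) ∧
  ∀ (y : Y) (x' : X'), f y = h x' →
    ∃! s : (Σ i, (Y' i : Type u)), h' s.1 s.2 = y ∧ f' s.1 s.2 = x'

variable {G Ω} in
/-- A measure for `G` relative to the stabilizer class of `Ω`, valued in `k`. -/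
structure IsMeasure {k : Type v} [CommRing k] (μ : TransMap G Ω → k) : Prop where
  iso : ∀ {Y X : TransSet G Ω} (f : Y →[G] X), Function.Bijective f → μ ⟨Y, X, f⟩ = 1
  comp : ∀ {Z Y X : TransSet G Ω} (f : Y →[G] X) (g : Z →[G] Y),
    μ ⟨Z, X, f.comp g⟩ = μ ⟨Y, X, f⟩ * μ ⟨Z, Y, g⟩
  baseChange : ∀ {Y X X' : TransSet G Ω} (f : Y →[G] X) (h : X' →[G] X) {n : ℕ}
    (Y' : Fin n → TransSet G Ω) (f' : ∀ i, Y' i →[G] X') (h' : ∀ i, Y' i →[G] Y),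
    IsOrbitBaseChange f h Y' f' h' → μ ⟨Y, X, f⟩ = ∑ i, μ ⟨Y' i, X', f' i⟩

/-- The relations imposed on the symbols `[f]` by the axioms of a measure. -/
inductive ThetaRel : MvPolynomial (TransMap G Ω) ℤ → Prop
  | iso {Y X : TransSet G Ω} (f : Y →[G] X) (hf : Function.Bijective f) :
      ThetaRel (MvPolynomial.X ⟨Y, X, f⟩ - 1)
  | comp {Z Y X : TransSet G Ω} (f : Y →[G] X) (g : Z →[G] Y) :
      ThetaRel (MvPolynomial.X ⟨Z, X, f.comp g⟩ -
        MvPolynomial.X ⟨Y, X, f⟩ * MvPolynomial.X ⟨Z, Y, g⟩)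
  | baseChange {Y X X' : TransSet G Ω} (f : Y →[G] X) (h : X' →[G] X) {n : ℕ}
      (Y' : Fin n → TransSet G Ω) (f' : ∀ i, Y' i →[G] X') (h' : ∀ i, Y' i →[G] Y)
      (hbc : IsOrbitBaseChange f h Y' f' h') :
      ThetaRel (MvPolynomial.X ⟨Y, X, f⟩ - ∑ i, MvPolynomial.X ⟨Y' i, X', f' i⟩)

/-- The ring `Θ(G, Ω)` carrying the universal measure: the polynomial ring on the symbols `[f]`
modulo the ideal generated by the axioms of a measure. -/
abbrev Theta : Type (u + 1) :=
  MvPolynomial (TransMap G Ω) ℤ ⧸ Ideal.span {p | ThetaRel G Ω p}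

variable {G Ω} in
/-- The class `[f]` in `Θ(G, Ω)`. -/
noncomputable def Theta.cls (f : TransMap G Ω) : Theta G Ω :=
  Ideal.Quotient.mk _ (MvPolynomial.X f)

variable {G Ω} in
/-- The class `[X]` in `Θ(G, Ω)` of a transitive set, that is, of the map from `X` to a point. -/
noncomputable def Theta.clsSet (X : TransSet G Ω) : Theta G Ω := Theta.cls ⟨X, _, X.toPt⟩

variable {G Ω} in
/-- `Hom_G(Δ, X)` is non-empty, and all fibres of `Hom_G(Δ, Y) → Hom_G(Δ, X)`, `ψ ↦ f ∘ ψ`, have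
exactly `n` elements. -/
def HasFiberCount (Δ : Type u) [MulAction G Δ] (f : TransMap G Ω) (n : ℕ) : Prop :=
  Nonempty (Δ →[G] f.tgt) ∧
    ∀ α : Δ →[G] f.tgt,
      Finite {ψ : Δ →[G] f.src // f.map.comp ψ = α} ∧
        Nat.card {ψ : Δ →[G] f.src // f.map.comp ψ = α} = n

end Measures

/-! ### Inverting integers -/

section Inverting

/-- `R[1/n]`. -/
abbrev InvNat (R : Type v) [CommRing R] (n : ℕ) : Type v := Localization.Away (n : R)

/-- The extension to `R[1/n]` of a ring homomorphism `R → S` for which `n` is a unit of `S`. -/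
noncomputable def InvNat.lift {R : Type v} [CommRing R] {S : Type w} [CommRing S] (n : ℕ)
    (ψ : R →+* S) (h : IsUnit (n : S)) : InvNat R n →+* S :=
  IsLocalization.Away.lift (n : R) (g := ψ) (by simpa using h)

theorem InvNat.isUnit_natCast (R : Type v) [CommRing R] (n : ℕ) :
    IsUnit ((n : ℕ) : InvNat R n) := by
  have h := IsLocalization.Away.algebraMap_isUnit (S := InvNat R n) (n : R)
  simpa using h

theorem InvNat.isUnit_of_dvd (R : Type v) [CommRing R] {m n : ℕ} (h : m ∣ n) :
    IsUnit ((m : ℕ) : InvNat R n) :=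
  isUnit_of_dvd_unit (Nat.cast_dvd_cast h) (InvNat.isUnit_natCast R n)

theorem isUnit_natCast_pair (S : Type v) [CommRing S] (n : ℕ) (h : IsUnit (n : S)) :
    IsUnit ((n : ℕ) : S[X] × S[X]) := by
  have h1 : IsUnit ((n : ℕ) : S[X]) := by
    simpa using h.map (Polynomial.C : S →+* S[X])
  exact Prod.isUnit_iff.2 ⟨by simpa using h1, by simpa using h1⟩

end Inverting

/-! ### Quadratic spaces and the infinite orthogonal group -/

section Orthogonal

variable {F : Type u} [Field F]

/-- Embeddings of quadratic spaces: injective linear maps that respect the forms. -/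
def QEmb {W : Type v} [AddCommGroup W] [Module F W] (B : LinearMap.BilinForm F W)
    {V : Type w} [AddCommGroup V] [Module F V] (C : LinearMap.BilinForm F V) : Type (max v w) :=
  {i : W →ₗ[F] V // Function.Injective i ∧ ∀ x y, C (i x) (i y) = B x y}

variable (F) in
/-- The space `𝐕` with basis `e_i, f_i`; here `e_i` and `f_i` are the basis vectors of index
`Sum.inl i` and `Sum.inr i`. -/
abbrev VInf : Type u := (ℕ ⊕ ℕ) →₀ F

variable (F) in
/-- The symmetric bilinear form on `𝐕` for which `⟨e_i, e_j⟩ = ⟨f_i, f_j⟩ = 0` and `⟨e_i, f_j⟩` is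
`1` if `i = j` and `0` otherwise: `⟨x, y⟩ = ∑ i, x i * y (swap i)`. -/
noncomputable def formInf : LinearMap.BilinForm F (VInf F) :=
  Finsupp.linearCombination F (fun i : ℕ ⊕ ℕ => (Finsupp.lapply i.swap : VInf F →ₗ[F] F))

theorem formInf_single (i j : ℕ ⊕ ℕ) (a b : F) :
    formInf F (Finsupp.single i a) (Finsupp.single j b) = if j = i.swap then a * b else 0 := by
  simp [formInf, Finsupp.single_apply]

variable (F) in
/-- The infinite orthogonal group: the linear automorphisms of `𝐕` that preserve the form. -/
def OInf : Subgroup (VInf F ≃ₗ[F] VInf F) where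
  carrier := {g | ∀ x y, formInf F (g x) (g y) = formInf F x y}
  mul_mem' {g h} hg hh x y := by
    rw [LinearEquiv.mul_apply, LinearEquiv.mul_apply, hg, hh]
  one_mem' _ _ := rfl
  inv_mem' {g} hg x y := by
    have h := hg (g⁻¹ x) (g⁻¹ y)
    rw [← LinearEquiv.mul_apply, ← LinearEquiv.mul_apply, mul_inv_cancel] at h
    exact h.symm

/-- The orthogonal group acts on embeddings into `𝐕` by composition. -/
noncomputable instance {W : Type v} [AddCommGroup W] [Module F W] (B : LinearMap.BilinForm F W) :
    MulAction (OInf F) (QEmb B (formInf F)) where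
  smul g i := ⟨(g : VInf F ≃ₗ[F] VInf F).toLinearMap ∘ₗ i.1,
    (g : VInf F ≃ₗ[F] VInf F).injective.comp i.2.1, fun x y => (g.2 _ _).trans (i.2.2 x y)⟩
  one_smul _ := rfl
  mul_smul _ _ _ := rfl

/-- The bilinear form of the quadratic space `V_{m,δ,n}`, on the vector space with basis
`Fin m ⊕ Fin n`. The basis is orthogonal; the last `n` basis vectors are isotropic and span the
nullspace, while the first `m` have norms `1, …, 1, (-1)^⌊m/2⌋ δ`, so that they span a
non-degenerate space of dimension `m` with modified discriminant
`(-1)^⌊m/2⌋ * ((-1)^⌊m/2⌋ δ) = δ`. (For `m = 0` the parameter `δ` plays no role.) -/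
noncomputable def stdForm (m : ℕ) (δ : Fˣ) (n : ℕ) :
    LinearMap.BilinForm F (Fin m ⊕ Fin n → F) :=
  Matrix.toBilin' (Matrix.diagonal (Sum.elim
    (fun i : Fin m => if (i : ℕ) + 1 = m then (-1) ^ (m / 2) * (δ : F) else 1) (fun _ => 0)))

/-- `X_{m,δ,n}`, the `G`-set of embeddings of `V_{m,δ,n}` into `𝐕`. -/
abbrev XSet (m : ℕ) (δ : Fˣ) (n : ℕ) : Type u := QEmb (stdForm m δ n) (formInf F)

/-- The number `N_{a,ε,b}^{ℓ,δ,n}` of embeddings `V_{a,ε,b} → V_{ℓ,δ,n}`. -/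
noncomputable def numEmb (a : ℕ) (ε : Fˣ) (b : ℕ) (l : ℕ) (δ : Fˣ) (n : ℕ) : ℕ :=
  Nat.card (QEmb (stdForm a ε b) (stdForm l δ n))

variable (F) [Fintype F]

/-- `ℤ[1/q]`, where `q` is the cardinality of `F`. -/
abbrev Zq : Type := InvNat ℤ (Fintype.card F)

/-- `ℤ[1/2q]`, where `q` is the cardinality of `F`. -/
abbrev Z2q : Type := InvNat ℤ (2 * Fintype.card F)

/-- The canonical map `ℤ[1/q] → ℤ[1/2q]`. -/
noncomputable def ZqToZ2q : Zq F →+* Z2q F :=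
  InvNat.lift _ (Int.castRingHom _) (InvNat.isUnit_of_dvd ℤ (Dvd.intro_left 2 rfl))

/-- The canonical map from `ℤ[1/q]` to a field of characteristic zero. -/
noncomputable def ZqToField (k : Type v) [Field k] [CharZero k] : Zq F →+* k :=
  InvNat.lift _ (Int.castRingHom k) (by simp)

/-- The ring `Θ(G, 𝐕)` for the infinite orthogonal group `G`. -/
abbrev ThetaO : Type (u + 1) := Theta (OInf F) (VInf F)

variable {F}

/-- `φ : Θ(G, 𝐕) → ℤ[1/q][t]` is the counting measure of the smooth approximation of `G` given by
the sets `Δ_r = X_{2r+s,1,0}`, `r ≥ 0` (so `s = 0` is the even case and `s = 1` the odd case), with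
counts written as polynomials in `t = q ^ r`: for every map `f : Y → X` of transitive
`𝐕`-smooth `G`-sets, the value of `φ [f]` at `q ^ r` is, for all but finitely many `r`, the common
cardinality of the fibres of `Hom_G(Δ_r, Y) → Hom_G(Δ_r, X)`. Moreover each `X_{a,ε,b}` is a
transitive `𝐕`-smooth `G`-set, and `φ` maps its class to the polynomial `P_{a,ε,b}` that satisfies
`P_{a,ε,b}(q ^ r) = N_{a,ε,b}^{2r+s,1,0}` for all `r`. -/
def IsCountingHom (s : ℕ) (φ : ThetaO F →+* (Zq F)[X]) : Prop :=
  (∀ f : TransMap (OInf F) (VInf F), ∀ᶠ r : ℕ in cofinite,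
    ∃ n : ℕ, HasFiberCount (XSet (2 * r + s) (1 : Fˣ) 0) f n ∧
      (φ (Theta.cls f)).eval ((Fintype.card F : Zq F) ^ r) = n) ∧
  ∀ (a : ℕ) (ε : Fˣ) (b : ℕ),
    ∃ h : IsTransSmooth (OInf F) (VInf F) (XSet a ε b), ∀ r : ℕ,
      (φ (Theta.clsSet ⟨XSet a ε b, h⟩)).eval ((Fintype.card F : Zq F) ^ r) =
        numEmb a ε b (2 * r + s) (1 : Fˣ) 0

/-- The homomorphism `Θ(G, 𝐕)[1/2q] → ℤ[1/2q][t] × ℤ[1/2q][t]` induced by a pair of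
homomorphisms `Θ(G, 𝐕) → ℤ[1/q][t]`. -/
noncomputable def pairHom (φ₀ φ₁ : ThetaO F →+* (Zq F)[X]) :
    InvNat (ThetaO F) (2 * Fintype.card F) →+* (Z2q F)[X] × (Z2q F)[X] :=
  InvNat.lift _
    (((Polynomial.mapRingHom (ZqToZ2q F)).comp φ₀).prod
      ((Polynomial.mapRingHom (ZqToZ2q F)).comp φ₁))
    (isUnit_natCast_pair _ _ (InvNat.isUnit_natCast ℤ _))

/-- The `k`-valued rule `μ_t` obtained by composing `φ` with the map `ℤ[1/q][t] → k` that sends the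
variable to the given element `t` of `k`. -/
noncomputable def muAt {k : Type v} [Field k] [CharZero k] (φ : ThetaO F →+* (Zq F)[X]) (t : k) :
    TransMap (OInf F) (VInf F) → k :=
  fun f => (φ (Theta.cls f)).eval₂ (ZqToField F k) t

end Orthogonal

/-! ### Witt's theorem for the infinite orthogonal group -/

section Witt

variable {F : Type u} [Field F]

/-! By Witt's theorem the orbit of a vector v ∉ span A under the pointwise stabilizer G(A) consists
of the vectors outside the span with the same norm as v and the same pairings with A. Every map of
transitive smooth sets is a composite of isomorphisms and one-vector extensions G/G(A ∪ {v}) →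
G/G(A), so a measure is determined by its values on such relative orbits. Base change turns these
values into a finitely additive, translation invariant valuation ν on the subsets of 𝐕 stable under
some G(A), with value 1 on points (`IsMeasure.toQVal`).

Such a valuation is governed by its level function c ↦ ν{⟨v, v⟩ = c}. Homotheties make it constant
on each square class of nonzero elements, so once 2q is invertible it is a combination of 1, χ and
qδ₀ − 1 with coefficients T/q, u and w (`IsMeasure.exists_param`); here χ is the quadratic character
and δ₀ the indicator function of 0. Passing to the complement of an isotropic vector only rescales
T; for an anisotropic vector a quadratic character sum exchanges the roles of u and w up to factors
(`QVal.ν_perp`). Hence the measure of every relative orbit is an explicit expression in 1/q, T, u, w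
(`QVal.ν_relOrbit`). Adjoining a plane along two different bases gives uw = 0 and T = q²w² + qu²
(`IsMeasure.param_relations`). So x ↦ qw, y ↦ u defines a surjection from ℤ[1/2q][x, y] onto Θ[1/2q]
that kills xy.

For the converse one counts. Lifts of a map Δ_r → X along a one-vector extension are the vectors of
a relative orbit lying in a split subspace of dimension 2r + s (`homFiber_step`). Counting vectors
there is a valuation of the same abstract kind, so the same formula applies, with (T, u, w) equal to
(t², 0, t/q) for s = 0 and (qt², t, 0) for s = 1, where t = q^r. The counts are thus polynomials in
t. They are nonzero, so Hom(Δ_r, X) is non-empty for almost all r, and identities between counts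
become identities between polynomials (`isMeasure_countPoly`).

The even counting measure sends (x, y) to (t, 0) and the odd one to (0, t). The composite of the
surjection with the pair is therefore the restriction of polynomials to the two coordinate axes,
with kernel (xy) and with image the pairs that agree at the origin. This identifies Θ[1/2q]; for
values in a field, xy = 0 forces one coordinate to vanish, which gives the two families. -/

theorem formInf_apply (x y : VInf F) : formInf F x y = x.sum fun i a => a * y i.swap := by
  simp [formInf, Finsupp.linearCombination_apply, Finsupp.sum, LinearMap.sum_apply]

theorem formInf_comm (x y : VInf F) : formInf F x y = formInf F y x := by
  induction x using Finsupp.induction_linear with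
  | zero => simp
  | add f g hf hg => simp [hf, hg]
  | single i a =>
    induction y using Finsupp.induction_linear with
    | zero => simp
    | add f g hf hg => simp [hf, hg]
    | single j b =>
      rw [formInf_single, formInf_single]
      have : j = i.swap ↔ i = j.swap := by
        constructor <;> (rintro rfl; simp)
      simp only [this, mul_comm]

theorem formInf_single_left (i : ℕ ⊕ ℕ) (a : F) (y : VInf F) :
    formInf F (Finsupp.single i a) y = a * y i.swap := by
  simp [formInf_apply]

theorem formInf_span_eq {s : Set (VInf F)} {v w : VInf F}
    (h : ∀ a ∈ s, formInf F v a = formInf F w a) :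
    ∀ a ∈ Submodule.span F s, formInf F v a = formInf F w a := by
  intro a ha
  induction ha using Submodule.span_induction with
  | mem x hx => exact h x hx
  | zero => simp
  | add x y _ _ hx hy => simp [hx, hy]
  | smul c x _ hx => simp [hx]

/-- Every linear functional agrees on a finitely generated subspace with pairing against a
vector. -/
theorem exists_formInf_eq (A : Finset (VInf F)) (φ : VInf F →ₗ[F] F) :
    ∃ v, ∀ a ∈ A, formInf F v a = φ a := by
  classical
  -- The basis vector dual to index `i` is the one of index `i.swap`; only indices in the supports
  -- of `A` matter.
  refine ⟨∑ i ∈ A.biUnion Finsupp.support,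
    Finsupp.single i.swap (φ (Finsupp.single i 1)), fun a ha => ?_⟩
  rw [map_sum, LinearMap.sum_apply]
  simp only [formInf_single_left, Sum.swap_swap]
  have hs : a.support ⊆ A.biUnion Finsupp.support := Finset.subset_biUnion_of_mem _ ha
  conv_rhs => rw [← Finsupp.sum_single a, Finsupp.sum, map_sum]
  rw [← Finset.sum_subset hs]
  · refine Finset.sum_congr rfl fun i _ => ?_
    rw [← mul_one (a i), ← smul_eq_mul (a i) 1, ← Finsupp.smul_single, map_smul]
    simp [mul_comm]
  · intro i _ hi
    simp [Finsupp.notMem_support_iff.1 hi]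

theorem exists_perp_one {A : Finset (VInf F)} {b : VInf F}
    (hb : b ∉ Submodule.span F (A : Set (VInf F))) :
    ∃ v, (∀ a ∈ A, formInf F v a = 0) ∧ formInf F v b = 1 := by
  classical
  obtain ⟨φ, hφ, hA⟩ := Submodule.exists_le_ker_of_notMem hb
  obtain ⟨v, hv⟩ := exists_formInf_eq (insert b A) φ
  refine ⟨(φ b)⁻¹ • v, fun a ha => ?_, ?_⟩
  · simp [hv a (Finset.mem_insert_of_mem ha),
      LinearMap.mem_ker.1 (hA (Submodule.subset_span ha))]
  · simp [hv b (Finset.mem_insert_self _ _), hφ]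

/-- The vector `e_N + (c/2) f_N` of norm `c`. -/
noncomputable def normVec (N : ℕ) (c : F) : VInf F :=
  Finsupp.single (Sum.inl N) 1 + Finsupp.single (Sum.inr N) (c / 2)

theorem formInf_normVec_left (N : ℕ) (c : F) (y : VInf F) :
    formInf F (normVec N c) y = y (Sum.inr N) + c / 2 * y (Sum.inl N) := by
  simp [normVec, formInf_single_left]

theorem formInf_normVec (N M : ℕ) (c d : F) :
    formInf F (normVec N c) (normVec M d) = if N = M then (c + d) / 2 else 0 := by
  rw [formInf_normVec_left]
  by_cases h : N = M
  · subst h; simp [normVec]; ring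
  · simp [normVec, h]

theorem exists_fresh_index (A : Finset (VInf F)) :
    ∃ N : ℕ, ∀ a ∈ Submodule.span F (A : Set (VInf F)), a (Sum.inl N) = 0 ∧ a (Sum.inr N) = 0 := by
  classical
  obtain ⟨N, hN⟩ := Infinite.exists_notMem_finset
    ((A.biUnion Finsupp.support).image (Sum.elim id id))
  refine ⟨N, fun a ha => ?_⟩
  induction ha using Submodule.span_induction with
  | mem x hx =>
    constructor <;>
    · by_contra h
      exact hN (Finset.mem_image.2 ⟨_, Finset.mem_biUnion.2 ⟨x, hx, Finsupp.mem_support_iff.2 h⟩,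
        rfl⟩)
  | zero => simp
  | add x y _ _ hx hy => simp [hx, hy]
  | smul c x _ hx => simp [hx]

/-- Any prescribed pairings with a finite set and any norm are realized outside of a given
finite-dimensional subspace. -/
theorem exists_extension (h2 : (2 : F) ≠ 0) (A : Finset (VInf F)) (v : VInf F) (c : F) :
    ∃ z, z ∉ Submodule.span F (A : Set (VInf F)) ∧
      (∀ a ∈ Submodule.span F (A : Set (VInf F)), formInf F z a = formInf F v a) ∧
      formInf F z z = c := by
  classical
  obtain ⟨N, hN⟩ := exists_fresh_index (insert v A)
  have hv := hN v (Submodule.subset_span (by simp))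
  have hA : ∀ a ∈ Submodule.span F (A : Set (VInf F)), a (Sum.inl N) = 0 ∧ a (Sum.inr N) = 0 :=
    fun a ha => hN a (Submodule.span_mono (by simp) ha)
  -- A hyperbolic plane not met by `A` and `v` absorbs the missing norm without disturbing the
  -- pairings.
  refine ⟨v + normVec N (c - formInf F v v), fun h => ?_, fun a ha => ?_, ?_⟩
  · simpa [normVec, hv] using (hA _ h).1
  · simp [formInf_normVec_left, hA a ha]
  · have h1 : formInf F v (normVec N (c - formInf F v v)) = 0 := by
      rw [formInf_comm, formInf_normVec_left]; simp [hv]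
    have h3 : formInf F (normVec N (c - formInf F v v)) v = 0 := by
      rw [formInf_comm, h1]
    simp only [map_add, LinearMap.add_apply, h1, h3, formInf_normVec]
    simp only [if_true, zero_add, add_zero]
    field_simp
    ring

theorem OInf.smul_def (g : OInf F) (v : VInf F) : g • v = (g : VInf F ≃ₗ[F] VInf F) v := rfl

theorem OInf.smul_add' (g : OInf F) (v w : VInf F) : g • (v + w) = g • v + g • w := by
  simp [OInf.smul_def]

theorem OInf.smul_sub' (g : OInf F) (v w : VInf F) : g • (v - w) = g • v - g • w := by
  simp [OInf.smul_def]

theorem OInf.smul_smul' (g : OInf F) (c : F) (v : VInf F) : g • (c • v) = c • (g • v) := by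
  simp [OInf.smul_def]

theorem OInf.form_smul (g : OInf F) (v w : VInf F) :
    formInf F (g • v) (g • w) = formInf F v w := g.2 v w

/-- Vectors fixed on a set are fixed on its span. -/
theorem OInf.smul_eq_of_span {g : OInf F} {s : Set (VInf F)} (h : ∀ a ∈ s, g • a = a) :
    ∀ a ∈ Submodule.span F s, g • a = a := by
  intro a ha
  induction ha using Submodule.span_induction with
  | mem x hx => exact h x hx
  | zero => simp
  | add x y _ _ hx hy => rw [OInf.smul_add', hx, hy]
  | smul c x _ hx => rw [OInf.smul_smul', hx]

/-- The reflection in v − w fixes everything orthogonal to v − w. Equal norms give 2⟨v − w, v⟩ = ⟨v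
− w, v − w⟩, so it carries v to w. -/
theorem exists_reflection {v w : VInf F} (hn : formInf F v v = formInf F w w)
    (hd : formInf F (v - w) (v - w) ≠ 0) :
    ∃ g : OInf F, (∀ a, formInf F v a = formInf F w a → g • a = a) ∧ g • v = w := by
  set d := v - w with hdef
  have hf : (2 / formInf F d d) • formInf F d d = 2 := by
    simp [div_mul_cancel₀ _ hd]
  let r : VInf F ≃ₗ[F] VInf F :=
    Module.reflection (f := (2 / formInf F d d) • formInf F d) (x := d) (by simpa using hf)
  have hr : ∀ x, r x = x - (2 / formInf F d d * formInf F d x) • d := fun x => by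
    simp [r, Module.reflection_apply]
  refine ⟨⟨r, fun x y => ?_⟩, fun a ha => ?_, ?_⟩
  · rw [hr, hr]
    simp only [map_sub, map_smul, LinearMap.sub_apply, LinearMap.smul_apply, smul_eq_mul]
    rw [formInf_comm x d]
    field_simp
    ring
  · change r a = a
    rw [hr, hdef]
    simp [ha]
  · change r v = w
    rw [hr]
    have : formInf F d d = 2 * formInf F d v := by
      simp only [hdef, map_sub, LinearMap.sub_apply, formInf_comm w v, hn]; ring
    have h3 : 2 / formInf F d d * formInf F d v = 1 := by
      rw [div_mul_eq_mul_div, ← this, div_self hd]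
    rw [h3, one_smul, hdef]; abel

/-- Witt's theorem for one additional vector. -/
theorem exists_smul_eq_of_type (h2 : (2 : F) ≠ 0) {A : Finset (VInf F)} {v w : VInf F}
    (hv : v ∉ Submodule.span F (A : Set (VInf F))) (hw : w ∉ Submodule.span F (A : Set (VInf F)))
    (hA : ∀ a ∈ A, formInf F v a = formInf F w a) (hn : formInf F v v = formInf F w w) :
    ∃ g : OInf F, (∀ a ∈ A, g • a = a) ∧ g • v = w := by
  classical
  -- The complement of A is not the union of its two proper subspaces orthogonal to v and to w.
  obtain ⟨z₀, h0, h0v, h0w⟩ : ∃ z, (∀ a ∈ A, formInf F z a = 0) ∧ formInf F z v ≠ 0 ∧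
      formInf F z w ≠ 0 := by
    obtain ⟨z₁, h1, h1v⟩ := exists_perp_one hv
    obtain ⟨z₂, h2, h2w⟩ := exists_perp_one hw
    by_cases h1w : formInf F z₁ w = 0
    · by_cases h2v : formInf F z₂ v = 0
      · exact ⟨z₁ + z₂, fun a ha => by simp [h1 a ha, h2 a ha], by simp [h1v, h2v],
          by simp [h1w, h2w]⟩
      · exact ⟨z₂, h2, h2v, by simp [h2w]⟩
    · exact ⟨z₁, h1, by simp [h1v], h1w⟩
  -- If v − w is isotropic, two reflections lead from v to w through v + z. This norm of z gives v +
  -- z the norm of v, and makes −z and v + z − w anisotropic, of norms −2⟨z₀, v⟩ and −2⟨z₀, w⟩.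
  obtain ⟨z, -, hz, hzz⟩ := exists_extension h2 (insert v (insert w A)) z₀ (-2 * formInf F z₀ v)
  have hzv : formInf F z v = formInf F z₀ v := hz v (Submodule.subset_span (by simp))
  have hzw : formInf F z w = formInf F z₀ w := hz w (Submodule.subset_span (by simp))
  have hza : ∀ a ∈ A, formInf F z a = 0 := fun a ha => by
    rw [hz a (Submodule.subset_span (by simp [ha])), h0 a ha]
  have hvz := formInf_comm v z
  have hwz := formInf_comm w z
  by_cases hd : formInf F (v - w) (v - w) = 0
  · obtain ⟨g₁, hg₁, hg₁v⟩ := exists_reflection (v := v) (w := v + z) (by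
      simp only [map_add, LinearMap.add_apply, hvz, hzv, hzz]; ring) (by
      simp only [sub_add_cancel_left, map_neg, LinearMap.neg_apply, hzz, neg_neg]
      simp [h2, h0v])
    obtain ⟨g₂, hg₂, hg₂v⟩ := exists_reflection (v := v + z) (w := w) (by
      simp only [map_add, LinearMap.add_apply, hvz, hzv, hzz, ← hn]; ring) (by
      have : formInf F (v + z - w) (v + z - w) = -2 * formInf F z w + formInf F (v - w) (v - w) := by
        simp only [map_add, map_sub, LinearMap.add_apply, LinearMap.sub_apply, hvz, hwz, hzz, ← hzv]
        ring
      rw [this, hd, hzw]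
      simp [h2, h0w])
    refine ⟨g₂ * g₁, fun a ha => ?_, ?_⟩
    · rw [mul_smul, hg₁ a (by simp [hza a ha]), hg₂ a (by simp [hza a ha, hA a ha])]
    · rw [mul_smul, hg₁v, hg₂v]
  · obtain ⟨g, hg, hgv⟩ := exists_reflection hn hd
    exact ⟨g, fun a ha => hg a (hA a ha), hgv⟩

theorem mem_fixingSubgroup_finset {A : Finset (VInf F)} {g : OInf F} :
    g ∈ fixingSubgroup (OInf F) (A : Set (VInf F)) ↔ ∀ a ∈ A, g • a = a := by
  simp [mem_fixingSubgroup_iff]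

/-- Stabilizers remember spans: a vector a outside the span of D can be moved by G(D) to a vector of
the same type that lies outside the span of D and a. -/
theorem mem_span_of_fixingSubgroup_le (h2 : (2 : F) ≠ 0) {A D : Finset (VInf F)}
    (h : fixingSubgroup (OInf F) (D : Set (VInf F)) ≤ fixingSubgroup (OInf F) (A : Set (VInf F))) :
    ∀ a ∈ A, a ∈ Submodule.span F (D : Set (VInf F)) := by
  classical
  intro a ha
  by_contra hd
  obtain ⟨z, hz, hza, hzz⟩ := exists_extension h2 (insert a D) a (formInf F a a)
  have hmono : Submodule.span F (D : Set (VInf F)) ≤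
      Submodule.span F ((insert a D : Finset (VInf F)) : Set (VInf F)) :=
    Submodule.span_mono (by simp)
  obtain ⟨g, hg, hga⟩ := exists_smul_eq_of_type h2 hd (fun h => hz (hmono h))
    (fun b hb => (hza b (hmono (Submodule.subset_span hb))).symm) hzz.symm
  have := mem_fixingSubgroup_finset.1 (h (mem_fixingSubgroup_finset.2 hg)) a ha
  rw [this] at hga
  exact hz (hga ▸ Submodule.subset_span (by simp))

end Witt

/-! ### Transitivity on embeddings of finite-dimensional spaces -/

section Embeddings

variable {F : Type u} [Field F]

theorem QEmb.smul_apply {W : Type v} [AddCommGroup W] [Module F W] {B : LinearMap.BilinForm F W}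
    (g : OInf F) (i : QEmb B (formInf F)) (x : W) : (g • i).1 x = g • i.1 x := rfl

/-- Witt's one-vector statement is applied along a basis: when g already matches the two embeddings
on some basis vectors, a correction fixing their images matches one more. -/
theorem exists_smul_eq_qEmb (h2 : (2 : F) ≠ 0) {W : Type v} [AddCommGroup W] [Module F W]
    [Module.Finite F W] {B : LinearMap.BilinForm F W} (i j : QEmb B (formInf F)) :
    ∃ g : OInf F, g • i = j := by
  classical
  let b := Module.finBasis F W
  have key : ∀ s : Finset (Fin (Module.finrank F W)), ∃ g : OInf F,
      ∀ k ∈ s, g • i.1 (b k) = j.1 (b k) := by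
    intro s
    induction s using Finset.induction_on with
    | empty => exact ⟨1, by simp⟩
    | insert k s hk ih =>
      obtain ⟨g, hg⟩ := ih
      have hnot : ∀ e : QEmb B (formInf F), e.1 (b k) ∉
          Submodule.span F ((s.image fun l => e.1 (b l) : Finset (VInf F)) : Set (VInf F)) := by
        intro e he
        have : (fun l => e.1 (b l)) = e.1 ∘ b := rfl
        rw [Finset.coe_image, this, Set.image_comp, Submodule.span_image] at he
        obtain ⟨x, hx, hxe⟩ := he
        rw [e.2.1 hxe] at hx
        exact b.linearIndependent.notMem_span_image (Finset.mem_coe.not.2 hk) hx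
      obtain ⟨h, hh, hh'⟩ := exists_smul_eq_of_type h2 (A := s.image fun l => j.1 (b l))
        (v := g • i.1 (b k)) (w := j.1 (b k)) (by
          have := hnot (g • i)
          have e1 : (s.image fun l => (g • i).1 (b l)) = s.image fun l => j.1 (b l) :=
            Finset.image_congr fun l hl => by simpa [QEmb.smul_apply] using hg l hl
          rwa [e1] at this) (hnot j) (by
          intro a ha
          obtain ⟨l, hl, rfl⟩ := Finset.mem_image.1 ha
          rw [j.2.2, ← hg l hl, OInf.form_smul, i.2.2]) (by
          rw [j.2.2, OInf.form_smul, i.2.2])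
      refine ⟨h * g, fun l hl => ?_⟩
      rw [mul_smul]
      rcases Finset.mem_insert.1 hl with rfl | hl
      · exact hh'
      · rw [hg l hl, hh _ (Finset.mem_image_of_mem _ hl)]
  obtain ⟨g, hg⟩ := key Finset.univ
  refine ⟨g, Subtype.ext (b.ext fun k => ?_)⟩
  rw [QEmb.smul_apply]
  exact hg k (Finset.mem_univ k)

theorem stdForm_apply (m : ℕ) (δ : Fˣ) (n : ℕ) (x y : Fin m ⊕ Fin n → F) :
    stdForm m δ n x y = ∑ i, (Sum.elim (fun i : Fin m =>
      if (i : ℕ) + 1 = m then (-1) ^ (m / 2) * (δ : F) else 1) (fun _ => 0) i : F) * x i * y i := by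
  rw [stdForm, Matrix.toBilin'_apply']
  simp only [dotProduct, Matrix.mulVec_diagonal]
  exact Finset.sum_congr rfl fun i _ => by ring

/-- Diagonal forms embed into `𝐕`. -/
theorem nonempty_qEmb_stdForm (h2 : (2 : F) ≠ 0) (m : ℕ) (δ : Fˣ) (n : ℕ) :
    Nonempty (XSet (F := F) m δ n) := by
  -- Each basis vector gets a hyperbolic plane of its own, in which `normVec` has the prescribed
  -- norm.
  let ι : Fin m ⊕ Fin n → ℕ := Sum.elim (fun i => (i : ℕ)) (fun i => m + i)
  have hι : Function.Injective ι := by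
    rintro (i | i) (j | j) h
    · exact congrArg Sum.inl (Fin.ext h)
    · have := i.2; simp [ι] at h; omega
    · have := j.2; simp [ι] at h; omega
    · simp [ι] at h; exact congrArg Sum.inr (Fin.ext h)
  let d : Fin m ⊕ Fin n → F := Sum.elim (fun i : Fin m =>
      if (i : ℕ) + 1 = m then (-1) ^ (m / 2) * (δ : F) else 1) (fun _ => 0)
  let e : (Fin m ⊕ Fin n → F) →ₗ[F] VInf F :=
    Fintype.linearCombination F (fun i => normVec (ι i) (d i))
  have he : ∀ x, e x = ∑ i, x i • normVec (ι i) (d i) := fun x =>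
    Fintype.linearCombination_apply F _ x
  refine ⟨⟨e, ?_, fun x y => ?_⟩⟩
  · rw [injective_iff_map_eq_zero]
    intro x hx
    ext i
    have := DFunLike.congr_fun hx (Sum.inl (ι i))
    rw [he, Finsupp.finsetSum_apply] at this
    simpa [normVec, Finsupp.single_apply, hι.eq_iff] using this
  · rw [he, he, stdForm_apply]
    simp only [map_sum, LinearMap.sum_apply, map_smul, LinearMap.smul_apply, smul_eq_mul,
      formInf_normVec, hι.eq_iff]
    refine Finset.sum_congr rfl fun i _ => ?_
    simp only [mul_ite, mul_zero, Finset.sum_ite_eq', Finset.mem_univ, if_true]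
    change _ = d i * _ * _
    field_simp
    ring

theorem stabilizer_qEmb {W : Type u} [AddCommGroup W] [Module F W] [Finite W]
    {B : LinearMap.BilinForm F W} (i : QEmb B (formInf F)) :
    MulAction.stabilizer (OInf F) i =
      fixingSubgroup (OInf F) ((Set.finite_range i.1).toFinset : Set (VInf F)) := by
  ext g
  rw [MulAction.mem_stabilizer_iff, mem_fixingSubgroup_finset]
  simp only [Set.Finite.mem_toFinset, Set.mem_range, forall_exists_index,
    forall_apply_eq_imp_iff]
  exact ⟨fun h x => LinearMap.congr_fun (congrArg Subtype.val h) x,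
    fun h => Subtype.ext (LinearMap.ext h)⟩

theorem isTransSmooth_xSet [Finite F] (h2 : (2 : F) ≠ 0) (m : ℕ) (δ : Fˣ) (n : ℕ) :
    IsTransSmooth (OInf F) (VInf F) (XSet (F := F) m δ n) where
  nonempty := nonempty_qEmb_stdForm h2 m δ n
  pretransitive := ⟨exists_smul_eq_qEmb h2⟩
  smooth i := ⟨_, stabilizer_qEmb i⟩

end Embeddings

/-! ### Quadratic character sums -/

section CharSums

variable {F : Type u} [Field F] [Fintype F]

open Classical in
/-- The quadratic character of `F` with values in a commutative ring. -/
noncomputable def chi (R : Type v) [CommRing R] (c : F) : R := ((quadraticChar F c : ℤ) : R)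

variable {R : Type v} [CommRing R]

theorem chi_zero : chi R (0 : F) = 0 := by simp [chi]

theorem chi_one : chi R (1 : F) = 1 := by simp [chi]

theorem chi_mul (a b : F) : chi R (a * b) = chi R a * chi R b := by
  classical
  rw [chi, map_mul, Int.cast_mul]; rfl

theorem chi_sq {a : F} (ha : a ≠ 0) : chi R (a * a) = 1 := by
  classical
  have := quadraticChar_sq_one' ha
  rw [pow_two] at this
  rw [chi, this, Int.cast_one]

theorem chi_mul_self {a : F} (ha : a ≠ 0) : chi R a * chi R a = 1 := by
  rw [← chi_mul, chi_sq ha]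

theorem chi_inv (a : F) : chi R a⁻¹ = chi R a := by
  by_cases ha : a = 0
  · simp [ha]
  · have h1 : chi R a * chi R a⁻¹ = 1 := by rw [← chi_mul, mul_inv_cancel₀ ha, chi_one]
    calc chi R a⁻¹ = (chi R a * chi R a) * chi R a⁻¹ := by rw [chi_mul_self ha, one_mul]
      _ = chi R a := by rw [mul_assoc, h1, mul_one]

theorem map_chi {S : Type w} [CommRing S] (f : R →+* S) (a : F) : f (chi R a) = chi S a := by
  simp [chi]

theorem ringChar_ne_two_of {F : Type u} [Field F] (h2 : (2 : F) ≠ 0) : ringChar F ≠ 2 := fun h => h2 (by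
  have := ringChar.Nat.cast_ringChar (R := F)
  rw [h] at this
  exact_mod_cast this)

theorem sum_chi (h2 : (2 : F) ≠ 0) : ∑ c : F, chi R c = 0 := by
  classical
  have := quadraticChar_sum_zero (ringChar_ne_two_of h2)
  have h := congrArg (Int.cast : ℤ → R) this
  push_cast at h
  simpa only [chi] using h

theorem sum_chi_affine (h2 : (2 : F) ≠ 0) {a : F} (ha : a ≠ 0) (b : F) :
    ∑ c : F, chi R (a * c + b) = 0 := by
  rw [← sum_chi (R := R) h2]
  exact Fintype.sum_equiv ((Equiv.mulLeft₀ a ha).trans (Equiv.addRight b)) _ _ fun _ => rfl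

open Classical in
theorem sum_ite_sq_eq (h2 : (2 : F) ≠ 0) (c : F) :
    ∑ y : F, (if y * y = c then (1 : R) else 0) = 1 + chi R c := by
  have h := quadraticChar_card_sqrts (ringChar_ne_two_of h2) c
  rw [Finset.sum_boole]
  have e : {x : F | x ^ 2 = c}.toFinset = Finset.univ.filter fun x => x * x = c := by
    ext x; simp [pow_two]
  rw [e] at h
  have := congrArg (Int.cast : ℤ → R) h
  push_cast at this
  rw [this, chi, add_comm]

theorem sum_comp_sq (h2 : (2 : F) ≠ 0) (f : F → R) :
    ∑ y : F, f (y * y) = ∑ z : F, (1 + chi R z) * f z := by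
  classical
  calc ∑ y : F, f (y * y) = ∑ y : F, ∑ z : F, (if y * y = z then (1 : R) else 0) * f z := by
        simp
    _ = ∑ z : F, (∑ y : F, if y * y = z then (1 : R) else 0) * f z := by
        rw [Finset.sum_comm]; simp only [Finset.sum_mul]
    _ = _ := by simp only [sum_ite_sq_eq h2]

open Classical in
theorem sum_ite_sub_sq_eq (h2 : (2 : F) ≠ 0) {α : F} (hα : α ≠ 0) (c : F) :
    ∑ y : F, (if c - α * (y * y) = 0 then (1 : R) else 0) = 1 + chi R α * chi R c := by
  rw [← chi_inv α, ← chi_mul, ← sum_ite_sq_eq h2]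
  refine Finset.sum_congr rfl fun y _ => ?_
  have : c - α * (y * y) = 0 ↔ y * y = α⁻¹ * c := by
    rw [sub_eq_zero, eq_inv_mul_iff_mul_eq₀ hα, eq_comm]
  simp only [this]

open Classical in
-- Substituting z = y² gives z the weight 1 + χ(z). The unweighted part is a vanishing affine sum.
-- For z ≠ 0 one has χ(z)χ(c − αz) = χ(c/z − α), affine in 1/z; with 0⁻¹ = 0 the term at z = 0 must
-- be subtracted, which accounts for −χ(−α).
theorem sum_chi_sub_sq (h2 : (2 : F) ≠ 0) {α : F} (hα : α ≠ 0) (c : F) :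
    ∑ y : F, chi R (c - α * (y * y)) =
      chi R (-α) * ((if c = 0 then (Fintype.card F : R) else 0) - 1) := by
  rw [sum_comp_sq h2 fun z => chi R (c - α * z)]
  have h0 : ∑ z : F, chi R (c - α * z) = 0 := by
    rw [← sum_chi_affine (R := R) h2 (neg_ne_zero.2 hα) c]
    exact Finset.sum_congr rfl fun z _ => by congr 1; ring
  simp only [add_mul, one_mul, Finset.sum_add_distrib, h0, zero_add]
  have key : ∀ z : F, chi R z * chi R (c - α * z) =
      chi R (c * z⁻¹ + -α) - if z = 0 then chi R (-α) else 0 := by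
    intro z
    by_cases hz : z = 0
    · simp [hz, chi_zero]
    · have : c - α * z = (c * z⁻¹ + -α) * z := by field_simp; ring
      rw [this, chi_mul, mul_left_comm, chi_mul_self hz]
      simp [hz]
  simp only [key, Finset.sum_sub_distrib, Finset.sum_ite_eq', Finset.mem_univ, if_true]
  by_cases hc : c = 0
  · simp [hc]; ring
  · have : ∑ z : F, chi R (c * z⁻¹ + -α) = 0 := by
      rw [← sum_chi_affine (R := R) h2 hc (-α)]
      exact Fintype.sum_equiv (Equiv.inv F) _ _ fun _ => rfl
    rw [this]; simp [hc]

end CharSums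

/-! ### Level functions and their convolutions -/

section Params

variable {F : Type u} [Field F] [Fintype F]

/-- Parameters for the measures of the level sets of a quadratic form. -/
@[ext] structure QParam (R : Type v) where
  T : R
  u : R
  w : R

variable {R : Type v} [CommRing R]

open Classical in
/-- The measure of the vectors of norm `c` in terms of the parameters; `qi` is the inverse of the
cardinality of the field. -/
noncomputable def QParam.val (qi : R) (p : QParam R) (c : F) : R :=
  p.T * qi + p.u * chi R c + p.w * ((if c = 0 then (Fintype.card F : R) else 0) - 1)

open Classical in
/-- The change of parameters upon passing to the orthogonal complement of a vector of norm `α`. -/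
noncomputable def QParam.step (qi : R) (α : F) (p : QParam R) : QParam R :=
  if α = 0 then ⟨p.T * qi, p.u, p.w⟩
  else ⟨p.T * qi, chi R (-α) * p.w, chi R α * p.u * qi⟩

/-- The change of parameters upon adding an orthogonal vector of norm `α ≠ 0`. -/
noncomputable def QParam.back (α : F) (p : QParam R) : QParam R :=
  ⟨Fintype.card F * p.T, Fintype.card F * chi R α * p.w, chi R (-α) * p.u⟩

/-- The parameters of the orthogonal complement of orthogonal vectors of given norms. -/
noncomputable def QParam.par (qi : R) (l : List F) (p : QParam R) : QParam R :=
  l.foldr (QParam.step qi) p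

theorem QParam.step_T (qi : R) (α : F) (p : QParam R) : (p.step qi α).T = p.T * qi := by
  unfold QParam.step; split_ifs <;> rfl

theorem QParam.par_T (qi : R) (l : List F) (p : QParam R) :
    (p.par qi l).T = p.T * qi ^ l.length := by
  induction l with
  | nil => simp [QParam.par]
  | cons a l ih =>
    change (QParam.step qi a (p.par qi l)).T = _
    rw [QParam.step_T, ih, List.length_cons, pow_succ, mul_assoc]

variable {qi : R}

/-- Both χ and qδ₀ − 1 have sum zero over the field, so T is the total measure. -/
theorem QParam.sum_val (h2 : (2 : F) ≠ 0) (hq : (Fintype.card F : R) * qi = 1) (p : QParam R) :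
    ∑ c : F, p.val qi c = p.T := by
  classical
  simp only [QParam.val, Finset.sum_add_distrib, ← Finset.mul_sum, sum_chi h2,
    Finset.sum_sub_distrib, Finset.sum_ite_eq', Finset.mem_univ, if_true]
  simp only [Finset.sum_const, Finset.card_univ, nsmul_eq_mul]
  linear_combination p.T * hq

/-- Convolution with the norms αy² of a line preserves the span of 1, χ and qδ₀ − 1 and exchanges
the last two up to factors: one direction is `sum_chi_sub_sq`, the other the count of square roots.
-/
theorem QParam.sum_val_sub_sq (h2 : (2 : F) ≠ 0)
    (p : QParam R) {α : F} (hα : α ≠ 0) (c : F) :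
    ∑ y : F, p.val qi (c - α * (y * y)) = (p.back α).val qi c := by
  classical
  have h1 := sum_chi_sub_sq (R := R) h2 hα c
  have h3 := sum_ite_sub_sq_eq (R := R) h2 hα c
  have h4 : ∑ y : F, (if c - α * (y * y) = 0 then (Fintype.card F : R) else 0) =
      Fintype.card F * (1 + chi R α * chi R c) := by
    rw [← h3, Finset.mul_sum]; simp
  simp only [QParam.val, Finset.sum_add_distrib, ← Finset.mul_sum, h1,
    Finset.sum_sub_distrib, h4, QParam.back]
  simp only [Finset.sum_const, Finset.card_univ, nsmul_eq_mul]
  ring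

/-- Averaging over the split plane. -/
theorem sum_sum_sq_sub_sq (h2 : (2 : F) ≠ 0) (Q : F → R) {α : F} (hα : α ≠ 0) (c : F) :
    ∑ y : F, ∑ x : F, Q (c + α * (y * y) - α * (x * x)) =
      Fintype.card F * Q c + (Fintype.card F - 1) * ∑ d : F, Q d := by
  classical
  -- With a = y − x the split form y² − x² becomes a(a + 2x), which for fixed a ≠ 0 takes every
  -- value once.
  have e1 : ∑ y : F, ∑ x : F, Q (c + α * (y * y) - α * (x * x)) =
      ∑ a : F, ∑ x : F, Q (c + α * (a * (a + 2 * x))) := by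
    rw [Finset.sum_comm, Finset.sum_comm (s := Finset.univ) (t := Finset.univ)
      (f := fun a x => Q (c + α * (a * (a + 2 * x))))]
    refine Finset.sum_congr rfl fun x _ => ?_
    refine Fintype.sum_equiv (Equiv.subRight x) _ _ fun y => ?_
    simp only [Equiv.subRight_apply]
    congr 1; ring
  have e2 : ∀ a : F, ∑ x : F, Q (c + α * (a * (a + 2 * x))) =
      if a = 0 then Fintype.card F * Q c else ∑ d : F, Q d := by
    intro a
    by_cases ha : a = 0
    · simp [ha]
    · rw [if_neg ha]
      have hb : α * a * 2 ≠ 0 := by simp [hα, ha, h2]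
      refine Fintype.sum_equiv ((Equiv.mulLeft₀ _ hb).trans (Equiv.addRight (c + α * a * a)))
        _ _ fun x => ?_
      simp only [Equiv.trans_apply, Equiv.mulLeft₀_apply, Equiv.coe_addRight]
      congr 1; ring
  rw [e1]
  simp only [e2]
  rw [← Finset.add_sum_erase _ _ (Finset.mem_univ (0 : F)), if_pos rfl]
  rw [Finset.sum_congr rfl (g := fun _ => ∑ d : F, Q d)
    (fun a ha => if_neg (Finset.ne_of_mem_erase ha))]
  rw [Finset.sum_const, Finset.card_erase_of_mem (Finset.mem_univ _), Finset.card_univ,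
    nsmul_eq_mul, Nat.cast_sub Fintype.card_pos, Nat.cast_one]

/-- The convolution in `hQ` can be inverted: a further convolution with the norms of −α amounts to
adding a hyperbolic plane, which turns Q into qQ + (q − 1)∑Q by `sum_sum_sq_sub_sq`, and q is
invertible. -/
theorem QParam.eq_val_step (h2 : (2 : F) ≠ 0) (hq : (Fintype.card F : R) * qi = 1)
    (p : QParam R) {α : F} (hα : α ≠ 0) (Q : F → R) (hT : ∑ d, Q d = p.T * qi)
    (hQ : ∀ c, p.val qi c = ∑ y : F, Q (c - α * (y * y))) (c : F) :
    Q c = (p.step qi α).val qi c := by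
  classical
  have h := sum_sum_sq_sub_sq h2 Q hα c
  simp only [← hQ] at h
  have h3 := p.sum_val_sub_sq (qi := qi) h2 (neg_ne_zero.2 hα) c
  simp only [neg_mul, sub_neg_eq_add] at h3
  rw [h3, hT] at h
  have h4 : Q c = qi * (Fintype.card F * Q c) := by linear_combination (-Q c) * hq
  rw [h4]
  simp only [QParam.val, QParam.back, neg_neg] at h
  simp only [QParam.val, QParam.step, hα, if_false]
  have h5 : (Fintype.card F : R) * Q c = Fintype.card F * p.T * qi +
      Fintype.card F * chi R (-α) * p.w * chi R c + chi R α * p.u *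
        ((if c = 0 then (Fintype.card F : R) else 0) - 1) -
        (Fintype.card F - 1) * (p.T * qi) := by rw [h]; ring
  rw [h5]
  linear_combination (chi R (-α) * p.w * chi R c) * hq

theorem QParam.map_val {S : Type w} [CommRing S] (f : R →+* S) (p : QParam R) (c : F) :
    f (p.val qi c) = QParam.val (f qi) ⟨f p.T, f p.u, f p.w⟩ c := by
  classical
  simp only [QParam.val, map_add, map_mul, map_sub, map_one, map_chi]
  congr 3
  split_ifs <;> simp

/-- The image of parameters under a ring homomorphism. -/
def QParam.map {S : Type w} [CommRing S] (f : R →+* S) (p : QParam R) : QParam S :=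
  ⟨f p.T, f p.u, f p.w⟩

theorem QParam.map_par {S : Type w} [CommRing S] (f : R →+* S) (p : QParam R) (l : List F) :
    (p.par qi l).map f = (p.map f).par (f qi) l := by
  induction l with
  | nil => rfl
  | cons a l ih =>
    change (QParam.step qi a (p.par qi l)).map f = QParam.step (f qi) a ((p.map f).par (f qi) l)
    rw [← ih]
    unfold QParam.step
    split_ifs <;> simp [QParam.map, map_chi]

end Params

/-! ### Finitely additive translation invariant valuations on a quadratic space -/

section Valuation

variable {F : Type u} [Field F] {V : Type w} [AddCommGroup V] [Module F V]

/-- A finitely additive valuation on sets of vectors, invariant under translation by the vectors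
of a subspace `W` on which the form is non-degenerate. -/
structure QVal (B : LinearMap.BilinForm F V) (W : Submodule F V) (R : Type v) [CommRing R] where
  dom : Set V → Prop
  ν : Set V → R
  symm : ∀ x y, B x y = B y x
  rep : ∀ (l : List V) (b : V), (∀ a ∈ l, a ∈ W) → b ∈ W → b ∉ Submodule.span F {x | x ∈ l} →
    ∃ v ∈ W, (∀ a ∈ l, B v a = 0) ∧ B v b = 1
  dom_inter : ∀ {S S'}, dom S → dom S' → dom (S ∩ S')
  dom_compl : ∀ {S}, dom S → dom Sᶜ
  dom_form : ∀ a ∈ W, ∀ d, dom {v | B v a = d}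
  dom_norm : ∀ c, dom {v | B v v = c}
  dom_point : ∀ v ∈ W, dom {v}
  add : ∀ {S S'}, dom S → dom S' → Disjoint S S' → ν (S ∪ S') = ν S + ν S'
  transl : ∀ {S} (x : V), dom S → x ∈ W → ν {v | v + x ∈ S} = ν S
  point : ∀ v ∈ W, ν {v} = 1

/-- Lists of pairwise orthogonal linearly independent vectors. -/
def GoodList (B : LinearMap.BilinForm F V) : List V → Prop
  | [] => True
  | b :: l => GoodList B l ∧ (∀ a ∈ l, B b a = 0) ∧ b ∉ Submodule.span F {x | x ∈ l}

theorem form_span {B : LinearMap.BilinForm F V} {l : List V} {v : V} {f : V →ₗ[F] F} (h : ∀ a ∈ l, B v a = f a) :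
    ∀ a ∈ Submodule.span F {x | x ∈ l}, B v a = f a := by
  intro a ha
  induction ha using Submodule.span_induction with
  | mem x hx => exact h x hx
  | zero => simp
  | add x y _ _ hx hy => simp [hx, hy]
  | smul c x _ hx => simp [hx]

namespace QVal

variable {B : LinearMap.BilinForm F V} {W : Submodule F V} {R : Type v} [CommRing R]
  (M : QVal B W R)

theorem dom_empty : M.dom ∅ := by
  have := M.dom_inter (M.dom_norm 0) (M.dom_compl (M.dom_norm 0))
  rwa [Set.inter_compl_self] at this

theorem dom_univ : M.dom Set.univ := by
  have := M.dom_compl M.dom_empty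
  rwa [Set.compl_empty] at this

theorem dom_union {S S' : Set V} (h : M.dom S) (h' : M.dom S') : M.dom (S ∪ S') := by
  have := M.dom_compl (M.dom_inter (M.dom_compl h) (M.dom_compl h'))
  rwa [← Set.compl_union, compl_compl] at this

theorem ν_empty : M.ν ∅ = 0 := by
  have := M.add M.dom_empty M.dom_empty (disjoint_bot_left)
  simpa using this

theorem dom_list {l : List V} (hl : ∀ a ∈ l, a ∈ W) (f : V → F) :
    M.dom {v | ∀ a ∈ l, B v a = f a} := by
  induction l with
  | nil => simpa using M.dom_univ
  | cons b l ih =>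
    have := M.dom_inter (M.dom_form b (hl b (by simp)) (f b))
      (ih fun a ha => hl a (by simp [ha]))
    convert this using 1
    ext v; simp

theorem dom_list_norm {l : List V} (hl : ∀ a ∈ l, a ∈ W) (f : V → F) (c : F) :
    M.dom {v | (∀ a ∈ l, B v a = f a) ∧ B v v = c} :=
  M.dom_inter (M.dom_list hl f) (M.dom_norm c)

theorem dom_finite {S : Set V} (hS : S.Finite) (hW : S ⊆ W) : M.dom S := by
  induction S, hS using Set.Finite.induction_on with
  | empty => exact M.dom_empty
  | insert _ _ ih =>
    rw [Set.insert_eq]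
    exact M.dom_union (M.dom_point _ (hW (Set.mem_insert _ _)))
      (ih ((Set.subset_insert _ _).trans hW))

theorem ν_finite {S : Set V} (hS : S.Finite) (hW : S ⊆ W) : M.ν S = S.ncard := by
  induction S, hS using Set.Finite.induction_on with
  | empty => simp [M.ν_empty]
  | @insert a s ha hs ih =>
    have h1 := (Set.subset_insert a s).trans hW
    rw [Set.ncard_insert_of_notMem ha hs, Set.insert_eq,
      M.add (M.dom_point a (hW (Set.mem_insert _ _))) (M.dom_finite hs h1)
        (Set.disjoint_singleton_left.2 ha), ih h1, M.point a (hW (Set.mem_insert _ _))]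
    push_cast; ring

theorem ν_diff {S S' : Set V} (h : M.dom S) (h' : M.dom S') (hsub : S' ⊆ S) :
    M.ν (S \ S') = M.ν S - M.ν S' := by
  have := M.add h' (M.dom_inter h (M.dom_compl h')) (by
    rw [← Set.sdiff_eq]; exact Set.disjoint_sdiff_right)
  rw [← Set.sdiff_eq, Set.union_sdiff_cancel hsub] at this
  rw [this]; ring

/-- Additivity over a finite partition. -/
theorem ν_eq_sum {ι : Type*} [Fintype ι] {S : Set V} (h : V → ι) (hS : M.dom S)
    (hd : ∀ i, M.dom {v | h v = i}) : M.ν S = ∑ i, M.ν (S ∩ {v | h v = i}) := by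
  classical
  have key : ∀ s : Finset ι, M.dom (S ∩ {v | h v ∈ s}) ∧
      M.ν (S ∩ {v | h v ∈ s}) = ∑ i ∈ s, M.ν (S ∩ {v | h v = i}) := by
    intro s
    induction s using Finset.induction_on with
    | empty => simp [M.ν_empty, M.dom_empty]
    | insert i s hi ih =>
      have e : S ∩ {v | h v ∈ insert i s} = S ∩ {v | h v = i} ∪ S ∩ {v | h v ∈ s} := by
        ext v; simp only [Set.mem_inter_iff, Set.mem_ofPred_eq, Finset.mem_insert, Set.mem_union]
        tauto
      have hdi := M.dom_inter hS (hd i)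
      refine ⟨e ▸ M.dom_union hdi ih.1, ?_⟩
      rw [e, M.add hdi ih.1, ih.2, Finset.sum_insert hi]
      rw [Set.disjoint_left]
      rintro v ⟨_, hv⟩ ⟨_, hv'⟩
      exact hi (hv ▸ hv')
  have := (key Finset.univ).2
  simpa using this

variable [Fintype F] {qi : R}

/-- The measure of an affine subspace cut out by independent linear conditions. -/
theorem ν_affine (hq : (Fintype.card F : R) * qi = 1) {l : List V} (hl : ∀ a ∈ l, a ∈ W)
    (hg : GoodList B l) (f : V → F) :
    M.ν {v | ∀ a ∈ l, B v a = f a} = M.ν Set.univ * qi ^ l.length := by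
  induction l generalizing f with
  | nil => simp
  | cons b l ih =>
    have hl' : ∀ a ∈ l, a ∈ W := fun a ha => hl a (by simp [ha])
    have hb : b ∈ W := hl b (by simp)
    obtain ⟨z, hz, hza, hzb⟩ := M.rep l b hl' hb hg.2.2
    have h1 := M.ν_eq_sum (fun v => B v b) (M.dom_list hl' f) (M.dom_form b hb)
    have h3 : ∀ d, M.ν ({v | ∀ a ∈ l, B v a = f a} ∩ {v | B v b = d}) =
        M.ν {v | ∀ a ∈ b :: l, B v a = f a} := by
      intro d
      -- Since z is orthogonal to l and pairs to 1 with b, the q slices ⟨v, b⟩ = d are translates of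
      -- one another.
      rw [← M.transl ((d - f b) • z) (M.dom_inter (M.dom_list hl' f) (M.dom_form b hb d))
        (W.smul_mem _ hz)]
      congr 1
      ext v
      simp only [Set.mem_ofPred_eq, Set.mem_inter_iff, List.forall_mem_cons, map_add, map_smul,
        LinearMap.add_apply, LinearMap.smul_apply, hzb, smul_eq_mul, mul_one]
      rw [and_comm]
      refine and_congr ⟨fun h => by linear_combination h, fun h => by linear_combination h⟩
        (forall₂_congr fun a ha => by rw [hza a ha, mul_zero, add_zero])
    simp only [h3, Finset.sum_const, Finset.card_univ, nsmul_eq_mul] at h1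
    rw [ih hl' hg.1] at h1
    rw [List.length_cons, pow_succ, ← mul_assoc, h1]
    linear_combination (-M.ν {v | ∀ a ∈ b :: l, B v a = f a}) * hq

/-- If a linear condition is imposed with respect to a radical vector, then all norms are equally
frequent. -/
theorem ν_affine_norm (h2 : (2 : F) ≠ 0) (hq : (Fintype.card F : R) * qi = 1) {l : List V}
    (hl : ∀ a ∈ l, a ∈ W) (hg : GoodList B l) (f : V →ₗ[F] F) {r : V}
    (hr : r ∈ Submodule.span F {x | x ∈ l}) (hperp : ∀ a ∈ l, B r a = 0) (hf : f r ≠ 0) (c : F) :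
    M.ν {v | (∀ a ∈ l, B v a = f a) ∧ B v v = c} = M.ν Set.univ * qi ^ (l.length + 1) := by
  have hrW : r ∈ W := Submodule.span_le.2 (fun a ha => hl a ha) hr
  have hrr : B r r = 0 := form_span (f := 0) (by simpa using hperp) r hr
  have h1 := M.ν_eq_sum (fun v => B v v) (M.dom_list hl f) M.dom_norm
  have h3 : ∀ d, M.ν ({v | ∀ a ∈ l, B v a = f a} ∩ {v | B v v = d}) =
        M.ν {v | (∀ a ∈ l, B v a = f a) ∧ B v v = c} := by
    intro d
    -- Adding s·r keeps the pairings with l and changes the norm by 2s·f(r), because r is isotropic;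
    -- so all norm levels are translates of one another.
    rw [← M.transl (((d - c) / (2 * f r)) • r)
      (M.dom_inter (M.dom_list hl f) (M.dom_norm d)) (W.smul_mem _ hrW)]
    congr 1
    ext v
    simp only [Set.mem_ofPred_eq, Set.mem_inter_iff]
    have e : ∀ a ∈ l, B (v + ((d - c) / (2 * f r)) • r) a = B v a := fun a ha => by
      simp [hperp a ha]
    rw [show (∀ a ∈ l, B (v + ((d - c) / (2 * f r)) • r) a = f a) ↔ ∀ a ∈ l, B v a = f a from
      forall₂_congr fun a ha => by rw [e a ha]]
    refine and_congr_right fun hv => ?_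
    have h4 : B v r = f r := form_span hv r hr
    simp only [map_add, map_smul, LinearMap.add_apply, LinearMap.smul_apply, smul_eq_mul, hrr,
      M.symm r v, h4]
    have : B v v + (d - c) / (2 * f r) * f r + (d - c) / (2 * f r) * (f r +
        (d - c) / (2 * f r) * 0) = B v v + (d - c) := by field_simp; ring
    rw [this]
    exact ⟨fun h => by linear_combination h, fun h => by linear_combination h⟩
  simp only [h3, Finset.sum_const, Finset.card_univ, nsmul_eq_mul] at h1
  rw [M.ν_affine hq hl hg] at h1
  rw [pow_succ, ← mul_assoc, h1]
  linear_combination (-M.ν {v | (∀ a ∈ l, B v a = f a) ∧ B v v = c}) * hq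

theorem ν_univ (h2 : (2 : F) ≠ 0) (hq : (Fintype.card F : R) * qi = 1) {p : QParam R}
    (hp : ∀ c, M.ν {v | B v v = c} = p.val qi c) : M.ν Set.univ = p.T := by
  rw [M.ν_eq_sum (fun v => B v v) M.dom_univ M.dom_norm, ← p.sum_val h2 hq]
  exact Finset.sum_congr rfl fun c _ => by rw [Set.univ_inter, hp]

/-- The level sets of the orthogonal complement of finitely many orthogonal vectors. -/
theorem ν_perp (h2 : (2 : F) ≠ 0) (hq : (Fintype.card F : R) * qi = 1) {p : QParam R}
    (hp : ∀ c, M.ν {v | B v v = c} = p.val qi c) {l : List V}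
    (hl : ∀ a ∈ l, a ∈ W) (hg : GoodList B l) (c : F) :
    M.ν {v | (∀ a ∈ l, B v a = 0) ∧ B v v = c} =
      (p.par qi (l.map fun a => B a a)).val qi c := by
  classical
  induction l generalizing c with
  | nil => simpa [QParam.par] using hp c
  | cons b l ih =>
    have hl' : ∀ a ∈ l, a ∈ W := fun a ha => hl a (by simp [ha])
    have hb : b ∈ W := hl b (by simp)
    replace ih := ih hl' hg.1
    set p' := p.par qi (l.map fun a => B a a) with hp'
    have hT : p'.T = M.ν Set.univ * qi ^ l.length := by
      rw [hp', QParam.par_T, M.ν_univ h2 hq hp, List.length_map]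
    change _ = (p'.step qi (B b b)).val qi c
    have hdom : ∀ c, M.dom {v | (∀ a ∈ l, B v a = 0) ∧ B v v = c} :=
      M.dom_list_norm hl' fun _ => 0
    by_cases hα : B b b = 0
    -- An isotropic b is radical for b :: l. By `ν_affine_norm` the q − 1 slices ⟨v, b⟩ = d ≠ 0 have
    -- a measure independent of the norm; subtracting them leaves the slice d = 0.
    · have h1 := M.ν_eq_sum (fun v => B v b) (hdom c) (M.dom_form b hb)
      rw [← Finset.add_sum_erase _ _ (Finset.mem_univ (0 : F))] at h1
      have h0 : ({v | (∀ a ∈ l, B v a = 0) ∧ B v v = c} ∩ {v | B v b = 0}) =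
          {v | (∀ a ∈ b :: l, B v a = 0) ∧ B v v = c} := by
        ext v; simp only [Set.mem_inter_iff, Set.mem_ofPred_eq, List.forall_mem_cons]; tauto
      have h3 : ∀ d ∈ Finset.univ.erase (0 : F),
          M.ν ({v | (∀ a ∈ l, B v a = 0) ∧ B v v = c} ∩ {v | B v b = d}) =
            M.ν Set.univ * qi ^ (l.length + 2) := by
        intro d hd
        obtain ⟨z, hz, hza, hzb⟩ := M.rep l b hl' hb hg.2.2
        refine Eq.trans ?_ (M.ν_affine_norm h2 hq hl hg (d • B z) (r := b) (Submodule.subset_span (by simp))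
          (by
            intro a ha
            rcases List.mem_cons.1 ha with rfl | ha
            · exact hα
            · exact hg.2.1 a ha) (by simpa [hzb] using Finset.ne_of_mem_erase hd) c)
        congr 1
        ext v
        simp only [Set.mem_inter_iff, Set.mem_ofPred_eq, List.forall_mem_cons,
          LinearMap.smul_apply, hzb, smul_eq_mul, mul_one]
        have : (∀ a ∈ l, B v a = d * B z a) ↔ ∀ a ∈ l, B v a = 0 :=
          forall₂_congr fun a ha => by rw [hza a ha, mul_zero]
        rw [this]; tauto
      rw [Finset.sum_congr rfl h3, Finset.sum_const,
        Finset.card_erase_of_mem (Finset.mem_univ _), Finset.card_univ, nsmul_eq_mul,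
        Nat.cast_sub Fintype.card_pos, Nat.cast_one, h0, ih c] at h1
      have h4 : M.ν {v | (∀ a ∈ b :: l, B v a = 0) ∧ B v v = c} = p'.val qi c -
          (Fintype.card F - 1) * (M.ν Set.univ * qi ^ (l.length + 2)) := by rw [h1]; ring
      rw [h4]
      simp only [QParam.val, QParam.step, hα, if_true, hT]
      linear_combination (-M.ν Set.univ * qi ^ l.length * qi) * hq
    · have hbb : ∀ y : F, ∀ v, B (v + y • b) (v + y • b) = B v v + 2 * y * B v b + y * y * B b b :=
        fun y v => by
          simp only [map_add, map_smul, LinearMap.add_apply, LinearMap.smul_apply, smul_eq_mul,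
            M.symm b v]; ring
      -- An anisotropic b splits off: v is y·b plus a vector orthogonal to b. The known level
      -- function is thus the convolution of the wanted one with the norms of a line.
      refine p'.eq_val_step h2 hq hα
        (fun c => M.ν {v | (∀ a ∈ b :: l, B v a = 0) ∧ B v v = c}) ?_ (fun c => ?_) c
      · rw [hT, mul_assoc, ← pow_succ, ← List.length_cons (a := b),
          ← M.ν_affine hq hl hg fun _ => 0,
          M.ν_eq_sum (fun v => B v v) (M.dom_list hl fun _ => 0) M.dom_norm]
        rfl
      · rw [← ih c, M.ν_eq_sum (fun v => B v b) (hdom c) (M.dom_form b hb)]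
        refine (Fintype.sum_equiv (Equiv.mulLeft₀ _ hα) _ _ fun y => ?_).symm
        simp only [Equiv.mulLeft₀_apply]
        rw [← M.transl (y • b) (M.dom_inter (hdom c) (M.dom_form b hb _)) (W.smul_mem _ hb)]
        congr 1
        ext v
        simp only [Set.mem_inter_iff, Set.mem_ofPred_eq, List.forall_mem_cons, hbb]
        have e : (∀ a ∈ l, B (v + y • b) a = 0) ↔ ∀ a ∈ l, B v a = 0 :=
          forall₂_congr fun a ha => by simp [hg.2.1 a ha]
        rw [e]
        have e2 : B (v + y • b) b = B b b * y ↔ B v b = 0 := by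
          simp only [map_add, map_smul, LinearMap.add_apply, LinearMap.smul_apply, smul_eq_mul]
          exact ⟨fun h => by linear_combination h, fun h => by linear_combination h⟩
        rw [e2]
        constructor
        · rintro ⟨⟨h, h'⟩, h''⟩
          exact ⟨⟨h', by rw [h, h'']; ring⟩, h⟩
        · rintro ⟨⟨h, h'⟩, h''⟩
          refine ⟨⟨h'', h⟩, ?_⟩
          rw [h''] at h'
          linear_combination h'

end QVal

end Valuation

/-! ### Orbits of vectors under pointwise stabilizers and their measures -/

section StepData

variable {F : Type u} [Field F]

/-- The orbit of `v` under the pointwise stabilizer of `A`. -/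
abbrev relOrbit (A : Finset (VInf F)) (v : VInf F) : Set (VInf F) :=
  MulAction.orbit (fixingSubgroup (OInf F) (A : Set (VInf F))) v

theorem mem_relOrbit {A : Finset (VInf F)} {v x : VInf F} :
    x ∈ relOrbit A v ↔ ∃ g : OInf F, (∀ a ∈ A, g • a = a) ∧ g • v = x := by
  constructor
  · rintro ⟨⟨g, hg⟩, rfl⟩
    exact ⟨g, mem_fixingSubgroup_finset.1 hg, rfl⟩
  · rintro ⟨g, hg, rfl⟩
    exact ⟨⟨g, mem_fixingSubgroup_finset.2 hg⟩, rfl⟩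

theorem relOrbit_of_mem {A : Finset (VInf F)} {v : VInf F}
    (hv : v ∈ Submodule.span F (A : Set (VInf F))) : relOrbit A v = {v} := by
  ext x
  rw [mem_relOrbit, Set.mem_singleton_iff]
  constructor
  · rintro ⟨g, hg, rfl⟩
    exact OInf.smul_eq_of_span hg v hv
  · rintro rfl
    exact ⟨1, by simp, by simp⟩

theorem relOrbit_of_notMem (h2 : (2 : F) ≠ 0) {A : Finset (VInf F)} {v : VInf F}
    (hv : v ∉ Submodule.span F (A : Set (VInf F))) :
    relOrbit A v = {x | (∀ a ∈ A, formInf F x a = formInf F v a) ∧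
      formInf F x x = formInf F v v} \ (Submodule.span F (A : Set (VInf F)) : Set (VInf F)) := by
  ext x
  rw [mem_relOrbit]
  constructor
  · rintro ⟨g, hg, rfl⟩
    refine ⟨⟨fun a ha => ?_, OInf.form_smul g v v⟩, fun h => hv ?_⟩
    · conv_lhs => rw [← hg a ha]
      exact OInf.form_smul g v a
    · have h1 : g⁻¹ • (g • v) = g • v := OInf.smul_eq_of_span (s := (A : Set (VInf F)))
        (fun a ha => by rw [inv_smul_eq_iff, hg a ha]) _ h
      rw [inv_smul_smul] at h1
      rw [h1]; exact h
  · rintro ⟨⟨h1, h3⟩, h4⟩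
    exact exists_smul_eq_of_type h2 hv h4 (fun a ha => (h1 a ha).symm) h3.symm

theorem finite_span [Finite F] (A : Finset (VInf F)) :
    (Submodule.span F (A : Set (VInf F)) : Set (VInf F)).Finite := by
  have : Finite (Submodule.span F (A : Set (VInf F))) := Module.finite_of_finite F
  exact Set.toFinite _

theorem goodList_map_of_ortho {V : Type w} [AddCommGroup V] [Module F V]
    {B : LinearMap.BilinForm F V} {ι : Type*} {b : ι → V} (hb : LinearIndependent F b)
    (ho : ∀ i j, i ≠ j → B (b i) (b j) = 0) {L : List ι} (hL : L.Nodup) :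
    GoodList B (L.map b) := by
  induction L with
  | nil => trivial
  | cons i L ih =>
    rw [List.nodup_cons] at hL
    refine ⟨ih hL.2, fun a ha => ?_, fun h => ?_⟩
    · obtain ⟨j, hj, rfl⟩ := List.mem_map.1 ha
      exact ho i j fun h => hL.1 (h ▸ hj)
    · have e : {x | x ∈ L.map b} = b '' {x | x ∈ L} := by
        ext x; simp
      rw [e] at h
      exact hb.notMem_span_image (s := {x | x ∈ L}) hL.1 h

/-- In characteristic other than 2 an orthogonal basis exists even if the form degenerates on the
span; its isotropic members span the radical. -/
theorem exists_goodList (h2 : (2 : F) ≠ 0) (A : Finset (VInf F)) :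
    ∃ l, GoodList (formInf F) l ∧
      Submodule.span F {x | x ∈ l} = Submodule.span F (A : Set (VInf F)) := by
  set U := Submodule.span F (A : Set (VInf F))
  have : Invertible (2 : F) := invertibleOfNonzero h2
  obtain ⟨b, hb⟩ := LinearMap.BilinForm.exists_orthogonal_basis
    (V := U) (B := (formInf F).restrict U) ⟨fun x y => by
      simpa using formInf_comm (x : VInf F) (y : VInf F)⟩
  refine ⟨(List.finRange _).map fun i => (b i : VInf F), ?_, ?_⟩
  · refine goodList_map_of_ortho (b := fun i => (b i : VInf F)) ?_ ?_ (List.nodup_finRange _)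
    · exact b.linearIndependent.map' U.subtype (Submodule.ker_subtype U)
    · intro i j hij
      exact hb hij
  · have e : {x | x ∈ (List.finRange _).map fun i => (b i : VInf F)} =
        U.subtype '' Set.range b := by
      ext x; simp
    rw [e, Submodule.span_image, b.span_eq, Submodule.map_top, Submodule.range_subtype]

/-- The pairings with an orthogonal list can be corrected one vector at a time. The only obstruction
comes from isotropic members, which are radical, and there φ vanishes. -/
theorem exists_mem_span_form_eq {V : Type w} [AddCommGroup V] [Module F V]
    {B : LinearMap.BilinForm F V} (hs : ∀ x y, B x y = B y x) {l : List V} (hg : GoodList B l)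
    (φ : V →ₗ[F] F)
    (hr : ∀ r ∈ Submodule.span F {x | x ∈ l}, (∀ a ∈ l, B r a = 0) → φ r = 0) :
    ∃ v ∈ Submodule.span F {x | x ∈ l}, ∀ a ∈ l, B v a = φ a := by
  induction l with
  | nil => exact ⟨0, Submodule.zero_mem _, by simp⟩
  | cons b l ih =>
    have hmono : Submodule.span F {x | x ∈ l} ≤ Submodule.span F {x | x ∈ b :: l} :=
      Submodule.span_mono fun x hx => List.mem_cons_of_mem _ hx
    have hperp : ∀ v ∈ Submodule.span F {x | x ∈ l}, B v b = 0 := fun v hv => by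
      rw [hs]; exact form_span (f := 0) (by simpa using hg.2.1) v hv
    obtain ⟨v, hv, hva⟩ := ih hg.1 fun r hrl hra => hr r (hmono hrl) fun a ha => by
      rcases List.mem_cons.1 ha with rfl | ha
      · exact hperp r hrl
      · exact hra a ha
    have hb : b ∈ Submodule.span F {x | x ∈ b :: l} := Submodule.subset_span (by simp)
    -- For isotropic `b` the quotient is 0 by convention, and no correction is needed.
    refine ⟨v + (φ b / B b b) • b, Submodule.add_mem _ (hmono hv) (Submodule.smul_mem _ _ hb),
      fun a ha => ?_⟩
    rcases List.mem_cons.1 ha with rfl | ha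
    · by_cases h0 : B a a = 0
      · have : φ a = 0 := hr a hb fun c hc => by
          rcases List.mem_cons.1 hc with rfl | hc
          · exact h0
          · exact hg.2.1 c hc
        simp [hperp v hv, this, h0]
      · simp [hperp v hv, h0]
    · simp [hva a ha, hg.2.1 a ha]

/-- The data of an extension of a quadratic space by one vector that determine its measure. -/
inductive StepData (F : Type u)
  | perp (norms : List F) (c : F) (N : ℕ)
  | rad (k : ℕ)

/-- The measure of an extension with given data. -/
noncomputable def StepData.eval {R : Type v} [CommRing R] [Fintype F] (qi : R) (p : QParam R) :
    StepData F → R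
  | perp norms c N => (p.par qi norms).val qi c - N
  | rad k => p.T * qi ^ (k + 1)

/-- The extension of the span of `A` by `v` has the given data. -/
def HasData (A : Finset (VInf F)) (v : VInf F) : StepData F → Prop
  | .perp norms c N => ∃ l, GoodList (formInf F) l ∧
      Submodule.span F {x | x ∈ l} = Submodule.span F (A : Set (VInf F)) ∧
      norms = l.map (fun a => formInf F a a) ∧
      ∃ v₀ ∈ Submodule.span F {x | x ∈ l}, (∀ a ∈ l, formInf F v₀ a = formInf F v a) ∧
        formInf F (v - v₀) (v - v₀) = c ∧
        N = {x | x ∈ Submodule.span F {x | x ∈ l} ∧ (∀ a ∈ l, formInf F x a = 0) ∧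
          formInf F x x = c}.ncard
  | .rad k => ∃ l, GoodList (formInf F) l ∧
      Submodule.span F {x | x ∈ l} = Submodule.span F (A : Set (VInf F)) ∧ k = l.length ∧
      ∃ r ∈ Submodule.span F {x | x ∈ l}, (∀ a ∈ l, formInf F r a = 0) ∧ formInf F v r ≠ 0

/-- The dichotomy is whether v pairs to zero with the radical of the span. If so, some v₀ in the
span has the same pairings and v − v₀ is orthogonal to the span (`perp`); otherwise a radical vector
detects v (`rad`). -/
theorem exists_hasData (h2 : (2 : F) ≠ 0) (A : Finset (VInf F)) (v : VInf F) :
    ∃ d, HasData A v d := by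
  obtain ⟨l, hl, hspan⟩ := exists_goodList h2 A
  by_cases h : ∀ r ∈ Submodule.span F {x | x ∈ l}, (∀ a ∈ l, formInf F r a = 0) → formInf F v r = 0
  · obtain ⟨v₀, hv₀, hv⟩ := exists_mem_span_form_eq formInf_comm hl (formInf F v) h
    exact ⟨.perp _ _ _, l, hl, hspan, rfl, v₀, hv₀, hv, rfl, rfl⟩
  · push Not at h
    obtain ⟨r, hr, hra, hrv⟩ := h
    exact ⟨.rad _, l, hl, hspan, rfl, r, hr, hra, hrv⟩

theorem span_map_smul (g : OInf F) (l : List (VInf F)) :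
    Submodule.span F {x | x ∈ l.map (g • ·)} =
      (Submodule.span F {x | x ∈ l}).map (g : VInf F ≃ₗ[F] VInf F).toLinearMap := by
  rw [← Submodule.span_image]
  congr 1
  ext x
  simp [OInf.smul_def]

theorem GoodList.smul (g : OInf F) {l : List (VInf F)} (hl : GoodList (formInf F) l) :
    GoodList (formInf F) (l.map (g • ·)) := by
  induction l with
  | nil => trivial
  | cons b l ih =>
    refine ⟨ih hl.1, fun a ha => ?_, fun h => hl.2.2 ?_⟩
    · obtain ⟨a, ha', rfl⟩ := List.mem_map.1 ha
      rw [OInf.form_smul]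
      exact hl.2.1 a ha'
    · change g • b ∈ Submodule.span F {x | x ∈ l.map (g • ·)} at h
      rw [span_map_smul] at h
      obtain ⟨x, hx, hxb⟩ := h
      rwa [← (g : VInf F ≃ₗ[F] VInf F).injective hxb]

open Classical in
-- The data consist of norms, a length and a cardinality, all invariant under isometries. This is
-- needed because fibres are counted at a translated base point.
theorem HasData.smul (g : OInf F) {A : Finset (VInf F)} {v : VInf F} {d : StepData F}
    (h : HasData A v d) : HasData (A.image (g • ·)) (g • v) d := by
  have hsp : ∀ l : List (VInf F), Submodule.span F {x | x ∈ l} = Submodule.span F (A : Set (VInf F)) →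
      Submodule.span F {x | x ∈ l.map (g • ·)} =
        Submodule.span F ((A.image (g • ·) : Finset (VInf F)) : Set (VInf F)) := by
    intro l hl
    rw [span_map_smul, hl, ← Submodule.span_image, Finset.coe_image]
    rfl
  have hmem : ∀ l : List (VInf F), ∀ x, g • x ∈ Submodule.span F {x | x ∈ l.map (g • ·)} ↔
      x ∈ Submodule.span F {x | x ∈ l} := by
    intro l x
    rw [span_map_smul, OInf.smul_def]
    constructor
    · rintro ⟨y, hy, hyx⟩
      rwa [← (g : VInf F ≃ₗ[F] VInf F).injective hyx]
    · intro hx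
      exact ⟨x, hx, rfl⟩
  match d, h with
  | .perp norms c N, h =>
    obtain ⟨l, hl, hspan, hn, v₀, hv₀, hv, hc, hN⟩ := h
    refine ⟨l.map (g • ·), hl.smul g, hsp l hspan, ?_, g • v₀, (hmem l _).2 hv₀, ?_, ?_, ?_⟩
    · simp [hn, Function.comp_def, OInf.form_smul]
    · simpa [OInf.form_smul] using hv
    · rw [← hc, OInf.smul_def, OInf.smul_def, ← map_sub]
      exact OInf.form_smul g _ _
    · rw [hN]
      refine (Set.ncard_congr (fun x _ => g • x) ?_ ?_ ?_)
      · rintro x ⟨h1, h3, h4⟩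
        exact ⟨(hmem l x).2 h1, by simpa [OInf.form_smul] using h3, by simpa [OInf.form_smul]⟩
      · intro x y _ _ hxy
        exact smul_left_cancel g hxy
      · rintro y ⟨h1, h3, h4⟩
        obtain ⟨x, rfl⟩ : ∃ x, g • x = y := ⟨g⁻¹ • y, by simp⟩
        exact ⟨x, ⟨(hmem l x).1 h1, by simpa [OInf.form_smul] using h3,
          by simpa [OInf.form_smul] using h4⟩, rfl⟩
  | .rad k, h =>
    obtain ⟨l, hl, hspan, hk, r, hr, hra, hrv⟩ := h
    exact ⟨l.map (g • ·), hl.smul g, hsp l hspan, by simp [hk], g • r, (hmem l _).2 hr,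
      by simpa [OInf.form_smul] using hra, by rwa [OInf.form_smul]⟩

/-- The measure of a relative orbit is determined by its data. -/
theorem QVal.ν_relOrbit [Fintype F] (h2 : (2 : F) ≠ 0) {W : Submodule F (VInf F)} {R : Type v}
    [CommRing R] (M : QVal (formInf F) W R) {qi : R} (hq : (Fintype.card F : R) * qi = 1)
    {p : QParam R} (hp : ∀ c, M.ν {v | formInf F v v = c} = p.val qi c) {A : Finset (VInf F)}
    (hA : ∀ a ∈ A, a ∈ W) {v : VInf F} (hv : v ∉ Submodule.span F (A : Set (VInf F)))
    {d : StepData F} (hd : HasData A v d) : M.ν (relOrbit A v) = d.eval qi p := by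
  have hspW : Submodule.span F (A : Set (VInf F)) ≤ W := Submodule.span_le.2 hA
  have htype : ∀ l : List (VInf F),
      Submodule.span F {x | x ∈ l} = Submodule.span F (A : Set (VInf F)) →
      (∀ x, (∀ a ∈ A, formInf F x a = formInf F v a) ↔ (∀ a ∈ l, formInf F x a = formInf F v a)) ∧
      (∀ a ∈ l, a ∈ W) := by
    intro l hl
    refine ⟨fun x => ⟨fun h a ha => ?_, fun h a ha => ?_⟩, fun a ha => hspW ?_⟩
    · exact formInf_span_eq (s := (A : Set (VInf F))) h a
        (hl ▸ Submodule.subset_span (s := {x | x ∈ l}) ha)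
    · exact formInf_span_eq (s := {x | x ∈ l}) h a (hl ▸ Submodule.subset_span ha)
    · exact hl ▸ Submodule.subset_span (s := {x | x ∈ l}) ha
  rw [relOrbit_of_notMem h2 hv]
  match d, hd with
  | .perp norms c N, hd =>
    obtain ⟨l, hl, hspan, hn, v₀, hv₀, hvl, hc, hN⟩ := hd
    obtain ⟨hiff, hlW⟩ := htype l hspan
    simp only [hiff]
    have hv₀W : v₀ ∈ W := hspW (hspan ▸ hv₀)
    have hfin := finite_span A
    rw [← hspan] at hfin ⊢
    have hdom := M.dom_list_norm hlW (fun a => formInf F v a) (formInf F v v)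
    -- Translation by −v₀ carries the vectors of the type of v to those orthogonal to l of norm c,
    -- which `ν_perp` measures; the N of them in the span are removed afterwards.
    have hset : ∀ x, ((∀ a ∈ l, formInf F x a = formInf F v a) ∧ formInf F x x = formInf F v v) ↔
        (∀ a ∈ l, formInf F (x + -v₀) a = 0) ∧ formInf F (x + -v₀) (x + -v₀) = c := by
      intro x
      have e1 : ∀ a ∈ l, (formInf F (x + -v₀) a = 0 ↔ formInf F x a = formInf F v a) :=
        fun a ha => by
          rw [map_add, map_neg, LinearMap.add_apply, LinearMap.neg_apply, hvl a ha,
            add_neg_eq_zero]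
      rw [show (∀ a ∈ l, formInf F (x + -v₀) a = 0) ↔ ∀ a ∈ l, formInf F x a = formInf F v a from
        forall₂_congr e1]
      refine and_congr_right fun hx => ?_
      have h1 : formInf F x v₀ = formInf F v v₀ := formInf_span_eq (s := {x | x ∈ l}) hx v₀ hv₀
      rw [← hc]
      simp only [map_add, map_sub, map_neg, LinearMap.add_apply, LinearMap.sub_apply,
        LinearMap.neg_apply, formInf_comm v₀ x, formInf_comm v₀ v, h1]
      exact ⟨fun h => by linear_combination h, fun h => by linear_combination h⟩
    have hdom0 := M.dom_list_norm hlW (fun _ => 0) c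
    have h1 := M.transl (-v₀) hdom0 (W.neg_mem hv₀W)
    rw [M.ν_perp h2 hq hp hlW hl] at h1
    simp only [Set.mem_ofPred_eq, ← hset] at h1
    set S := {x | (∀ a ∈ l, formInf F x a = formInf F v a) ∧ formInf F x x = formInf F v v}
    set U := Submodule.span F {x | x ∈ l}
    have hsub : S ∩ U ⊆ W := fun x hx => hspW (hspan ▸ hx.2)
    have hfin' : (S ∩ U).Finite := hfin.subset Set.inter_subset_right
    rw [← Set.sdiff_self_inter, M.ν_diff hdom (M.dom_finite hfin' hsub) Set.inter_subset_left,
      M.ν_finite hfin' hsub, h1, hn, StepData.eval, hN]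
    congr 2
    refine Set.ncard_congr (fun x _ => x + -v₀) ?_ ?_ ?_
    · rintro x ⟨hxS, hxU⟩
      exact ⟨U.add_mem hxU (U.neg_mem hv₀), (hset x).1 hxS⟩
    · intro x y _ _ hxy
      exact add_right_cancel hxy
    · rintro y ⟨hyU, hy⟩
      exact ⟨y + v₀, ⟨(hset _).2 (by simpa using hy), U.add_mem hyU hv₀⟩, by simp⟩
  | .rad k, hd =>
    obtain ⟨l, hl, hspan, hk, r, hr, hra, hrv⟩ := hd
    obtain ⟨hiff, hlW⟩ := htype l hspan
    simp only [hiff]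
    -- Vectors of the span pair to zero with the radical vector r, whereas v does not, so none has
    -- to be removed.
    have hempty : {x | (∀ a ∈ l, formInf F x a = formInf F v a) ∧ formInf F x x = formInf F v v} \
        (Submodule.span F (A : Set (VInf F)) : Set (VInf F)) =
        {x | (∀ a ∈ l, formInf F x a = formInf F v a) ∧ formInf F x x = formInf F v v} := by
      rw [sdiff_eq_left, Set.disjoint_left]
      rintro x ⟨hx, -⟩ hxA
      rw [SetLike.mem_coe, ← hspan] at hxA
      have h1 : formInf F x r = formInf F v r := formInf_span_eq (s := {x | x ∈ l}) hx r hr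
      have h3 : formInf F r x = 0 := form_span (f := 0) (by simpa using hra) x hxA
      rw [formInf_comm, h3] at h1
      exact hrv h1.symm
    rw [hempty, M.ν_affine_norm h2 hq hlW hl (formInf F v) hr hra hrv, M.ν_univ h2 hq hp, hk]
    rfl

end StepData

/-! ### Pointed transitive sets -/

section Pointed

variable {G : Type u} [Group G] {Ω : Type u} [MulAction G Ω]

theorem exists_equivariant_map {Y X : Type*} [MulAction G Y] [MulAction G X]
    [MulAction.IsPretransitive G Y] (y : Y) (x : X)
    (h : MulAction.stabilizer G y ≤ MulAction.stabilizer G x) :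
    ∃ f : Y →[G] X, f y = x := by
  choose k hk using fun z : Y => MulAction.exists_smul_eq G y z
  have key : ∀ g : G, k (g • y) • x = g • x := fun g => by
    have : g⁻¹ * k (g • y) ∈ MulAction.stabilizer G y := by
      rw [MulAction.mem_stabilizer_iff, mul_smul, hk, inv_smul_smul]
    have := h this
    rw [MulAction.mem_stabilizer_iff, mul_smul, inv_smul_eq_iff] at this
    exact this
  refine ⟨⟨fun z => k z • x, fun g z => ?_⟩, ?_⟩
  · obtain ⟨g', rfl⟩ := MulAction.exists_smul_eq G y z
    rw [key, ← mul_smul, key, mul_smul]; rfl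
  · have := key 1
    rwa [one_smul, one_smul] at this

theorem equivariant_ext {Y X : Type*} [MulAction G Y] [MulAction G X]
    [MulAction.IsPretransitive G Y] {f f' : Y →[G] X} (y : Y) (h : f y = f' y) : f = f' := by
  ext z
  obtain ⟨g, rfl⟩ := MulAction.exists_smul_eq G y z
  rw [map_smul, map_smul, h]

theorem stabilizer_le_of_map {Y X : Type*} [MulAction G Y] [MulAction G X] (f : Y →[G] X) (y : Y) :
    MulAction.stabilizer G y ≤ MulAction.stabilizer G (f y) := fun g hg => by
  rw [MulAction.mem_stabilizer_iff] at hg ⊢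
  rw [← map_smul, hg]

theorem bijective_of_stabilizer {Y X : Type*} [MulAction G Y] [MulAction G X]
    [MulAction.IsPretransitive G Y] [MulAction.IsPretransitive G X] (f : Y →[G] X) (y : Y)
    (h : MulAction.stabilizer G (f y) ≤ MulAction.stabilizer G y) : Function.Bijective f := by
  constructor
  · intro a b hab
    obtain ⟨g, rfl⟩ := MulAction.exists_smul_eq G y a
    obtain ⟨g', rfl⟩ := MulAction.exists_smul_eq G y b
    rw [map_smul, map_smul] at hab
    have : g'⁻¹ * g ∈ MulAction.stabilizer G (f y) := by
      rw [MulAction.mem_stabilizer_iff, mul_smul, hab, inv_smul_smul]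
    have := h this
    rwa [MulAction.mem_stabilizer_iff, mul_smul, inv_smul_eq_iff] at this
  · intro x
    obtain ⟨g, rfl⟩ := MulAction.exists_smul_eq G (f y) x
    exact ⟨g • y, map_smul f g y⟩

instance (X : TransSet G Ω) : MulAction.IsPretransitive G X := X.isTransSmooth.pretransitive

open Classical in
theorem stabilizer_smul_eq_fixing {X : Type*} [MulAction G X] {x : X} {A : Finset Ω}
    (h : MulAction.stabilizer G x = fixingSubgroup G (A : Set Ω)) (g : G) :
    MulAction.stabilizer G (g • x) =
      fixingSubgroup G ((A.image (g • ·) : Finset Ω) : Set Ω) := by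
  ext k
  have h1 : k ∈ MulAction.stabilizer G (g • x) ↔ g⁻¹ * k * g ∈ MulAction.stabilizer G x := by
    simp only [MulAction.mem_stabilizer_iff, mul_smul, inv_smul_eq_iff]
  rw [h1, h]
  simp only [mem_fixingSubgroup_iff, Finset.coe_image, Set.forall_mem_image, mul_smul,
    inv_smul_eq_iff]

/-- The transitive set `G/G(A)`. -/
noncomputable def TransSet.ofFinset (A : Finset Ω) : TransSet G Ω where
  carrier := G ⧸ fixingSubgroup G (A : Set Ω)
  isTransSmooth :=
    { nonempty := ⟨((1 : G) : G ⧸ fixingSubgroup G (A : Set Ω))⟩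
      pretransitive := inferInstance
      smooth := fun x => by
        classical
        obtain ⟨g, rfl⟩ := MulAction.exists_smul_eq G
          ((1 : G) : G ⧸ fixingSubgroup G (A : Set Ω)) x
        exact ⟨_, stabilizer_smul_eq_fixing (MulAction.stabilizer_quotient _) g⟩ }

/-- The base point of `G/G(A)`. -/
def TransSet.base (A : Finset Ω) : (TransSet.ofFinset A : TransSet G Ω) :=
  ((1 : G) : G ⧸ fixingSubgroup G (A : Set Ω))

theorem TransSet.stabilizer_base (A : Finset Ω) :
    MulAction.stabilizer G (TransSet.base (G := G) A) = fixingSubgroup G (A : Set Ω) :=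
  MulAction.stabilizer_quotient _

theorem fixingSubgroup_mono {A C : Finset Ω} (h : A ⊆ C) :
    fixingSubgroup G (C : Set Ω) ≤ fixingSubgroup G (A : Set Ω) := fun g hg => by
  rw [mem_fixingSubgroup_iff] at hg ⊢
  exact fun a ha => hg a (h ha)

/-- The projection `G/G(C) → G/G(A)` for `A ⊆ C`. -/
noncomputable def TransSet.proj {A C : Finset Ω} (h : A ⊆ C) :
    (TransSet.ofFinset C : TransSet G Ω) →[G] (TransSet.ofFinset A : TransSet G Ω) :=
  (exists_equivariant_map (TransSet.base C) (TransSet.base A) (by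
    rw [TransSet.stabilizer_base, TransSet.stabilizer_base]; exact fixingSubgroup_mono h)).choose

theorem TransSet.proj_base {A C : Finset Ω} (h : A ⊆ C) :
    TransSet.proj (G := G) h (TransSet.base C) = TransSet.base A :=
  (exists_equivariant_map (TransSet.base C) (TransSet.base A) (by
    rw [TransSet.stabilizer_base, TransSet.stabilizer_base]
    exact fixingSubgroup_mono h)).choose_spec

namespace IsMeasure

variable {k : Type v} [CommRing k] {μ : TransMap G Ω → k} (hμ : IsMeasure μ)

include hμ

/-- The measure of a map depends only on the stabilizers of a point and of its image. -/
theorem eq_of_stabilizer {Y X Y' X' : TransSet G Ω} (f : Y →[G] X) (f' : Y' →[G] X') (y : Y)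
    (y' : Y') (hy : MulAction.stabilizer G y = MulAction.stabilizer G y')
    (hx : MulAction.stabilizer G (f y) = MulAction.stabilizer G (f' y')) :
    μ ⟨Y, X, f⟩ = μ ⟨Y', X', f'⟩ := by
  obtain ⟨e, he⟩ := exists_equivariant_map y y' hy.le
  obtain ⟨e₀, he₀⟩ := exists_equivariant_map (f y) (f' y') hx.le
  have h1 := hμ.iso e (bijective_of_stabilizer e y (by rw [he, hy]))
  have h2 := hμ.iso e₀ (bijective_of_stabilizer e₀ (f y) (by rw [he₀, hx]))
  have h3 : e₀.comp f = f'.comp e := equivariant_ext y (by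
    change e₀ (f y) = f' (e y)
    rw [he, he₀])
  have h4 := hμ.comp e₀ f
  rw [h3, hμ.comp, h1, h2, mul_one, one_mul] at h4
  exact h4.symm

end IsMeasure

open Classical in
/-- The measure of the extension of `A` by `v`. -/
noncomputable def stepMeasure {k : Type v} (μ : TransMap G Ω → k) (A : Finset Ω) (v : Ω) : k :=
  μ ⟨_, _, TransSet.proj (Finset.subset_insert v A)⟩

namespace IsMeasure

variable {k : Type v} [CommRing k] {μ : TransMap G Ω → k} (hμ : IsMeasure μ)

include hμ

open Classical in
theorem eq_stepMeasure {Y X : TransSet G Ω} (f : Y →[G] X) (y : Y) {A : Finset Ω} {v : Ω}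
    (hy : MulAction.stabilizer G y = fixingSubgroup G ((insert v A : Finset Ω) : Set Ω))
    (hx : MulAction.stabilizer G (f y) = fixingSubgroup G (A : Set Ω)) :
    μ ⟨Y, X, f⟩ = stepMeasure μ A v :=
  hμ.eq_of_stabilizer _ _ y (TransSet.base _) (by rw [hy, TransSet.stabilizer_base])
    (by rw [hx, TransSet.proj_base, TransSet.stabilizer_base])

open Classical in
theorem stepMeasure_congr {A A' : Finset Ω} {v v' : Ω}
    (h : fixingSubgroup G (A : Set Ω) = fixingSubgroup G (A' : Set Ω))
    (h' : fixingSubgroup G ((insert v A : Finset Ω) : Set Ω) =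
      fixingSubgroup G ((insert v' A' : Finset Ω) : Set Ω)) :
    stepMeasure μ A v = stepMeasure μ A' v' :=
  hμ.eq_stepMeasure _ (TransSet.base _) (by rw [TransSet.stabilizer_base, h'])
    (by rw [TransSet.proj_base, TransSet.stabilizer_base, h])

open Classical in
theorem stepMeasure_smul (g : G) (A : Finset Ω) (v : Ω) :
    stepMeasure μ (A.image (g • ·)) (g • v) = stepMeasure μ A v := by
  refine (hμ.eq_stepMeasure (TransSet.proj (Finset.subset_insert v A))
    (g • TransSet.base _) ?_ ?_).symm
  · rw [stabilizer_smul_eq_fixing (TransSet.stabilizer_base _), Finset.image_insert]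
  · rw [map_smul, TransSet.proj_base, stabilizer_smul_eq_fixing (TransSet.stabilizer_base _)]

theorem stepMeasure_smul_of_mem {A : Finset Ω} {g : G} (hg : g ∈ fixingSubgroup G (A : Set Ω))
    (v : Ω) : stepMeasure μ A (g • v) = stepMeasure μ A v := by
  classical
  rw [← hμ.stepMeasure_smul g A v]
  congr 1
  rw [mem_fixingSubgroup_iff] at hg
  ext x
  simp only [Finset.mem_image]
  exact ⟨fun h => ⟨x, h, hg x h⟩, by rintro ⟨a, ha, rfl⟩; rwa [hg a ha]⟩

theorem eq_one_of_stabilizer {Y X : TransSet G Ω} (f : Y →[G] X) (y : Y)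
    (h : MulAction.stabilizer G (f y) ≤ MulAction.stabilizer G y) : μ ⟨Y, X, f⟩ = 1 :=
  hμ.iso f (bijective_of_stabilizer f y h)

theorem stepMeasure_of_fixed {A : Finset Ω} {v : Ω}
    (hv : ∀ g ∈ fixingSubgroup G (A : Set Ω), g • v = v) : stepMeasure μ A v = 1 := by
  classical
  refine hμ.eq_one_of_stabilizer _ (TransSet.base _) ?_
  rw [TransSet.proj_base, TransSet.stabilizer_base, TransSet.stabilizer_base]
  intro g hg
  have := hv g hg
  rw [mem_fixingSubgroup_iff] at hg ⊢
  simpa [this] using hg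

/-- Composing two steps. -/
theorem stepMeasure_swap {v w v' w' : Ω}
    (h : ∀ g : G, (g • v = v ∧ g • w = w) ↔ (g • v' = v' ∧ g • w' = w')) :
    stepMeasure μ ∅ v * stepMeasure μ {v} w = stepMeasure μ ∅ v' * stepMeasure μ {v'} w' := by
  classical
  -- The two steps compose to the map from G/G({v, w}) to a point, whose measure depends only on the
  -- stabilizer.
  have key : ∀ v w, stepMeasure μ ∅ v * stepMeasure μ {v} w =
      μ ⟨_, _, TransSet.proj (Finset.empty_subset (insert w {v}))⟩ := by
    intro v w
    have e : stepMeasure μ ∅ v = μ ⟨_, _, TransSet.proj (Finset.empty_subset {v})⟩ :=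
      (hμ.eq_stepMeasure _ (TransSet.base _) (by rw [TransSet.stabilizer_base, insert_empty_eq])
        (by rw [TransSet.proj_base, TransSet.stabilizer_base])).symm
    rw [e, stepMeasure, ← hμ.comp]
    congr 2
    exact equivariant_ext (TransSet.base _) (by
      change TransSet.proj _ (TransSet.proj _ _) = _
      simp only [TransSet.proj_base])
  rw [key, key]
  refine hμ.eq_of_stabilizer _ _ (TransSet.base _) (TransSet.base _) ?_ ?_
  · rw [TransSet.stabilizer_base, TransSet.stabilizer_base]
    ext g
    simp only [mem_fixingSubgroup_iff, Finset.coe_insert, Set.forall_mem_insert,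
      Finset.coe_singleton, Set.mem_singleton_iff, forall_eq]
    have := h g
    tauto
  · rw [TransSet.proj_base, TransSet.proj_base]

/-- Base change of a one-step extension. -/
theorem stepMeasure_eq_sum_fin {n : ℕ} {A A' : Finset Ω} (hA : A ⊆ A') (v : Ω)
    (r : Fin n → Ω) (hr : ∀ i, r i ∈ MulAction.orbit (fixingSubgroup G (A : Set Ω)) v)
    (hu : ∀ x ∈ MulAction.orbit (fixingSubgroup G (A : Set Ω)) v,
      ∃! i, x ∈ MulAction.orbit (fixingSubgroup G (A' : Set Ω)) (r i)) :
    stepMeasure μ A v = ∑ i, stepMeasure μ A' (r i) := by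
  classical
  choose k hk using hr
  have hkA : ∀ i, ∀ a ∈ A, (k i : G) • a = a := fun i a ha =>
    (mem_fixingSubgroup_iff G).1 (k i).2 a ha
  have hk' : ∀ i, (k i : G) • v = r i := hk
  have hex : ∀ i, ∃ h' : (TransSet.ofFinset (insert (r i) A') : TransSet G Ω) →[G]
      (TransSet.ofFinset (insert v A) : TransSet G Ω),
      h' (TransSet.base _) = (k i : G) • TransSet.base _ := fun i => by
    refine exists_equivariant_map _ _ ?_
    rw [TransSet.stabilizer_base, stabilizer_smul_eq_fixing (TransSet.stabilizer_base _)]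
    refine fixingSubgroup_mono fun x hx => ?_
    obtain ⟨a, ha, rfl⟩ := Finset.mem_image.1 hx
    rcases Finset.mem_insert.1 ha with rfl | ha
    · rw [hk']; exact Finset.mem_insert_self _ _
    · rw [hkA i a ha]; exact Finset.mem_insert_of_mem (hA ha)
  choose h' hh' using hex
  refine hμ.baseChange (TransSet.proj (Finset.subset_insert v A)) (TransSet.proj hA)
    (fun i => TransSet.ofFinset (insert (r i) A'))
    (fun i => TransSet.proj (Finset.subset_insert (r i) A')) h' ⟨fun i y' => ?_, fun y x' hyx => ?_⟩
  · obtain ⟨g, rfl⟩ := MulAction.exists_smul_eq G (TransSet.base _) y'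
    simp only [map_smul, hh', TransSet.proj_base]
    congr 1
    rw [← MulAction.mem_stabilizer_iff, TransSet.stabilizer_base]
    exact (k i).2
  · obtain ⟨g, rfl⟩ := MulAction.exists_smul_eq G (TransSet.base _) x'
    obtain ⟨c, rfl⟩ : ∃ c : G, (g * c) • TransSet.base (insert v A) = y := by
      obtain ⟨c, hc⟩ := MulAction.exists_smul_eq G (TransSet.base (G := G) (insert v A)) y
      exact ⟨g⁻¹ * c, by rw [mul_inv_cancel_left, hc]⟩
    have hc : c ∈ fixingSubgroup G (A : Set Ω) := by
      simp only [map_smul, TransSet.proj_base] at hyx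
      rw [mul_smul, smul_left_cancel_iff, ← MulAction.mem_stabilizer_iff,
        TransSet.stabilizer_base] at hyx
      exact hyx
    obtain ⟨i, ⟨a, ha⟩, hi⟩ := hu (c • v) ⟨⟨c, hc⟩, rfl⟩
    have ha : (a : G) • r i = c • v := ha
    have haA' := (mem_fixingSubgroup_iff G).1 a.2
    have hcA := (mem_fixingSubgroup_iff G).1 hc
    -- The fibre of G/G(A ∪ {v}) → G/G(A) over the base point is the G(A)-orbit of v, so equality of
    -- points in it is equality of vectors.
    have hsame : ∀ (j : Fin n) (b : G), (∀ x ∈ A', b • x = x) → (b • r j = c • v ↔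
        (b * (k j : G)) • TransSet.base (G := G) (insert v A) = c • TransSet.base _) := by
      intro j b hb
      rw [← inv_smul_eq_iff (g := c), ← inv_smul_eq_iff (g := c), ← mul_smul, ← mul_smul,
        ← MulAction.mem_stabilizer_iff, TransSet.stabilizer_base, mem_fixingSubgroup_iff,
        Finset.coe_insert, Set.forall_mem_insert, ← hk' j, ← mul_smul, mul_assoc]
      refine ⟨fun h => ⟨h, fun x hx => ?_⟩, fun h => h.1⟩
      rw [mul_smul, mul_smul, hkA j x hx, hb x (hA hx), inv_smul_eq_iff, hcA x hx]
    refine ⟨⟨i, (g * a) • TransSet.base _⟩, ⟨?_, ?_⟩, ?_⟩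
    · rw [map_smul, hh', ← mul_smul, mul_assoc, mul_smul, (hsame i a haA').1 ha, mul_smul]
    · rw [map_smul, TransSet.proj_base, mul_smul]
      congr 1
      rw [← MulAction.mem_stabilizer_iff, TransSet.stabilizer_base]
      exact a.2
    · rintro ⟨j, z⟩ ⟨hz1, hz2⟩
      obtain ⟨b, rfl⟩ : ∃ b : G, (g * b) • TransSet.base (insert (r j) A') = z := by
        obtain ⟨b, hb⟩ := MulAction.exists_smul_eq G (TransSet.base (G := G) (insert (r j) A')) z
        exact ⟨g⁻¹ * b, by rw [mul_inv_cancel_left, hb]⟩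
      simp only [map_smul, hh', TransSet.proj_base] at hz1 hz2
      rw [mul_smul, smul_left_cancel_iff, ← MulAction.mem_stabilizer_iff,
        TransSet.stabilizer_base] at hz2
      have hbA' := (mem_fixingSubgroup_iff G).1 hz2
      rw [mul_smul, mul_smul, smul_left_cancel_iff, ← mul_smul] at hz1
      have hb := (hsame j b hbA').2 hz1
      obtain rfl : j = i := hi j ⟨⟨b, hz2⟩, hb⟩
      congr 1
      rw [mul_smul, mul_smul, smul_left_cancel_iff, ← inv_smul_eq_iff, ← mul_smul,
        ← MulAction.mem_stabilizer_iff, TransSet.stabilizer_base, mem_fixingSubgroup_iff,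
        Finset.coe_insert, Set.forall_mem_insert]
      refine ⟨?_, fun x hx => ?_⟩
      · rw [mul_smul, hb, ← ha, inv_smul_smul]
      · rw [mul_smul, hbA' x hx, inv_smul_eq_iff, haA' x hx]

theorem stepMeasure_eq_sum {ι : Type*} [Fintype ι] {A A' : Finset Ω} (hA : A ⊆ A') (v : Ω)
    (r : ι → Ω) (hr : ∀ i, r i ∈ MulAction.orbit (fixingSubgroup G (A : Set Ω)) v)
    (hu : ∀ x ∈ MulAction.orbit (fixingSubgroup G (A : Set Ω)) v,
      ∃! i, x ∈ MulAction.orbit (fixingSubgroup G (A' : Set Ω)) (r i)) :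
    stepMeasure μ A v = ∑ i, stepMeasure μ A' (r i) := by
  have e := Fintype.equivFin ι
  rw [hμ.stepMeasure_eq_sum_fin hA v (r ∘ e.symm) (fun i => hr _) (fun x hx => ?_)]
  · exact Fintype.sum_equiv e.symm _ _ fun _ => rfl
  · obtain ⟨i, hi, hi'⟩ := hu x hx
    exact ⟨e i, by simpa using hi, fun j hj => by rw [← hi' _ hj]; simp⟩

end IsMeasure

end Pointed

/-! ### The valuation attached to a measure -/

section RelVal

variable {G : Type u} [Group G] {Ω : Type u} [MulAction G Ω] {k : Type v} [CommRing k]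

/-- `S` is stable under the pointwise stabilizer of `A`. -/
def StableUnder (G : Type u) [Group G] {Ω : Type u} [MulAction G Ω] (A : Finset Ω)
    (S : Set Ω) : Prop :=
  ∀ g ∈ fixingSubgroup G (A : Set Ω), ∀ v, g • v ∈ S ↔ v ∈ S

theorem StableUnder.mono {A A' : Finset Ω} {S : Set Ω} (h : StableUnder G A S) (hA : A ⊆ A') :
    StableUnder G A' S := fun g hg => h g (fixingSubgroup_mono hA hg)

theorem stableUnder_orbit (A : Finset Ω) (v : Ω) :
    StableUnder G A (MulAction.orbit (fixingSubgroup G (A : Set Ω)) v) := fun g hg x => by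
  constructor
  · rintro ⟨h, hh⟩
    refine ⟨⟨g, hg⟩⁻¹ * h, ?_⟩
    change (_ * h) • v = x
    rw [mul_smul, inv_smul_eq_iff]
    exact hh
  · rintro ⟨h, rfl⟩
    exact ⟨⟨g, hg⟩ * h, mul_smul (⟨g, hg⟩ : fixingSubgroup G (A : Set Ω)) h v⟩

open Classical in
/-- The sum of the measures of the orbits of `G(A)` in `S`. -/
noncomputable def relVal (μ : TransMap G Ω → k) (A : Finset Ω) (S : Set Ω) : k :=
  ∑ᶠ o : MulAction.orbitRel.Quotient (fixingSubgroup G (A : Set Ω)) Ω,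
    if o.out ∈ S then stepMeasure μ A o.out else 0

/-- The orbit of a vector under `G(A)` as an element of the orbit space. -/
abbrev orbitClass (G : Type u) [Group G] {Ω : Type u} [MulAction G Ω] (A : Finset Ω) (v : Ω) :
    MulAction.orbitRel.Quotient (fixingSubgroup G (A : Set Ω)) Ω :=
  Quotient.mk (MulAction.orbitRel (fixingSubgroup G (A : Set Ω)) Ω) v

theorem orbitClass_eq {A : Finset Ω} {v w : Ω} :
    orbitClass G A v = orbitClass G A w ↔
      ∃ g ∈ fixingSubgroup G (A : Set Ω), g • w = v := by
  rw [Quotient.eq, MulAction.orbitRel_apply]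
  constructor
  · rintro ⟨⟨g, hg⟩, h⟩; exact ⟨g, hg, h⟩
  · rintro ⟨g, hg, h⟩; exact ⟨⟨g, hg⟩, h⟩

theorem exists_smul_out (A : Finset Ω) (v : Ω) :
    ∃ g ∈ fixingSubgroup G (A : Set Ω), g • v = (orbitClass G A v).out :=
  orbitClass_eq.1 (Quotient.out_eq _)

namespace IsMeasure

variable {μ : TransMap G Ω → k} (hμ : IsMeasure μ)

include hμ

open Classical in
theorem relVal_term {A : Finset Ω} {S : Set Ω} (hS : StableUnder G A S) (v : Ω) :
    (if (orbitClass G A v).out ∈ S then stepMeasure μ A (orbitClass G A v).out else 0) =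
      if v ∈ S then stepMeasure μ A v else 0 := by
  obtain ⟨g, hg, h⟩ := exists_smul_out (G := G) A v
  rw [← h, hμ.stepMeasure_smul_of_mem hg]
  simp only [hS g hg v]

variable (hfin : ∀ A : Finset Ω, Finite (MulAction.orbitRel.Quotient
  (fixingSubgroup G (A : Set Ω)) Ω))

include hfin

omit hμ in
theorem relVal_add (A : Finset Ω) {S S' : Set Ω} (h : Disjoint S S') :
    relVal μ A (S ∪ S') = relVal μ A S + relVal μ A S' := by
  classical
  have := hfin A
  rw [relVal, relVal, relVal, ← finsum_add_distrib (Set.toFinite _) (Set.toFinite _)]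
  refine finsum_congr fun o => ?_
  by_cases h1 : o.out ∈ S
  · simp [h1, Set.disjoint_left.1 h h1]
  · simp [h1]

/-- A G(A)-orbit decomposes into finitely many G(A')-orbits, and base change along G/G(A') → G/G(A)
says that their step measures add up. So the value of a set does not depend on the support used to
compute it. -/
theorem relVal_eq_of_subset {A A' : Finset Ω} (hA : A ⊆ A') {S : Set Ω}
    (hS : StableUnder G A S) : relVal μ A S = relVal μ A' S := by
  classical
  have := hfin A
  have := hfin A'
  let _ := Fintype.ofFinite (MulAction.orbitRel.Quotient (fixingSubgroup G (A : Set Ω)) Ω)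
  let _ := Fintype.ofFinite (MulAction.orbitRel.Quotient (fixingSubgroup G (A' : Set Ω)) Ω)
  rw [relVal, relVal, finsum_eq_sum_of_fintype, finsum_eq_sum_of_fintype]
  let π : MulAction.orbitRel.Quotient (fixingSubgroup G (A' : Set Ω)) Ω →
      MulAction.orbitRel.Quotient (fixingSubgroup G (A : Set Ω)) Ω := fun o => orbitClass G A o.out
  rw [← Finset.sum_fiberwise Finset.univ π]
  refine Finset.sum_congr rfl fun o _ => ?_
  have hout : orbitClass G A o.out = o := Quotient.out_eq _
  have h1 : stepMeasure μ A o.out = ∑ o' : {o' // π o' = o}, stepMeasure μ A' o'.1.out := by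
    refine hμ.stepMeasure_eq_sum hA _ (fun o' : {o' // π o' = o} => o'.1.out) (fun o' => ?_)
      fun x hx => ?_
    · obtain ⟨g, hg, h⟩ := orbitClass_eq.1 (o'.2.trans hout.symm)
      exact ⟨⟨g, hg⟩, h⟩
    · have hxo : orbitClass G A x = o := by
        rw [← hout, orbitClass_eq]
        obtain ⟨⟨g, hg⟩, h⟩ := hx
        exact ⟨g, hg, h⟩
      refine ⟨⟨orbitClass G A' x, ?_⟩, ?_, ?_⟩
      · obtain ⟨g, hg, h⟩ := exists_smul_out (G := G) A' x
        rw [← hxo]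
        exact orbitClass_eq.2 ⟨g, fixingSubgroup_mono hA hg, h⟩
      · exact MulAction.orbitRel_apply.1 (Quotient.exact (Quotient.out_eq (orbitClass G A' x)).symm)
      · rintro ⟨o', ho'⟩ ⟨⟨g, hg⟩, h⟩
        refine Subtype.ext ?_
        change o' = orbitClass G A' x
        rw [← Quotient.out_eq o']
        exact (orbitClass_eq.2 ⟨g, hg, h⟩).symm
  have h3 : ∀ o' ∈ Finset.univ.filter fun o' => π o' = o,
      (if o'.out ∈ S then stepMeasure μ A' o'.out else 0) =
        if o.out ∈ S then stepMeasure μ A' o'.out else 0 := by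
    intro o' ho'
    obtain ⟨g, hg, h⟩ := orbitClass_eq.1 ((Finset.mem_filter.1 ho').2.trans hout.symm)
    have h4 : o'.out ∈ S ↔ o.out ∈ S := h ▸ hS g hg o.out
    simp only [h4]
  rw [Finset.sum_congr rfl h3]
  by_cases ho : o.out ∈ S
  · simp only [ho, if_true, h1]
    exact (Finset.sum_subtype (p := fun x => π x = o) (Finset.univ.filter fun x => π x = o)
      (fun x => by rw [Finset.mem_filter]; exact and_iff_right (Finset.mem_univ x))
      (fun x => stepMeasure μ A' x.out)).symm
  · simp [ho]

/-- Commuting with G(A), e permutes the orbits, and by hypothesis it preserves their measures. It is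
applied to translations and to homotheties. -/
theorem relVal_equiv {A : Finset Ω} {S S' : Set Ω} (hS : StableUnder G A S)
    (hS' : StableUnder G A S') (e : Ω ≃ Ω)
    (he : ∀ g ∈ fixingSubgroup G (A : Set Ω), ∀ v, e (g • v) = g • e v)
    (hSS' : ∀ v, e v ∈ S' ↔ v ∈ S) (hm : ∀ v, stepMeasure μ A (e v) = stepMeasure μ A v) :
    relVal μ A S = relVal μ A S' := by
  classical
  have := hfin A
  let _ := Fintype.ofFinite (MulAction.orbitRel.Quotient (fixingSubgroup G (A : Set Ω)) Ω)
  rw [relVal, relVal, finsum_eq_sum_of_fintype, finsum_eq_sum_of_fintype]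
  refine Fintype.sum_equiv (Quotient.congr e fun v w => ?_) _ _ fun o => ?_
  · change MulAction.orbitRel _ _ v w ↔ MulAction.orbitRel _ _ (e v) (e w)
    rw [MulAction.orbitRel_apply, MulAction.orbitRel_apply]
    constructor
    · rintro ⟨g, rfl⟩
      exact ⟨g, (he g g.2 w).symm⟩
    · rintro ⟨g, hg⟩
      refine ⟨g, e.injective ?_⟩
      rw [← hg]
      exact he g g.2 w
  · induction o using Quotient.inductionOn with
    | _ v =>
      rw [Quotient.congr_mk]
      exact (hμ.relVal_term hS v).trans ((hμ.relVal_term hS' (e v)).trans (by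
        simp only [hSS', hm])).symm

theorem relVal_orbit (A : Finset Ω) (v : Ω) :
    relVal μ A (MulAction.orbit (fixingSubgroup G (A : Set Ω)) v) = stepMeasure μ A v := by
  classical
  have := hfin A
  let _ := Fintype.ofFinite (MulAction.orbitRel.Quotient (fixingSubgroup G (A : Set Ω)) Ω)
  rw [relVal, finsum_eq_sum_of_fintype, Finset.sum_eq_single (orbitClass G A v)]
  · rw [hμ.relVal_term (stableUnder_orbit A v), if_pos (MulAction.mem_orbit_self v)]
  · intro o _ ho
    rw [if_neg]
    intro h
    apply ho
    rw [← Quotient.out_eq o]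
    obtain ⟨⟨g, hg⟩, h⟩ := h
    exact orbitClass_eq.2 ⟨g, hg, h⟩
  · simp

end IsMeasure

open Classical in
/-- The valuation on sets of finite support attached to a measure. -/
noncomputable def totalVal (μ : TransMap G Ω → k) (S : Set Ω) : k :=
  if h : ∃ A : Finset Ω, StableUnder G A S then relVal μ h.choose S else 0

theorem IsMeasure.totalVal_eq {μ : TransMap G Ω → k} (hμ : IsMeasure μ)
    (hfin : ∀ A : Finset Ω, Finite (MulAction.orbitRel.Quotient
      (fixingSubgroup G (A : Set Ω)) Ω)) {A : Finset Ω} {S : Set Ω} (hS : StableUnder G A S) :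
    totalVal μ S = relVal μ A S := by
  classical
  have h : ∃ A : Finset Ω, StableUnder G A S := ⟨A, hS⟩
  rw [totalVal, dif_pos h,
    hμ.relVal_eq_of_subset hfin (Finset.subset_union_left (s₂ := A)) h.choose_spec,
    hμ.relVal_eq_of_subset hfin (Finset.subset_union_right (s₁ := h.choose)) hS]

end RelVal

/-! ### Translation invariance of the valuation on `𝐕` -/

section MeasureVal

variable {F : Type u} [Field F] {k : Type v} [CommRing k]

theorem fixing_mem {A : Finset (VInf F)} {g : OInf F}
    (hg : g ∈ fixingSubgroup (OInf F) (A : Set (VInf F))) {a : VInf F} (ha : a ∈ A) : g • a = a :=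
  mem_fixingSubgroup_finset.1 hg a ha

/-- Once x is fixed, fixing v + x and fixing v are the same condition. -/
theorem stepMeasure_add {μ : TransMap (OInf F) (VInf F) → k} (hμ : IsMeasure μ)
    {A : Finset (VInf F)} {x : VInf F} (hx : x ∈ A) (v : VInf F) :
    stepMeasure μ A (v + x) = stepMeasure μ A v := by
  classical
  refine hμ.stepMeasure_congr rfl ?_
  ext g
  simp only [mem_fixingSubgroup_finset, Finset.forall_mem_insert]
  refine and_congr_left fun h => ?_
  rw [OInf.smul_add', h x hx, add_left_inj]

theorem stepMeasure_smul_vector {μ : TransMap (OInf F) (VInf F) → k} (hμ : IsMeasure μ)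
    (A : Finset (VInf F)) {c : F} (hc : c ≠ 0) (v : VInf F) :
    stepMeasure μ A (c • v) = stepMeasure μ A v := by
  classical
  refine hμ.stepMeasure_congr rfl ?_
  ext g
  simp only [mem_fixingSubgroup_finset, Finset.forall_mem_insert]
  refine and_congr_left fun h => ?_
  rw [OInf.smul_smul', smul_right_inj hc]

variable [Fintype F]

/-- By Witt's theorem an orbit is determined by the vector itself if it lies in the span, and
otherwise by its pairings with A and its norm. Over a finite field these take finitely many values.
-/
theorem finite_orbits (h2 : (2 : F) ≠ 0) (A : Finset (VInf F)) :
    Finite (MulAction.orbitRel.Quotient (fixingSubgroup (OInf F) (A : Set (VInf F))) (VInf F)) := by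
  classical
  have hfin := finite_span A
  have : Finite (Submodule.span F (A : Set (VInf F))) := hfin
  let T : VInf F → (Option (Submodule.span F (A : Set (VInf F)))) × (A → F) × F := fun v =>
    (if h : v ∈ Submodule.span F (A : Set (VInf F)) then some ⟨v, h⟩ else none,
      fun a => formInf F v a, formInf F v v)
  refine Finite.of_injective (fun o : MulAction.orbitRel.Quotient
    (fixingSubgroup (OInf F) (A : Set (VInf F))) (VInf F) => T o.out) fun o o' h => ?_
  rw [← Quotient.out_eq o, ← Quotient.out_eq o']
  change orbitClass (OInf F) A _ = orbitClass (OInf F) A _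
  simp only [T, Prod.mk.injEq] at h
  obtain ⟨h1, h3, h4⟩ := h
  by_cases hv : o.out ∈ Submodule.span F (A : Set (VInf F))
  · by_cases hw : o'.out ∈ Submodule.span F (A : Set (VInf F))
    · simp only [hv, hw, dif_pos, Option.some.injEq, Subtype.mk.injEq] at h1
      rw [h1]
    · simp [hv, hw] at h1
  · by_cases hw : o'.out ∈ Submodule.span F (A : Set (VInf F))
    · simp [hv, hw] at h1
    · obtain ⟨g, hg, h⟩ := exists_smul_eq_of_type h2 hw hv
        (fun a ha => (congrFun h3 ⟨a, ha⟩).symm) h4.symm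
      exact orbitClass_eq.2 ⟨g, mem_fixingSubgroup_finset.2 hg, h⟩

/-- The valuation on `𝐕` attached to a measure. -/
noncomputable def IsMeasure.toQVal (h2 : (2 : F) ≠ 0) {μ : TransMap (OInf F) (VInf F) → k}
    (hμ : IsMeasure μ) : QVal (formInf F) ⊤ k where
  dom S := ∃ A : Finset (VInf F), StableUnder (OInf F) A S
  ν := totalVal μ
  symm := formInf_comm
  rep l b _ _ hb := by
    classical
    obtain ⟨v, hv, hvb⟩ := exists_perp_one (A := l.toFinset) (b := b) (by simpa using hb)
    exact ⟨v, trivial, by simpa using hv, hvb⟩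
  dom_inter := by
    classical
    rintro S S' ⟨A, hA⟩ ⟨A', hA'⟩
    exact ⟨A ∪ A', fun g hg v => and_congr (hA.mono Finset.subset_union_left g hg v)
      (hA'.mono Finset.subset_union_right g hg v)⟩
  dom_compl := by
    rintro S ⟨A, hA⟩
    exact ⟨A, fun g hg v => not_congr (hA g hg v)⟩
  dom_form a _ d := ⟨{a}, fun g hg v => by
    have := fixing_mem hg (Finset.mem_singleton_self a)
    simp only [Set.mem_ofPred_eq]
    conv_lhs => rw [← this, OInf.form_smul]⟩
  dom_norm c := ⟨∅, fun g hg v => by simp only [Set.mem_ofPred_eq, OInf.form_smul]⟩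
  dom_point v _ := ⟨{v}, fun g hg x => by
    have := fixing_mem hg (Finset.mem_singleton_self v)
    simp only [Set.mem_singleton_iff]
    conv_lhs => rw [← this, smul_left_cancel_iff]⟩
  add := by
    classical
    rintro S S' ⟨A, hA⟩ ⟨A', hA'⟩ hd
    have h1 := hA.mono (Finset.subset_union_left (s₂ := A'))
    have h3 := hA'.mono (Finset.subset_union_right (s₁ := A))
    rw [hμ.totalVal_eq (finite_orbits h2) h1, hμ.totalVal_eq (finite_orbits h2) h3,
      hμ.totalVal_eq (finite_orbits h2) (A := A ∪ A') (fun g hg v => or_congr (h1 g hg v)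
        (h3 g hg v)), IsMeasure.relVal_add (finite_orbits h2) _ hd]
  transl := by
    classical
    rintro S x ⟨A, hA⟩ -
    have h1 := hA.mono (Finset.subset_insert x A)
    -- Translation by `x` is equivariant once `x` has been added to the support.
    have hx : ∀ g ∈ fixingSubgroup (OInf F) ((insert x A : Finset (VInf F)) : Set (VInf F)),
        ∀ v, g • v + x = g • (v + x) := fun g hg v => by
      rw [OInf.smul_add', fixing_mem hg (Finset.mem_insert_self x A)]
    have h3 : StableUnder (OInf F) (insert x A) {v | v + x ∈ S} := fun g hg v => by
      simp only [Set.mem_ofPred_eq, hx g hg]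
      exact h1 g hg _
    rw [hμ.totalVal_eq (finite_orbits h2) h1, hμ.totalVal_eq (finite_orbits h2) h3]
    exact hμ.relVal_equiv (finite_orbits h2) h3 h1 (Equiv.addRight x) hx (fun v => Iff.rfl)
      (stepMeasure_add hμ (Finset.mem_insert_self x A))
  point v _ := by
    have h1 : relOrbit {v} v = {v} := relOrbit_of_mem (Submodule.subset_span (by simp))
    have h3 : StableUnder (OInf F) {v} {v} := fun g hg x => by
      have := fixing_mem hg (Finset.mem_singleton_self v)
      simp only [Set.mem_singleton_iff]
      conv_lhs => rw [← this, smul_left_cancel_iff]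
    rw [hμ.totalVal_eq (finite_orbits h2) h3]
    have := hμ.relVal_orbit (finite_orbits h2) {v} v
    rw [relOrbit, Finset.coe_singleton] at h1
    rw [Finset.coe_singleton, h1] at this
    rw [this]
    exact hμ.stepMeasure_of_fixed fun g hg => fixing_mem hg (Finset.mem_singleton_self v)

theorem IsMeasure.toQVal_relOrbit (h2 : (2 : F) ≠ 0) {μ : TransMap (OInf F) (VInf F) → k}
    (hμ : IsMeasure μ) (A : Finset (VInf F)) (v : VInf F) :
    (hμ.toQVal h2).ν (relOrbit A v) = stepMeasure μ A v := by
  change totalVal μ _ = _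
  rw [hμ.totalVal_eq (finite_orbits h2) (stableUnder_orbit A v),
    hμ.relVal_orbit (finite_orbits h2)]

end MeasureVal

/-! ### Factorization of maps into one-vector extensions -/

section Induction

variable {G : Type u} [Group G] {Ω : Type u} [MulAction G Ω]

open Classical in
/-- Every map of transitive smooth sets is a composite of isomorphisms and one-step extensions. -/
theorem TransMap.induction {P : TransMap G Ω → Prop}
    (iso : ∀ {Y X : TransSet G Ω} (f : Y →[G] X), Function.Bijective f → P ⟨Y, X, f⟩)
    (comp : ∀ {Z Y X : TransSet G Ω} (f : Y →[G] X) (g : Z →[G] Y),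
      P ⟨Y, X, f⟩ → P ⟨Z, Y, g⟩ → P ⟨Z, X, f.comp g⟩)
    (step : ∀ {Y X : TransSet G Ω} (f : Y →[G] X) (y : Y) (A : Finset Ω) (v : Ω),
      MulAction.stabilizer G y = fixingSubgroup G ((insert v A : Finset Ω) : Set Ω) →
      MulAction.stabilizer G (f y) = fixingSubgroup G (A : Set Ω) → P ⟨Y, X, f⟩)
    (f : TransMap G Ω) : P f := by
  have key : ∀ (C A : Finset Ω) (Y X : TransSet G Ω) (f : Y →[G] X) (y : Y),
      MulAction.stabilizer G y = fixingSubgroup G ((C ∪ A : Finset Ω) : Set Ω) →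
      MulAction.stabilizer G (f y) = fixingSubgroup G (A : Set Ω) → P ⟨Y, X, f⟩ := by
    intro C
    induction C using Finset.induction_on with
    | empty =>
      intro A Y X f y hy hx
      refine iso f (bijective_of_stabilizer f y ?_)
      rw [hy, hx, Finset.empty_union]
    | insert c C hc ih =>
      intro A Y X f y hy hx
      have e : insert c C ∪ A = C ∪ insert c A := by
        rw [Finset.insert_union, Finset.union_insert]
      rw [e] at hy
      obtain ⟨f₁, hf₁⟩ := exists_equivariant_map (TransSet.base (G := G) (insert c A)) (f y) (by
        rw [TransSet.stabilizer_base, hx]; exact fixingSubgroup_mono (Finset.subset_insert _ _))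
      obtain ⟨f₂, hf₂⟩ := exists_equivariant_map y (TransSet.base (G := G) (insert c A)) (by
        rw [TransSet.stabilizer_base, hy]; exact fixingSubgroup_mono Finset.subset_union_right)
      have hcomp : f = f₁.comp f₂ := equivariant_ext y (by
        change _ = f₁ (f₂ y)
        rw [hf₂, hf₁])
      rw [hcomp]
      refine comp f₁ f₂ (step f₁ (TransSet.base _) A c (TransSet.stabilizer_base _) ?_)
        (ih (insert c A) _ _ f₂ y hy ?_)
      · rw [hf₁, hx]
      · rw [hf₂, TransSet.stabilizer_base]
  obtain ⟨Y, X, f⟩ := f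
  obtain ⟨y⟩ := Y.isTransSmooth.nonempty
  obtain ⟨C, hC⟩ := Y.isTransSmooth.smooth y
  obtain ⟨A, hA⟩ := X.isTransSmooth.smooth (f y)
  -- The existence of f gives G(C) ≤ G(A), so adding A to C leaves the stabilizer of y unchanged.
  refine key C A Y X f y (le_antisymm ?_ ?_) hA
  · intro g hg
    have h1 := stabilizer_le_of_map f y hg
    rw [hC] at hg
    rw [hA] at h1
    rw [mem_fixingSubgroup_iff] at hg h1 ⊢
    intro a ha
    rcases Finset.mem_union.1 (Finset.mem_coe.1 ha) with ha | ha
    · exact hg a ha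
    · exact h1 a ha
  · rw [hC]; exact fixingSubgroup_mono Finset.subset_union_left

end Induction

/-! ### The parameters of a measure -/

section Parameters

variable {F : Type u} [Field F] [Fintype F]

theorem chi_nonsquare {R : Type v} [CommRing R] {a : F} (ha : ¬ IsSquare a) : chi R a = -1 := by
  classical
  simp [chi, quadraticChar_neg_one_iff_not_isSquare.2 ha]

open Classical in
omit [Fintype F] in
-- The span is zero here, so the only vector that may have to be discarded is 0, of norm 0.
theorem hasData_empty (v : VInf F) :
    HasData ∅ v (.perp [] (formInf F v v) (if formInf F v v = 0 then 1 else 0)) := by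
  refine ⟨[], trivial, by simp, rfl, 0, Submodule.zero_mem _, by simp, by simp, ?_⟩
  split_ifs with h
  · symm
    rw [Set.ncard_eq_one]
    refine ⟨0, ?_⟩
    ext x
    simp only [List.not_mem_nil, Set.mem_ofPred_eq, Set.mem_singleton_iff]
    constructor
    · rintro ⟨hx, -⟩
      simpa using hx
    · rintro rfl
      simp [h]
  · symm
    rw [Set.ncard_eq_zero ((Set.finite_singleton (0 : VInf F)).subset (by
      rintro x ⟨hx, -⟩; simpa using hx))]
    ext x
    simp only [List.not_mem_nil, Set.mem_ofPred_eq, Set.mem_empty_iff_false, iff_false]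
    rintro ⟨hx, -, hxx⟩
    simp at hx
    rw [hx] at hxx
    exact h (by simpa using hxx.symm)

omit [Fintype F] in
theorem goodList_singleton {v : VInf F} (hv : v ≠ 0) : GoodList (formInf F) [v] :=
  ⟨trivial, by simp, by simpa using hv⟩

/-- The line of an anisotropic v meets its complement only in 0, whose norm differs from that of w;
nothing is discarded. -/
theorem hasData_perp {v w : VInf F} (hv : formInf F v v ≠ 0) (hvw : formInf F w v = 0)
    (hw : formInf F w w ≠ 0) : HasData {v} w (.perp [formInf F v v] (formInf F w w) 0) := by
  refine ⟨[v], goodList_singleton (by rintro rfl; simp at hv), by simp, rfl, 0,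
    Submodule.zero_mem _, by simp [hvw], by simp, ?_⟩
  symm
  rw [Set.ncard_eq_zero ((finite_span {v}).subset (by
    rintro x ⟨hx, -⟩; simpa using hx))]
  ext x
  simp only [Set.mem_ofPred_eq, Set.mem_empty_iff_false, iff_false]
  rintro ⟨hx, hxv, hxx⟩
  simp only [List.mem_singleton, Set.ofPred_eq_eq_singleton, Submodule.mem_span_singleton] at hx
  obtain ⟨a, rfl⟩ := hx
  have : a = 0 := by simpa [hv] using hxv v
  exact hw (by rw [← hxx, this]; simp)

omit [Fintype F] in
theorem hasData_hyperbolic {v w : VInf F} (hv : formInf F v v = 0) (hvw : formInf F w v ≠ 0) :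
    HasData {v} w (.rad 1) := by
  refine ⟨[v], goodList_singleton (by rintro rfl; simp at hvw), by simp, rfl, v,
    Submodule.subset_span (by simp), by simp [hv], hvw⟩

omit [Fintype F] in
theorem notMem_span_of_perp {v w : VInf F} (hv : formInf F v v ≠ 0) (hvw : formInf F w v = 0)
    (hw : w ≠ 0) : w ∉ Submodule.span F (({v} : Finset (VInf F)) : Set (VInf F)) := by
  intro h
  simp only [Finset.coe_singleton, Submodule.mem_span_singleton] at h
  obtain ⟨a, rfl⟩ := h
  have : a = 0 := by simpa [hv] using hvw
  exact hw (by simp [this])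

omit [Fintype F] in
theorem notMem_span_of_isotropic {v w : VInf F} (hv : formInf F v v = 0)
    (hvw : formInf F w v ≠ 0) :
    w ∉ Submodule.span F (({v} : Finset (VInf F)) : Set (VInf F)) := by
  intro h
  simp only [Finset.coe_singleton, Submodule.mem_span_singleton] at h
  obtain ⟨a, rfl⟩ := h
  exact hvw (by simp [hv])

/-- Both x² and e − dy² take (q + 1)/2 values, so they have one in common. -/
theorem exists_add_sq_eq (h2 : (2 : F) ≠ 0) {d : F} (hd : d ≠ 0) (e : F) :
    ∃ x y : F, x * x + d * (y * y) = e := by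
  have h1 : degree (C d * X ^ 2 : F[X]) = 2 := degree_C_mul_X_pow 2 hd
  obtain ⟨x, y, h⟩ := FiniteField.exists_root_sum_quadratic
    (f := (X ^ 2 : F[X])) (g := C d * X ^ 2 - C e) (degree_X_pow 2)
    (by rw [degree_sub_C (by rw [h1]; decide), h1])
    (FiniteField.odd_card_of_char_ne_two (ringChar_ne_two_of h2))
  refine ⟨x, y, ?_⟩
  simp at h
  linear_combination h

omit [Fintype F] in
theorem eq_inv_smul_plane {V : Type w} [AddCommGroup V] [Module F V] (v w : V) {a b c d : F}
    (h : a * d - b * c ≠ 0) :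
    v = (a * d - b * c)⁻¹ • (d • (a • v + b • w) - b • (c • v + d • w)) ∧
      w = (a * d - b * c)⁻¹ • (a • (c • v + d • w) - c • (a • v + b • w)) := by
  constructor <;> (rw [eq_inv_smul_iff₀ h]; module)

variable {k : Type v} [CommRing k] {μ : TransMap (OInf F) (VInf F) → k} (hμ : IsMeasure μ)

include hμ

omit [Fintype F] in
-- Pairs of vectors related by an invertible matrix have the same stabilizer. Comparing the two ways
-- to adjoin a plane is the source of the relations between the parameters.
theorem IsMeasure.stepMeasure_plane (v w : VInf F) {a b c d : F} (h : a * d - b * c ≠ 0) :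
    stepMeasure μ ∅ v * stepMeasure μ {v} w =
      stepMeasure μ ∅ (a • v + b • w) * stepMeasure μ {a • v + b • w} (c • v + d • w) := by
  apply hμ.stepMeasure_swap
  intro g
  constructor <;> rintro ⟨h1, h3⟩
  · simp only [OInf.smul_add', OInf.smul_smul', h1, h3, and_self]
  · obtain ⟨e1, e2⟩ := eq_inv_smul_plane v w h
    constructor
    · conv_lhs => rw [e1]
      rw [OInf.smul_smul', OInf.smul_sub', OInf.smul_smul', OInf.smul_smul', h1, h3, ← e1]
    · conv_lhs => rw [e2]
      rw [OInf.smul_smul', OInf.smul_sub', OInf.smul_smul', OInf.smul_smul', h1, h3, ← e2]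

/-- Homothety by a commutes with G, and a vector and its nonzero multiples have the same stabilizer.
-/
theorem IsMeasure.ν_norm_mul_sq (h2 : (2 : F) ≠ 0) {a : F} (ha : a ≠ 0) (c : F) :
    (hμ.toQVal h2).ν {v | formInf F v v = a * a * c} =
      (hμ.toQVal h2).ν {v | formInf F v v = c} := by
  have hst : ∀ c : F, StableUnder (OInf F) ∅ {v : VInf F | formInf F v v = c} :=
    fun c g hg v => by simp only [Set.mem_ofPred_eq, OInf.form_smul]
  change totalVal μ _ = totalVal μ _
  rw [hμ.totalVal_eq (finite_orbits h2) (hst _), hμ.totalVal_eq (finite_orbits h2) (hst _)]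
  refine (hμ.relVal_equiv (finite_orbits h2) (hst _) (hst _)
    (LinearEquiv.smulOfNeZero F (VInf F) a ha).toEquiv (fun g _ v => ?_) (fun v => ?_)
    (fun v => stepMeasure_smul_vector hμ _ ha v)).symm
  · exact (OInf.smul_smul' g a v).symm
  · change formInf F (a • v) (a • v) = _ ↔ formInf F v v = c
    simp only [map_smul, LinearMap.smul_apply, smul_eq_mul, ← mul_assoc]
    exact ⟨fun h => mul_left_cancel₀ (mul_ne_zero ha ha) h, fun h => by rw [h]⟩

/-- Away from 0 the level function has only two values, at 1 and at a nonsquare; inverting 2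
separates them into their half difference u and their half sum. Taking T to be the total then fixes
w and forces the value at 0. -/
theorem IsMeasure.exists_param (h2 : (2 : F) ≠ 0) {qi hi : k}
    (hq : (Fintype.card F : k) * qi = 1) (hhi : 2 * hi = 1) :
    ∃ p : QParam k, ∀ c, (hμ.toQVal h2).ν {v | formInf F v v = c} = p.val qi c := by
  classical
  obtain ⟨ε, hε⟩ := FiniteField.exists_nonsquare (ringChar_ne_two_of h2)
  have hε0 : ε ≠ 0 := by rintro rfl; exact hε (IsSquare.zero)
  set M := hμ.toQVal h2 with hM
  set Q : F → k := fun c => M.ν {v | formInf F v v = c} with hQ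
  have hχε := chi_nonsquare (R := k) hε
  let p : QParam k := ⟨∑ c, Q c, (Q 1 - Q ε) * hi, (∑ c, Q c) * qi - (Q 1 + Q ε) * hi⟩
  have key : ∀ c, c ≠ 0 → Q c = p.val qi c := by
    intro c hc
    by_cases hs : IsSquare c
    · obtain ⟨a, rfl⟩ := hs
      have ha : a ≠ 0 := by rintro rfl; simp at hc
      have h1 : Q (a * a) = Q 1 := by
        have := hμ.ν_norm_mul_sq h2 ha 1
        rwa [mul_one] at this
      rw [h1]
      simp only [QParam.val, p, chi_sq ha, hc, if_false]
      linear_combination (-Q 1) * hhi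
    · have h1 : Q c = Q ε := by
        obtain ⟨a, ha⟩ : IsSquare (c * ε) := by
          have h3 := FiniteField.isSquare_iff (ringChar_ne_two_of h2) (mul_ne_zero hc hε0)
          rw [← quadraticChar_one_iff_isSquare (mul_ne_zero hc hε0), map_mul,
            quadraticChar_neg_one_iff_not_isSquare.2 hs,
            quadraticChar_neg_one_iff_not_isSquare.2 hε]
          rfl
        have ha0 : a ≠ 0 := by rintro rfl; simp [hc, hε0] at ha
        have := hμ.ν_norm_mul_sq h2 (div_ne_zero ha0 hε0) ε
        have e : a / ε * (a / ε) * ε = c := by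
          field_simp; linear_combination -ha
        rw [e] at this
        exact this
      rw [h1]
      simp only [QParam.val, p, chi_nonsquare hs, hc, if_false]
      linear_combination (-Q ε) * hhi
  refine ⟨p, fun c => ?_⟩
  by_cases hc : c = 0
  · subst hc
    have h1 := p.sum_val h2 hq
    have h3 : ∑ c, Q c = p.T := rfl
    rw [← h1, ← Finset.add_sum_erase _ _ (Finset.mem_univ (0 : F)),
      ← Finset.add_sum_erase _ _ (Finset.mem_univ (0 : F)),
      Finset.sum_congr rfl fun c hc => key c (Finset.ne_of_mem_erase hc)] at h3
    exact add_right_cancel h3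
  · exact key c hc

/-- The relations between the parameters of a measure. -/
theorem IsMeasure.param_relations (h2 : (2 : F) ≠ 0) {qi hi : k}
    (hq : (Fintype.card F : k) * qi = 1) (hhi : 2 * hi = 1) {p : QParam k}
    (hp : ∀ c, (hμ.toQVal h2).ν {v | formInf F v v = c} = p.val qi c) :
    p.u * p.w = 0 ∧ p.T = (Fintype.card F : k) ^ 2 * p.w ^ 2 + Fintype.card F * p.u ^ 2 := by
  classical
  obtain ⟨ε, hε⟩ := FiniteField.exists_nonsquare (ringChar_ne_two_of h2)
  have hε0 : ε ≠ 0 := by rintro rfl; exact hε (IsSquare.zero)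
  have hχε := chi_nonsquare (R := k) hε
  have s1 : ∀ v : VInf F, v ≠ 0 → stepMeasure μ ∅ v =
      p.val qi (formInf F v v) - if formInf F v v = 0 then 1 else 0 := by
    intro v hv
    rw [← hμ.toQVal_relOrbit h2, (hμ.toQVal h2).ν_relOrbit h2 hq hp (by simp) (by simpa using hv)
      (hasData_empty v)]
    simp [StepData.eval, QParam.par]
  have s2 : ∀ v w : VInf F, formInf F v v ≠ 0 → formInf F w v = 0 → formInf F w w ≠ 0 →
      stepMeasure μ {v} w = (p.step qi (formInf F v v)).val qi (formInf F w w) := by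
    intro v w hv hvw hw
    rw [← hμ.toQVal_relOrbit h2, (hμ.toQVal h2).ν_relOrbit h2 hq hp (by simp)
      (notMem_span_of_perp hv hvw (by rintro rfl; simp at hw)) (hasData_perp hv hvw hw)]
    simp [StepData.eval, QParam.par]
  have s3 : ∀ v w : VInf F, formInf F v v = 0 → formInf F w v ≠ 0 →
      stepMeasure μ {v} w = p.T * qi ^ 2 := by
    intro v w hv hvw
    rw [← hμ.toQVal_relOrbit h2, (hμ.toQVal h2).ν_relOrbit h2 hq hp (by simp)
      (notMem_span_of_isotropic hv hvw) (hasData_hyperbolic hv hvw)]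
    simp [StepData.eval]
  have ne0 : ∀ v : VInf F, formInf F v v ≠ 0 → v ≠ 0 := by rintro v hv rfl; simp at hv
  -- The plane with orthogonal basis of norms 1, d represents the nonsquare ε, so it also has an
  -- orthogonal basis of norms ε, dε. Equating the two products leaves this multiple of uw.
  have rel1 : ∀ d : F, d ≠ 0 → 2 * (p.u * p.w) * (chi k (-1 : F) * chi k d + qi) = 0 := by
    intro d hd
    obtain ⟨x, y, hxy⟩ := exists_add_sq_eq h2 hd ε
    have h11 : formInf F (normVec 0 1) (normVec 0 1) = 1 := by
      rw [formInf_normVec, if_pos rfl]; field_simp; norm_num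
    have hdd : formInf F (normVec 1 d) (normVec 1 d) = d := by
      rw [formInf_normVec, if_pos rfl]; field_simp; ring
    have h1d : formInf F (normVec 0 1) (normVec 1 d) = 0 := by
      rw [formInf_normVec, if_neg zero_ne_one]
    have hd1 : formInf F (normVec 1 d) (normVec 0 1) = 0 := by
      rw [formInf_normVec, if_neg one_ne_zero]
    set v : VInf F := normVec 0 1
    set w : VInf F := normVec 1 d
    have hv' : formInf F (x • v + y • w) (x • v + y • w) = ε := by
      simp only [map_add, map_smul, LinearMap.add_apply, LinearMap.smul_apply, smul_eq_mul, h11,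
        hdd, h1d, hd1]
      linear_combination hxy
    have hw' : formInf F ((-(d * y)) • v + x • w) ((-(d * y)) • v + x • w) = d * ε := by
      simp only [map_add, map_smul, LinearMap.add_apply, LinearMap.smul_apply, smul_eq_mul, h11,
        hdd, h1d, hd1]
      linear_combination d * hxy
    have hvw' : formInf F ((-(d * y)) • v + x • w) (x • v + y • w) = 0 := by
      simp only [map_add, map_smul, LinearMap.add_apply, LinearMap.smul_apply, smul_eq_mul, h11,
        hdd, h1d, hd1]
      ring
    have hsw := hμ.stepMeasure_plane v w (a := x) (b := y) (c := -(d * y)) (d := x) (by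
      have : x * x - y * -(d * y) = ε := by linear_combination hxy
      rwa [this])
    rw [s1 v (ne0 v (by rw [h11]; exact one_ne_zero)), s1 _ (ne0 _ (by rwa [hv'])),
      s2 v w (by rw [h11]; exact one_ne_zero) hd1 (by rwa [hdd]),
      s2 _ _ (by rwa [hv']) hvw' (by rw [hw']; exact mul_ne_zero hd hε0), h11, hdd, hv', hw'] at hsw
    have hχ : chi k (-ε) = - chi k (-1 : F) := by
      rw [← neg_one_mul, chi_mul, hχε]; ring
    simp only [QParam.val, QParam.step, one_ne_zero, hε0, hd, mul_eq_zero, or_self, if_false,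
      chi_one, hχε, chi_mul, hχ] at hsw
    linear_combination hsw
  have hu : p.u * p.w = 0 := by
    have h1 := rel1 1 one_ne_zero
    have h3 := rel1 ε hε0
    rw [chi_one] at h1
    rw [hχε] at h3
    -- Adding the cases d = 1 and d = ε cancels the term with χ(d) and leaves 4uw/q.
    have h4 : p.u * p.w = hi * hi * Fintype.card F * (2 * (p.u * p.w) * (chi k (-1 : F) * 1 + qi) +
        2 * (p.u * p.w) * (chi k (-1 : F) * -1 + qi)) := by
      have : hi * hi * Fintype.card F * (2 * (p.u * p.w) * (chi k (-1 : F) * 1 + qi) +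
        2 * (p.u * p.w) * (chi k (-1 : F) * -1 + qi)) =
          (2 * hi) * (2 * hi) * (Fintype.card F * qi) * (p.u * p.w) := by ring
      rw [this, hhi, hq]; ring
    rw [h4, h1, h3]; ring
  refine ⟨hu, ?_⟩
  have hee : formInf F (Finsupp.single (Sum.inl 0) 1) (Finsupp.single (Sum.inl 0) 1) = 0 := by
    simp [formInf_single]
  have hfe : formInf F (Finsupp.single (Sum.inr 0) 1) (Finsupp.single (Sum.inl 0) 1) = 1 := by
    simp [formInf_single]
  -- The hyperbolic plane has the isotropic basis e, f and the orthogonal basis e + f/2, e − f/2 of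
  -- norms 1 and −1. Comparing them determines T.
  have hsw := hμ.stepMeasure_plane (Finsupp.single (Sum.inl 0) 1) (Finsupp.single (Sum.inr 0) 1)
    (a := 1) (b := 1 / 2) (c := 1) (d := -1 / 2) (by
      intro h
      field_simp at h
      norm_num at h
      exact h2 h)
  have e1 : (1 : F) • Finsupp.single (Sum.inl 0) 1 + (1 / 2 : F) • Finsupp.single (Sum.inr 0) 1 =
      normVec 0 (1 : F) := by simp [normVec]
  have e2 : (1 : F) • Finsupp.single (Sum.inl 0) 1 + (-1 / 2 : F) • Finsupp.single (Sum.inr 0) 1 =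
      normVec 0 (-1 : F) := by simp [normVec]
  have h11 : formInf F (normVec 0 1) (normVec 0 1) = 1 := by
    rw [formInf_normVec, if_pos rfl]; field_simp; norm_num
  have h1m : formInf F (normVec 0 (-1)) (normVec 0 1) = 0 := by
    rw [formInf_normVec, if_pos rfl]; simp
  have hmm : formInf F (normVec 0 (-1)) (normVec 0 (-1)) = -1 := by
    rw [formInf_normVec, if_pos rfl]; field_simp; norm_num
  rw [e1, e2, s1 _ (by simp), s1 _ (ne0 _ (by rw [h11]; exact one_ne_zero)),
    s3 _ _ hee (by rw [hfe]; exact one_ne_zero), s2 _ _ (by rw [h11]; exact one_ne_zero) h1m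
    (by rw [hmm]; exact neg_ne_zero.2 one_ne_zero), h11, hmm, hee] at hsw
  simp only [QParam.val, QParam.step, one_ne_zero, neg_eq_zero, if_false, if_true, chi_one,
    chi_zero] at hsw
  have hs : chi k (-1 : F) * chi k (-1 : F) = 1 := chi_mul_self (neg_ne_zero.2 one_ne_zero)
  have hT : p.T * qi ^ 2 = p.w ^ 2 + p.u ^ 2 * qi := by
    linear_combination -hsw - (1 + qi) * hu + (p.w * p.T * qi) * hq -
      p.w * (p.T * qi + p.u - p.w) * hs
  calc p.T = (Fintype.card F * qi) ^ 2 * p.T := by rw [hq]; ring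
    _ = (Fintype.card F : k) ^ 2 * (p.T * qi ^ 2) := by ring
    _ = _ := by rw [hT]; linear_combination (Fintype.card F : k) * p.u ^ 2 * hq

/-- In a factorization into one-vector extensions and isomorphisms each factor is 1 or an expression
of `StepData.eval` with integer coefficients in 1/q, T, u, w; and T is itself a polynomial in u and
w. -/
theorem IsMeasure.mem_subring (h2 : (2 : F) ≠ 0) {qi hi : k}
    (hq : (Fintype.card F : k) * qi = 1) (hhi : 2 * hi = 1) {p : QParam k}
    (hp : ∀ c, (hμ.toQVal h2).ν {v | formInf F v v = c} = p.val qi c) (S : Subring k)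
    (hqi : qi ∈ S) (hu : p.u ∈ S) (hw : p.w ∈ S) (f : TransMap (OInf F) (VInf F)) : μ f ∈ S := by
  classical
  have hT : p.T ∈ S := by
    rw [(hμ.param_relations h2 hq hhi hp).2]
    exact S.add_mem (S.mul_mem (S.pow_mem (natCast_mem S _) _) (S.pow_mem hw _))
      (S.mul_mem (natCast_mem S _) (S.pow_mem hu _))
  have hχ : ∀ a : F, chi k a ∈ S := fun a => intCast_mem S _
  have hstep : ∀ (l : List F), (p.par qi l).T ∈ S ∧ (p.par qi l).u ∈ S ∧ (p.par qi l).w ∈ S := by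
    intro l
    induction l with
    | nil => exact ⟨hT, hu, hw⟩
    | cons a l ih =>
      obtain ⟨i1, i2, i3⟩ := ih
      change (QParam.step qi a (p.par qi l)).T ∈ S ∧ (QParam.step qi a (p.par qi l)).u ∈ S ∧
        (QParam.step qi a (p.par qi l)).w ∈ S
      unfold QParam.step
      split_ifs
      · exact ⟨S.mul_mem i1 hqi, i2, i3⟩
      · exact ⟨S.mul_mem i1 hqi, S.mul_mem (hχ _) i3, S.mul_mem (S.mul_mem (hχ _) i2) hqi⟩
  have hval : ∀ d : StepData F, d.eval qi p ∈ S := by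
    rintro (⟨l, c, N⟩ | n)
    · obtain ⟨i1, i2, i3⟩ := hstep l
      refine S.sub_mem (S.add_mem (S.add_mem (S.mul_mem i1 hqi) (S.mul_mem i2 (hχ _)))
        (S.mul_mem i3 (S.sub_mem ?_ S.one_mem))) (natCast_mem S N)
      split_ifs
      · exact natCast_mem S _
      · exact S.zero_mem
    · exact S.mul_mem hT (S.pow_mem hqi _)
  induction f using TransMap.induction with
  | iso f hf => rw [hμ.iso f hf]; exact S.one_mem
  | comp f g hf hg => rw [hμ.comp]; exact S.mul_mem hf hg
  | step f y A v hy hx =>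
    rw [hμ.eq_stepMeasure f y hy hx]
    by_cases hv : v ∈ Submodule.span F (A : Set (VInf F))
    · rw [hμ.stepMeasure_of_fixed fun g hg =>
        OInf.smul_eq_of_span (mem_fixingSubgroup_finset.1 hg) v hv]
      exact S.one_mem
    · obtain ⟨d, hd⟩ := exists_hasData h2 A v
      rw [← hμ.toQVal_relOrbit h2, (hμ.toQVal h2).ν_relOrbit h2 hq hp (fun _ _ => trivial) hv hd]
      exact hval d

end Parameters

/-! ### Fibres of maps between sets of equivariant maps -/

section Fibers

variable {G : Type u} [Group G]

/-- The lifts of an equivariant map `α : Δ → X` along `f : Y → X`. -/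
abbrev HomFiber {Δ Y X : Type*} [MulAction G Δ] [MulAction G Y] [MulAction G X] (f : Y →[G] X)
    (α : Δ →[G] X) : Type _ := {ψ : Δ →[G] Y // f.comp ψ = α}

variable {Δ : Type u} [MulAction G Δ] [MulAction.IsPretransitive G Δ]

theorem comp_eq_iff {Y X : Type*} [MulAction G Y] [MulAction G X] (f : Y →[G] X)
    (ψ : Δ →[G] Y) (α : Δ →[G] X) (j : Δ) : f.comp ψ = α ↔ f (ψ j) = α j :=
  ⟨fun h => by rw [← h]; rfl, fun h => equivariant_ext j h⟩

/-- Lifts correspond to points of the fibre with large enough stabilizer. -/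
noncomputable def homFiberEquiv {Y X : Type*} [MulAction G Y] [MulAction G X] (f : Y →[G] X)
    (α : Δ →[G] X) (j : Δ) : HomFiber f α ≃
      {y : Y // f y = α j ∧ MulAction.stabilizer G j ≤ MulAction.stabilizer G y} :=
  Equiv.ofBijective (fun ψ => ⟨ψ.1 j, (comp_eq_iff f ψ.1 α j).1 ψ.2, stabilizer_le_of_map _ _⟩) (by
    constructor
    · intro ψ ψ' h
      exact Subtype.ext (equivariant_ext j (congrArg Subtype.val h))
    · rintro ⟨y, hy, hs⟩
      obtain ⟨ψ, hψ⟩ := exists_equivariant_map j y hs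
      exact ⟨⟨ψ, (comp_eq_iff f ψ α j).2 (by rw [hψ, hy])⟩, Subtype.ext hψ⟩)

omit [MulAction.IsPretransitive G Δ] in
theorem homFiber_of_bijective {Y X : Type*} [MulAction G Y] [MulAction G X] (f : Y →[G] X)
    (hf : Function.Bijective f) (α : Δ →[G] X) : Nonempty (Unique (HomFiber f α)) := by
  let e := MulActionHom.inverse f (Equiv.ofBijective f hf).symm
    (Equiv.ofBijective f hf).left_inv (Equiv.ofBijective f hf).right_inv
  have he : ∀ x, f (e x) = x := (Equiv.ofBijective f hf).right_inv
  exact ⟨⟨⟨e.comp α, by ext x; exact he _⟩⟩, fun ψ => Subtype.ext (by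
    ext x
    apply hf.1
    have := DFunLike.congr_fun ψ.2 x
    exact this.trans (he _).symm)⟩

/-- Lifts along a composite. -/
def homFiberComp {Z Y X : Type*} [MulAction G Z] [MulAction G Y] [MulAction G X] (f : Y →[G] X)
    (g : Z →[G] Y) (α : Δ →[G] X) :
    HomFiber (f.comp g) α ≃ Σ ψ : HomFiber f α, HomFiber g ψ.1 where
  toFun ψ := ⟨⟨g.comp ψ.1, ψ.2⟩, ⟨ψ.1, rfl⟩⟩
  invFun s := ⟨s.2.1, (congrArg (fun ψ => f.comp ψ) s.2.2).trans s.1.2⟩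
  left_inv _ := rfl
  right_inv := by
    rintro ⟨ψ, ⟨χ, hχ⟩⟩
    have key : ∀ (ψ : Δ →[G] Y) (hψ : f.comp ψ = α) (hχ : g.comp χ = ψ)
        (h : f.comp (g.comp χ) = α), (⟨⟨g.comp χ, h⟩, ⟨χ, rfl⟩⟩ :
          Σ ψ : HomFiber f α, HomFiber g ψ.1) = ⟨⟨ψ, hψ⟩, ⟨χ, hχ⟩⟩ := by
      rintro _ hψ rfl h; rfl
    exact key _ _ _ _

/-- Lifts along a base change. -/
theorem homFiber_baseChange {Ω : Type u} [MulAction G Ω] [Nonempty Δ] {Y X X' : TransSet G Ω}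
    {f : Y →[G] X} {h : X' →[G] X} {n : ℕ} {Y' : Fin n → TransSet G Ω} {f' : ∀ i, Y' i →[G] X'}
    {h' : ∀ i, Y' i →[G] Y} (hbc : IsOrbitBaseChange f h Y' f' h') (α : Δ →[G] X') :
    Nonempty ((Σ i, HomFiber (f' i) α) ≃ HomFiber f (h.comp α)) := by
  obtain ⟨j⟩ := ‹Nonempty Δ›
  refine ⟨Equiv.ofBijective (fun s => ⟨(h' s.1).comp s.2.1, ?_⟩) ⟨?_, ?_⟩⟩
  · obtain ⟨i, ψ, rfl⟩ := s
    ext x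
    exact hbc.1 i (ψ x)
  · rintro ⟨i, ψ, hψ⟩ ⟨k, χ, hχ⟩ hs
    have hs := DFunLike.congr_fun (congrArg Subtype.val hs) j
    have hs : h' i (ψ j) = h' k (χ j) := hs
    have h1 := (comp_eq_iff (f' i) ψ α j).1 hψ
    have h2 := (comp_eq_iff (f' k) χ α j).1 hχ
    have hf : f (h' i (ψ j)) = h (α j) := by rw [hbc.1, h1]
    have := (hbc.2 _ _ hf).unique (y₁ := ⟨i, ψ j⟩) (y₂ := ⟨k, χ j⟩) ⟨rfl, h1⟩ ⟨hs.symm, h2⟩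
    obtain ⟨rfl, h3⟩ := Sigma.mk.inj_iff.1 this
    congr 2
    exact equivariant_ext (G := G) j (eq_of_heq h3)
  · rintro ⟨ψ, hψ⟩
    have hj : f (ψ j) = h (α j) := (comp_eq_iff f ψ _ j).1 hψ
    obtain ⟨⟨i, y⟩, ⟨h1, h2⟩, hu⟩ := hbc.2 _ _ hj
    have h1 : h' i y = ψ j := h1
    have h2 : f' i y = α j := h2
    obtain ⟨χ, hχ⟩ := exists_equivariant_map (G := G) j y (fun g hg => by
      rw [MulAction.mem_stabilizer_iff] at hg ⊢
      have h3 := hu ⟨i, g • y⟩ ⟨by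
        change h' i (g • y) = _
        rw [map_smul, h1, ← map_smul, hg], by
        change f' i (g • y) = _
        rw [map_smul, h2, ← map_smul, hg]⟩
      exact eq_of_heq (Sigma.mk.inj_iff.1 h3).2)
    refine ⟨⟨i, χ, (comp_eq_iff _ _ _ j).2 (by rw [hχ, h2])⟩, Subtype.ext ?_⟩
    refine equivariant_ext j ?_
    change h' i (χ j) = ψ j
    rw [hχ, h1]

end Fibers

/-! ### Lifts along one-vector extensions as vectors of a subspace -/

section OrthogonalFibers

variable {F : Type u} [Field F]

theorem mem_span_of_fixed (h2 : (2 : F) ≠ 0) {D : Finset (VInf F)} {a : VInf F}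
    (h : ∀ g ∈ fixingSubgroup (OInf F) (D : Set (VInf F)), g • a = a) :
    a ∈ Submodule.span F (D : Set (VInf F)) :=
  mem_span_of_fixingSubgroup_le h2 (A := {a}) (fun g hg => mem_fixingSubgroup_finset.2 (by
    simpa using h g hg)) a (Finset.mem_singleton_self a)

theorem mem_stabilizer_smul_iff {X : Type*} [MulAction (OInf F) X] {x : X} {A : Finset (VInf F)}
    (h : MulAction.stabilizer (OInf F) x = fixingSubgroup (OInf F) (A : Set (VInf F)))
    (g k : OInf F) :
    k ∈ MulAction.stabilizer (OInf F) (g • x) ↔ ∀ a ∈ A, k • (g • a) = g • a := by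
  rw [stabilizer_smul_eq_fixing h]
  simp [mem_fixingSubgroup_iff]

/-- Lifts along a one-step extension correspond to the vectors of a relative orbit in the subspace
spanned by `D`. -/
theorem homFiber_step (h2 : (2 : F) ≠ 0) {Δ : Type u} [MulAction (OInf F) Δ]
    [MulAction.IsPretransitive (OInf F) Δ] {j : Δ} {D : Finset (VInf F)}
    (hj : MulAction.stabilizer (OInf F) j = fixingSubgroup (OInf F) (D : Set (VInf F)))
    {Y X : TransSet (OInf F) (VInf F)} (f : Y →[OInf F] X) {y : Y} {A : Finset (VInf F)}
    {C : Finset (VInf F)} {v : VInf F} (hC : ∀ a, a ∈ C ↔ a = v ∨ a ∈ A)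
    (hy : MulAction.stabilizer (OInf F) y = fixingSubgroup (OInf F) (C : Set (VInf F)))
    (hx : MulAction.stabilizer (OInf F) (f y) = fixingSubgroup (OInf F) (A : Set (VInf F)))
    (α : Δ →[OInf F] X) (hα : α j = f y) :
    (∀ a ∈ A, a ∈ Submodule.span F (D : Set (VInf F))) ∧
    Nonempty (HomFiber f α ≃
      ↥(relOrbit A v ∩ (Submodule.span F (D : Set (VInf F)) : Set (VInf F)))) := by
  have hAD : ∀ a ∈ A, a ∈ Submodule.span F (D : Set (VInf F)) :=
    mem_span_of_fixingSubgroup_le h2 (by rw [← hj, ← hx, ← hα]; exact stabilizer_le_of_map α j)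
  refine ⟨hAD, ⟨(homFiberEquiv f α j).trans (Equiv.symm ?_)⟩⟩
  have hsame : ∀ g g' : OInf F, (∀ a ∈ A, g • a = a) → (∀ a ∈ A, g' • a = a) →
      (g • v = g' • v ↔ g • y = g' • y) := by
    intro g g' hg hg'
    rw [← inv_smul_eq_iff (g := g'), ← mul_smul, ← inv_smul_eq_iff (g := g') (a := g • y),
      ← mul_smul, ← MulAction.mem_stabilizer_iff (a := y), hy, mem_fixingSubgroup_finset]
    simp only [hC, forall_eq_or_imp]
    exact ⟨fun h => ⟨h, fun a ha => by rw [mul_smul, hg a ha, inv_smul_eq_iff, hg' a ha]⟩,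
      fun h => h.1⟩
  have hex : ∀ w : ↥(relOrbit A v ∩ (Submodule.span F (D : Set (VInf F)) : Set (VInf F))),
      ∃ g : OInf F, (∀ a ∈ A, g • a = a) ∧ g • v = w := fun w => mem_relOrbit.1 w.2.1
  choose g hgA hgv using hex
  refine Equiv.ofBijective (fun w => ⟨g w • y, ?_, ?_⟩) ⟨fun w w' h => ?_, ?_⟩
  · rw [map_smul, hα, ← MulAction.mem_stabilizer_iff, hx, mem_fixingSubgroup_finset]
    exact hgA w
  · intro k hk
    rw [hj, mem_fixingSubgroup_finset] at hk
    rw [mem_stabilizer_smul_iff hy]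
    intro b hb
    refine OInf.smul_eq_of_span (s := (D : Set (VInf F))) hk _ ?_
    rcases (hC b).1 hb with rfl | hb
    · rw [hgv]; exact w.2.2
    · rw [hgA w b hb]; exact hAD b hb
  · apply Subtype.ext
    rw [← hgv w, ← hgv w']
    exact (hsame _ _ (hgA w) (hgA w')).2 (congrArg Subtype.val h)
  · rintro ⟨y', hy', hs⟩
    obtain ⟨k, rfl⟩ := MulAction.exists_smul_eq (OInf F) y y'
    have hkA : ∀ a ∈ A, k • a = a := by
      rw [map_smul, hα, ← MulAction.mem_stabilizer_iff, hx, mem_fixingSubgroup_finset] at hy'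
      exact hy'
    -- A lift exists only if the stabilizer of j fixes k • v, which forces k • v into the span of D.
    have hkv : k • v ∈ Submodule.span F (D : Set (VInf F)) := mem_span_of_fixed h2 fun g hg =>
      (mem_stabilizer_smul_iff hy k g).1 (hs (hj ▸ hg)) v ((hC v).2 (Or.inl rfl))
    let w : ↥(relOrbit A v ∩ (Submodule.span F (D : Set (VInf F)) : Set (VInf F))) :=
      ⟨k • v, mem_relOrbit.2 ⟨k, hkA, rfl⟩, hkv⟩
    exact ⟨w, Subtype.ext ((hsame _ _ (hgA w) hkA).1 (hgv w))⟩

end OrthogonalFibers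

/-! ### Counting vectors of given norm in finite quadratic spaces -/

section Counting

variable {F : Type u} [Field F] [Fintype F] {R : Type v} [CommRing R] {qi : R}

/-- The coefficients `1, …, 1, e` of a diagonal form. -/
def diagCoeff (n : ℕ) (e : F) (i : Fin n) : F := if (i : ℕ) + 1 = n then e else 1

open Classical in
/-- The number of solutions of `∑ d i * x i ^ 2 = c`. -/
noncomputable def diagCount (R : Type v) [CommRing R] {n : ℕ} (d : Fin n → F) (c : F) : R :=
  ∑ x : Fin n → F, if ∑ i, d i * (x i * x i) = c then 1 else 0

/-- The zero space has level function δ₀ = 1/q + (1/q)(qδ₀ − 1). -/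
theorem diagCount_zero (hq : (Fintype.card F : R) * qi = 1) (d : Fin 0 → F) (c : F) :
    diagCount R d c = QParam.val qi ⟨1, 0, qi⟩ c := by
  simp only [diagCount, QParam.val, Finset.univ_eq_empty, Finset.sum_empty, Finset.univ_unique,
    Finset.sum_singleton, Fin.sum_univ_zero]
  by_cases hc : c = 0
  · simp only [hc, if_true]; linear_combination -hq
  · simp [hc, Ne.symm hc]

theorem diagCount_succ {n : ℕ} (d : Fin (n + 1) → F) (c : F) :
    diagCount R d c = ∑ y : F, diagCount R (fun i => d i.succ) (c - d 0 * (y * y)) := by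
  classical
  simp only [diagCount]
  rw [← Fintype.sum_prod_type', ← (Fin.consEquiv fun _ => F).sum_comp]
  refine Finset.sum_congr rfl fun x _ => ?_
  have : ∑ i, d i * ((Fin.consEquiv fun _ => F) x i * (Fin.consEquiv fun _ => F) x i) = c ↔
      ∑ i : Fin n, d i.succ * (x.2 i * x.2 i) = c - d 0 * (x.1 * x.1) := by
    rw [Fin.sum_univ_succ, eq_sub_iff_add_eq']
    simp [Fin.consEquiv]
  simp only [this]

theorem diagCount_diagCoeff (h2 : (2 : F) ≠ 0) (hq : (Fintype.card F : R) * qi = 1) {e : F}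
    (he : e ≠ 0) (k : ℕ) (c : F) :
    diagCount R (diagCoeff (k + 1) e) c =
      QParam.val qi ((QParam.back (1 : F))^[k] (QParam.back e ⟨1, 0, qi⟩)) c := by
  induction k generalizing c with
  | zero =>
    rw [diagCount_succ]
    simp only [diagCount_zero hq]
    have e1 : diagCoeff (0 + 1) e 0 = e := by simp [diagCoeff]
    rw [e1, QParam.sum_val_sub_sq h2 _ he]
    rfl
  | succ k ih =>
    rw [diagCount_succ]
    have e1 : (fun i : Fin (k + 1) => diagCoeff (k + 1 + 1) e i.succ) = diagCoeff (k + 1) e := by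
      ext i; simp [diagCoeff]
    have e2 : diagCoeff (k + 1 + 1) e 0 = 1 := by simp [diagCoeff]
    rw [e1, e2]
    simp only [ih]
    rw [QParam.sum_val_sub_sq h2 _ one_ne_zero,
      ← Function.iterate_succ_apply' (QParam.back (1 : F))]

/-- Since `back` exchanges u and w, its steps are taken in pairs; a pair multiplies both by qχ(−1).
-/
theorem QParam.back_one_iterate (j : ℕ) (p : QParam R) :
    (QParam.back (1 : F))^[2 * j] p = ⟨(Fintype.card F : R) ^ (2 * j) * p.T,
      (Fintype.card F * chi R (-1 : F)) ^ j * p.u, (Fintype.card F * chi R (-1 : F)) ^ j * p.w⟩ := by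
  induction j with
  | zero => simp
  | succ j ih =>
    rw [Nat.mul_succ, Function.iterate_succ_apply', Function.iterate_succ_apply', ih]
    ext <;> simp only [QParam.back, chi_one] <;> ring

theorem chi_neg_one_pow (r : ℕ) : chi R ((-1 : F) ^ r) = chi R (-1 : F) ^ r := by
  induction r with
  | zero => simp [chi_one]
  | succ r ih => rw [pow_succ, chi_mul, ih, pow_succ]

theorem chi_neg_one_pow_mul_self (r : ℕ) : chi R (-1 : F) ^ r * chi R (-1 : F) ^ r = 1 := by
  rw [← mul_pow, chi_mul_self (neg_ne_zero.2 one_ne_zero), one_pow]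

variable (F) in
/-- The parameters of the split quadratic space of dimension `2r + s` in terms of `t = q ^ r`. -/
def cParam (qi : R) (s : ℕ) (t : R) : QParam R :=
  if s = 0 then ⟨t ^ 2, 0, t * qi⟩ else ⟨Fintype.card F * t ^ 2, t, 0⟩

/-- The sign (−1)^r in the last coefficient contributes a χ(−1)^r that cancels the one from
iterating `back`. This is why the split forms have parameters polynomial in q^r. -/
theorem diagCount_eq (h2 : (2 : F) ≠ 0) (hq : (Fintype.card F : R) * qi = 1) {s : ℕ} (hs : s ≤ 1)
    (r : ℕ) (c : F) :
    diagCount R (diagCoeff (2 * r + s) ((-1 : F) ^ ((2 * r + s) / 2))) c =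
      (cParam F qi s ((Fintype.card F : R) ^ r)).val qi c := by
  have hr : (2 * r + s) / 2 = r := by omega
  rw [hr]
  have he : (-1 : F) ^ r ≠ 0 := pow_ne_zero _ (neg_ne_zero.2 one_ne_zero)
  have h1 := chi_neg_one_pow_mul_self (F := F) (R := R) r
  rcases Nat.le_one_iff_eq_zero_or_eq_one.1 hs with rfl | rfl
  · rcases r with _ | r
    · rw [show (2 * 0 + 0) = 0 from rfl, diagCount_zero hq]
      simp [cParam]
    · rw [show 2 * (r + 1) + 0 = (2 * r + 1) + 1 by ring, diagCount_diagCoeff h2 hq he,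
        Function.iterate_succ_apply, QParam.back_one_iterate]
      congr 1
      have h3 : chi R (-1 : F) ^ r * chi R (-1 : F) * (chi R (-1 : F) ^ r * chi R (-1 : F)) = 1 := by
        simpa only [pow_succ] using h1
      simp only [cParam, if_true, QParam.back, chi_one, chi_neg_one_pow]
      ext
      · ring
      · simp
      · simp only
        linear_combination ((Fintype.card F : R) ^ r * (Fintype.card F * qi)) * h3
  · rw [diagCount_diagCoeff h2 hq he, QParam.back_one_iterate]
    congr 1
    simp only [cParam, one_ne_zero, if_false, QParam.back, chi_neg_one_pow]
    ext
    · ring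
    · simp only
      linear_combination ((Fintype.card F : R) ^ r) * (Fintype.card F * qi) * h1 +
        (Fintype.card F : R) ^ r * hq
    · simp

omit [Field F] in
theorem QParam.map_cParam {S : Type w} [CommRing S] (f : R →+* S) (s : ℕ) (t : R) :
    (cParam F qi s t).map f = cParam F (f qi) s (f t) := by
  unfold cParam
  split_ifs <;> simp [QParam.map]

theorem StepData.map_eval {S : Type w} [CommRing S] (f : R →+* S) (d : StepData F)
    (p : QParam R) : f (d.eval qi p) = d.eval (f qi) (p.map f) := by
  cases d with
  | perp l c N =>
    simp only [StepData.eval, map_sub, map_natCast, QParam.map_val, ← QParam.map_par]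
    rfl
  | rad k => simp [StepData.eval, QParam.map]

end Counting

/-! ### Counting in a split subspace as a valuation -/

section SubspaceVal

variable {F : Type u} [Field F] [Fintype F]

omit [Fintype F] in
theorem stdForm_one_apply (m : ℕ) (x y : Fin m ⊕ Fin 0 → F) :
    stdForm m 1 0 x y = ∑ i : Fin m, diagCoeff m ((-1 : F) ^ (m / 2)) i *
      x (Sum.inl i) * y (Sum.inl i) := by
  rw [stdForm_apply, Fintype.sum_sum_type]
  simp [diagCoeff]

omit [Fintype F] in
theorem diagCoeff_ne_zero (m : ℕ) {e : F} (he : e ≠ 0) (i : Fin m) : diagCoeff m e i ≠ 0 := by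
  unfold diagCoeff
  split_ifs
  · exact he
  · exact one_ne_zero

/-- The image of the split space under an embedding. -/
noncomputable abbrev XSet.range {m : ℕ} (j : XSet (F := F) m 1 0) : Submodule F (VInf F) :=
  LinearMap.range j.1

theorem XSet.range_finite {m : ℕ} (j : XSet (F := F) m 1 0) :
    (j.range : Set (VInf F)).Finite := by
  rw [LinearMap.coe_range]; exact Set.finite_range _

omit [Fintype F] in
-- The diagonal coefficients are nonzero, so a functional killing l but not b is represented inside
-- the split space: its coordinates are the values of φ on the basis divided by the coefficients.
theorem XSet.rep {m : ℕ} (j : XSet (F := F) m 1 0) (l : List (VInf F)) (b : VInf F)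
    (hl : ∀ a ∈ l, a ∈ j.range) (hbr : b ∈ j.range) (hb : b ∉ Submodule.span F {x | x ∈ l}) :
    ∃ v ∈ j.range, (∀ a ∈ l, formInf F v a = 0) ∧ formInf F v b = 1 := by
  classical
  obtain ⟨φ, hφ, hA⟩ := Submodule.exists_le_ker_of_notMem hb
  have he : (-1 : F) ^ (m / 2) ≠ 0 := pow_ne_zero _ (neg_ne_zero.2 one_ne_zero)
  let x : Fin m ⊕ Fin 0 → F := Sum.elim (fun i => (diagCoeff m ((-1 : F) ^ (m / 2)) i)⁻¹ *
    φ (j.1 (Pi.single (Sum.inl i) 1))) (fun _ => 0)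
  have hx : ∀ y, stdForm m 1 0 x y = φ (j.1 y) := by
    intro y
    have hy : y = ∑ i : Fin m, y (Sum.inl i) • Pi.single (Sum.inl i) (1 : F) := by
      ext i
      rcases i with i | i
      · simp [Finset.sum_apply, Pi.single_apply]
      · exact i.elim0
    conv_rhs => rw [hy, map_sum, map_sum]
    rw [stdForm_one_apply]
    refine Finset.sum_congr rfl fun i _ => ?_
    simp only [x, Sum.elim_inl, map_smul, smul_eq_mul,
      mul_inv_cancel_left₀ (diagCoeff_ne_zero m he i)]
    ring
  have hxj : ∀ a ∈ j.range, formInf F (j.1 x) a = φ a := by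
    rintro _ ⟨y, rfl⟩
    rw [j.2.2, hx]
  refine ⟨(φ b)⁻¹ • j.1 x, Submodule.smul_mem _ _ ⟨x, rfl⟩, fun a ha => ?_, ?_⟩
  · simp [hxj a (hl a ha), LinearMap.mem_ker.1 (hA (Submodule.subset_span ha))]
  · simp [hxj b hbr, hφ]

/-- The valuation that counts vectors in the image of the split space. -/
noncomputable def XSet.toQVal {m : ℕ} (j : XSet (F := F) m 1 0) (R : Type v) [CommRing R] :
    QVal (formInf F) j.range R where
  dom _ := True
  ν S := ((S ∩ j.range).ncard : R)
  symm := formInf_comm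
  rep := j.rep
  dom_inter _ _ := trivial
  dom_compl _ := trivial
  dom_form _ _ _ := trivial
  dom_norm _ := trivial
  dom_point _ _ := trivial
  add := by
    intro S S' _ _ h
    rw [Set.union_inter_distrib_right, Set.ncard_union_eq
      (h.mono Set.inter_subset_left Set.inter_subset_left)
      (j.range_finite.subset Set.inter_subset_right) (j.range_finite.subset Set.inter_subset_right),
      Nat.cast_add]
  transl := by
    intro S x _ hx
    congr 1
    refine Set.ncard_congr (fun v _ => v + x) ?_ ?_ ?_
    · rintro v ⟨hv, hvr⟩
      exact ⟨hv, j.range.add_mem hvr hx⟩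
    · intro v w _ _ h
      exact add_right_cancel h
    · rintro v ⟨hv, hvr⟩
      exact ⟨v + -x, ⟨by simpa using hv, j.range.add_mem hvr (j.range.neg_mem hx)⟩, by simp⟩
  point := by
    intro v hv
    rw [Set.inter_eq_left.2 (Set.singleton_subset_iff.2 hv), Set.ncard_singleton, Nat.cast_one]

theorem XSet.toQVal_norm_eq_diagCount {m : ℕ} (j : XSet (F := F) m 1 0) (R : Type v)
    [CommRing R] (c : F) : (j.toQVal R).ν {v | formInf F v v = c} =
      diagCount R (diagCoeff m ((-1 : F) ^ (m / 2))) c := by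
  classical
  have e1 : {v | formInf F v v = c} ∩ (j.range : Set (VInf F)) =
      j.1 '' {x | stdForm m 1 0 x x = c} := by
    ext v
    constructor
    · rintro ⟨hv, ⟨x, rfl⟩⟩
      exact ⟨x, by rw [← hv]; exact (j.2.2 x x).symm, rfl⟩
    · rintro ⟨x, hx, rfl⟩
      exact ⟨(j.2.2 x x).trans hx, ⟨x, rfl⟩⟩
  change (({v | formInf F v v = c} ∩ (j.range : Set (VInf F))).ncard : R) = _
  rw [e1, Set.ncard_image_of_injective _ j.2.1, Set.ncard_eq_toFinset_card', Set.toFinset_ofPred,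
    ← Finset.sum_boole, diagCount]
  refine Fintype.sum_equiv (Equiv.arrowCongr (Equiv.sumEmpty _ _) (Equiv.refl F)) _ _ fun x => ?_
  have : stdForm m 1 0 x x = ∑ i, diagCoeff m ((-1 : F) ^ (m / 2)) i *
      ((Equiv.arrowCongr (Equiv.sumEmpty (Fin m) (Fin 0)) (Equiv.refl F)) x i *
        (Equiv.arrowCongr (Equiv.sumEmpty (Fin m) (Fin 0)) (Equiv.refl F)) x i) := by
    rw [stdForm_one_apply]
    exact Finset.sum_congr rfl fun i _ => mul_assoc _ _ _
  rw [this]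

theorem XSet.toQVal_norm (h2 : (2 : F) ≠ 0) {s : ℕ} (hs : s ≤ 1) (r : ℕ)
    (j : XSet (F := F) (2 * r + s) 1 0) {R : Type v} [CommRing R] {qi : R}
    (hq : (Fintype.card F : R) * qi = 1) (c : F) :
    (j.toQVal R).ν {v | formInf F v v = c} =
      (cParam F qi s ((Fintype.card F : R) ^ r)).val qi c := by
  rw [j.toQVal_norm_eq_diagCount, diagCount_eq h2 hq hs]

end SubspaceVal

/-! ### The counting homomorphisms -/

section CountPoly

variable {F : Type u} [Field F] [Fintype F]

omit [Field F] in
theorem exists_card_mul_eq_one : ∃ qi : Zq F, (Fintype.card F : Zq F) * qi = 1 :=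
  (InvNat.isUnit_natCast ℤ (Fintype.card F)).exists_right_inv

instance : IsDomain (Zq F) :=
  IsLocalization.isDomain_localization (powers_le_nonZeroDivisors_of_noZeroDivisors (by
    exact_mod_cast Fintype.card_ne_zero))

instance : CharZero (Zq F) :=
  charZero_of_injective_algebraMap (R := ℤ) (IsLocalization.injective (Zq F)
    (powers_le_nonZeroDivisors_of_noZeroDivisors (x := ((Fintype.card F : ℕ) : ℤ)) (by
      exact_mod_cast Fintype.card_ne_zero)))

theorem card_pow_injective : Function.Injective fun r : ℕ => (Fintype.card F : Zq F) ^ r := by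
  intro r r' h
  have h : (Fintype.card F : Zq F) ^ r = (Fintype.card F : Zq F) ^ r' := h
  exact Nat.pow_right_injective (Fintype.one_lt_card (α := F)) (by exact_mod_cast h)

theorem eventually_eval_ne_zero {P : (Zq F)[X]} (hP : P ≠ 0) :
    ∀ᶠ r : ℕ in cofinite, P.eval ((Fintype.card F : Zq F) ^ r) ≠ 0 := by
  classical
  have h : {x | P.eval x = 0}.Finite := by
    refine (P.roots.toFinset.finite_toSet).subset fun x hx => ?_
    simpa [hP] using hx
  have := h.preimage (card_pow_injective (F := F)).injOn
  rw [eventually_cofinite]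
  refine this.subset fun r hr => ?_
  simpa using hr

theorem eq_of_eventually_eval_eq {P Q : (Zq F)[X]}
    (h : ∀ᶠ r : ℕ in cofinite,
      P.eval ((Fintype.card F : Zq F) ^ r) = Q.eval ((Fintype.card F : Zq F) ^ r)) : P = Q := by
  by_contra hne
  obtain ⟨r, h1, h2⟩ := (h.and (eventually_eval_ne_zero (sub_ne_zero.2 hne))).exists
  exact h2 (by rw [eval_sub, h1, sub_self])

/-- T is a constant times t², whereas u and w never acquire a t² term, so only T contributes. Over
ℤ[1/q] the coefficient is nonzero, which keeps the counting polynomials from vanishing. -/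
theorem coeff_two_eval {R : Type v} [CommRing R] {qi : R} (s : ℕ) (d : StepData F) :
    ∃ n, (d.eval (C qi) (cParam F (C qi) s X)).coeff 2 =
      (if s = 0 then 1 else (Fintype.card F : R)) * qi ^ n := by
  classical
  have hT : (cParam F (C qi) s X : QParam R[X]).T =
      C (if s = 0 then 1 else (Fintype.card F : R)) * X ^ 2 := by
    unfold cParam; split_ifs <;> simp
  have hchi : ∀ a : F, chi R[X] a = C (chi R a) := fun a => (map_chi C a).symm
  have huw : ∀ l : List F, ((cParam F (C qi) s X : QParam R[X]).par (C qi) l).u.coeff 2 = 0 ∧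
      ((cParam F (C qi) s X : QParam R[X]).par (C qi) l).w.coeff 2 = 0 := by
    intro l
    induction l with
    | nil =>
      change (cParam F (C qi) s X : QParam R[X]).u.coeff 2 = 0 ∧
        (cParam F (C qi) s X : QParam R[X]).w.coeff 2 = 0
      unfold cParam; split_ifs <;> simp [coeff_X]
    | cons a l ih =>
      change (QParam.step (C qi) a ((cParam F (C qi) s X : QParam R[X]).par (C qi) l)).u.coeff 2 =
        0 ∧ (QParam.step (C qi) a ((cParam F (C qi) s X : QParam R[X]).par (C qi) l)).w.coeff 2 = 0
      unfold QParam.step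
      split_ifs
      · exact ih
      · simp [hchi, coeff_C_mul, coeff_mul_C, ih.1, ih.2]
  cases d with
  | perp l c N =>
    refine ⟨l.length + 1, ?_⟩
    obtain ⟨hu, hw⟩ := huw l
    have e1 : ((if c = 0 then (Fintype.card F : R[X]) else 0) - 1) =
        C ((if c = 0 then (Fintype.card F : R) else 0) - 1) := by split_ifs <;> simp
    have e2 : (N : R[X]).coeff 2 = 0 := by
      rw [← C_eq_natCast, coeff_C_of_ne_zero two_ne_zero]
    simp only [StepData.eval, QParam.val, QParam.par_T, hT, hchi]
    rw [coeff_sub, coeff_add, coeff_add, coeff_mul_C, e2, ← C_pow, coeff_mul_C, coeff_mul_C,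
      coeff_C_mul, hu]
    have e3 : (((cParam F (C qi) s X : QParam R[X]).par (C qi) l).w *
        ((if c = 0 then (Fintype.card F : R[X]) else 0) - 1)).coeff 2 = 0 := by
      rw [e1, coeff_mul_C, hw, zero_mul]
    convert_to _ + (((cParam F (C qi) s X : QParam R[X]).par (C qi) l).w *
        ((if c = 0 then (Fintype.card F : R[X]) else 0) - 1)).coeff 2 - 0 = _
    rw [e3]
    simp
    ring_nf
  | rad k =>
    refine ⟨k + 1, ?_⟩
    simp only [StepData.eval, hT]
    rw [← C_pow, coeff_mul_C, coeff_C_mul]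
    simp

/-- The polynomial `P` counts the lifts along `f`. -/
def HasCount (s : ℕ) (f : TransMap (OInf F) (VInf F)) (P : (Zq F)[X]) : Prop :=
  ∀ (r : ℕ) (α : XSet (F := F) (2 * r + s) 1 0 →[OInf F] f.tgt),
    Finite (HomFiber f.map α) ∧
      (Nat.card (HomFiber f.map α) : Zq F) = P.eval ((Fintype.card F : Zq F) ^ r)

omit [Fintype F] in
theorem HasData.smul' {g : OInf F} {A A' : Finset (VInf F)} {v : VInf F} {d : StepData F}
    (h : HasData A v d) (hA : ∀ x, x ∈ A' ↔ ∃ a ∈ A, g • a = x) : HasData A' (g • v) d := by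
  classical
  convert h.smul g
  ext x
  rw [hA, Finset.mem_image]

theorem XSet.span_range {m : ℕ} (j : XSet (F := F) m 1 0) :
    Submodule.span F (((Set.finite_range j.1).toFinset : Finset (VInf F)) : Set (VInf F)) =
      j.range := by
  rw [Set.Finite.coe_toFinset, ← LinearMap.coe_range, Submodule.span_eq]

/-- The lifts are the vectors of a relative orbit in `j.range`. Counting them is a valuation with
parameters `cParam`, so `QVal.ν_relOrbit` gives their number as the value at q^r of one polynomial
that does not depend on r. -/
theorem exists_hasCount_step (h2 : (2 : F) ≠ 0) {s : ℕ} (hs : s ≤ 1)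
    {Y X : TransSet (OInf F) (VInf F)} (f : Y →[OInf F] X) {y : Y} {A C : Finset (VInf F)}
    {v : VInf F} (hC : ∀ a, a ∈ C ↔ a = v ∨ a ∈ A)
    (hy : MulAction.stabilizer (OInf F) y = fixingSubgroup (OInf F) (C : Set (VInf F)))
    (hx : MulAction.stabilizer (OInf F) (f y) = fixingSubgroup (OInf F) (A : Set (VInf F)))
    {qi : Zq F} (hq : (Fintype.card F : Zq F) * qi = 1)
    (hv : v ∉ Submodule.span F (A : Set (VInf F))) {d : StepData F} (hd : HasData A v d) :
    HasCount s ⟨Y, X, f⟩ (d.eval (Polynomial.C qi) (cParam F (Polynomial.C qi) s Polynomial.X)) := by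
  classical
  intro r α
  have hΔ := isTransSmooth_xSet (F := F) h2 (2 * r + s) 1 0
  have := hΔ.pretransitive
  obtain ⟨j⟩ := hΔ.nonempty
  obtain ⟨g, hg⟩ := MulAction.exists_smul_eq (OInf F) (f y) (α j)
  have hmem : ∀ (B : Finset (VInf F)) x, x ∈ B.image (g • ·) ↔ ∃ a ∈ B, g • a = x :=
    fun B x => Finset.mem_image
  have hst : ∀ {Z : Type u} [MulAction (OInf F) Z] {z : Z} {B : Finset (VInf F)},
      MulAction.stabilizer (OInf F) z = fixingSubgroup (OInf F) (B : Set (VInf F)) →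
      MulAction.stabilizer (OInf F) (g • z) =
        fixingSubgroup (OInf F) ((B.image (g • ·) : Finset (VInf F)) : Set (VInf F)) := by
    intro Z _ z B hB
    ext k
    rw [mem_stabilizer_smul_iff hB, mem_fixingSubgroup_finset, Finset.forall_mem_image]
  obtain ⟨hAD, ⟨e⟩⟩ := homFiber_step h2 (stabilizer_qEmb j) f (y := g • y)
    (A := A.image (g • ·)) (C := C.image (g • ·)) (v := g • v) (fun a => by
      simp only [hmem, hC]
      constructor
      · rintro ⟨b, rfl | hb, rfl⟩
        · exact Or.inl rfl
        · exact Or.inr ⟨b, hb, rfl⟩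
      · rintro (rfl | ⟨b, hb, rfl⟩)
        · exact ⟨v, Or.inl rfl, rfl⟩
        · exact ⟨b, Or.inr hb, rfl⟩) (hst hy) (by rw [map_smul]; exact hst hx) α
    (by rw [map_smul, hg])
  rw [XSet.span_range] at hAD e
  have hfin : (relOrbit (A.image (g • ·)) (g • v) ∩ (j.range : Set (VInf F))).Finite :=
    j.range_finite.subset Set.inter_subset_right
  have := hfin.to_subtype
  refine ⟨Finite.of_equiv _ e.symm, ?_⟩
  rw [Nat.card_congr e, Nat.card_coe_set_eq]
  have hv' : g • v ∉ Submodule.span F ((A.image (g • ·) : Finset (VInf F)) : Set (VInf F)) := by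
    intro h
    apply hv
    have e1 : ((A.image (g • ·) : Finset (VInf F)) : Set (VInf F)) =
        (g : VInf F ≃ₗ[F] VInf F).toLinearMap '' (A : Set (VInf F)) := by
      ext x; simp [OInf.smul_def]
    rw [e1, Submodule.span_image] at h
    obtain ⟨x, hx, hxv⟩ := h
    rwa [← (g : VInf F ≃ₗ[F] VInf F).injective hxv]
  have key := (j.toQVal (Zq F)).ν_relOrbit h2 hq (j.toQVal_norm h2 hs r hq) hAD hv'
    (hd.smul' (hmem A))
  refine Eq.trans key ?_
  rw [← coe_evalRingHom, StepData.map_eval, QParam.map_cParam]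
  simp

theorem hasCount_of_bijective (s : ℕ) {Y X : TransSet (OInf F) (VInf F)} (f : Y →[OInf F] X)
    (hf : Function.Bijective f) : HasCount s ⟨Y, X, f⟩ 1 := by
  intro r α
  obtain ⟨h⟩ := homFiber_of_bijective f hf α
  exact ⟨inferInstance, by simp⟩

theorem HasCount.comp {s : ℕ} {Z Y X : TransSet (OInf F) (VInf F)} {f : Y →[OInf F] X}
    {g : Z →[OInf F] Y} {P Q : (Zq F)[X]} (hf : HasCount s ⟨Y, X, f⟩ P)
    (hg : HasCount s ⟨Z, Y, g⟩ Q) : HasCount s ⟨Z, X, f.comp g⟩ (P * Q) := by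
  intro r α
  obtain ⟨h1, h3⟩ := hf r α
  have h4 : ∀ ψ : HomFiber f α, Finite (HomFiber g ψ.1) := fun ψ => (hg r ψ.1).1
  have e := homFiberComp f g α
  let _ := Fintype.ofFinite (HomFiber f α)
  refine ⟨Finite.of_equiv _ e.symm, ?_⟩
  change (Nat.card (HomFiber (f.comp g) α) : Zq F) = _
  rw [Nat.card_congr e, Nat.card_sigma, Nat.cast_sum,
    Finset.sum_congr rfl fun ψ _ => (hg r ψ.1).2]
  rw [Finset.sum_const, Finset.card_univ, nsmul_eq_mul, eval_mul]
  refine congrArg (· * _) (Eq.trans ?_ h3)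
  rw [Nat.card_eq_fintype_card (α := HomFiber f α)]

/-- Non-vanishing is carried through the induction, which works as ℤ[1/q] is a domain; it yields the
non-emptiness of Hom sets, hence the uniqueness of the polynomial. -/
theorem exists_hasCount (h2 : (2 : F) ≠ 0) {s : ℕ} (hs : s ≤ 1)
    (f : TransMap (OInf F) (VInf F)) : ∃ P : (Zq F)[X], P ≠ 0 ∧ HasCount s f P := by
  classical
  induction f using TransMap.induction with
  | iso f hf => exact ⟨1, one_ne_zero, hasCount_of_bijective s f hf⟩
  | comp f g hf hg =>
    obtain ⟨P, hP, h⟩ := hf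
    obtain ⟨Q, hQ, h'⟩ := hg
    exact ⟨P * Q, mul_ne_zero hP hQ, h.comp h'⟩
  | step f y A v hy hx =>
    by_cases hv : v ∈ Submodule.span F (A : Set (VInf F))
    · refine ⟨1, one_ne_zero, hasCount_of_bijective s f (bijective_of_stabilizer f y ?_)⟩
      rw [hx, hy]
      intro g hg
      have := OInf.smul_eq_of_span (mem_fixingSubgroup_finset.1 hg) v hv
      rw [mem_fixingSubgroup_finset] at hg ⊢
      intro a ha
      rcases (by simpa using ha : a = v ∨ a ∈ A) with rfl | ha
      · exact this
      · exact hg a ha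
    · obtain ⟨d, hd⟩ := exists_hasData h2 A v
      obtain ⟨qi, hq⟩ := exists_card_mul_eq_one (F := F)
      refine ⟨_, fun h => ?_, exists_hasCount_step h2 hs f (C := _) ?_ hy hx hq hv hd⟩
      swap
      · intro a; simp
      obtain ⟨n, hn⟩ := coeff_two_eval (qi := qi) s d
      rw [h, coeff_zero] at hn
      have hqi : qi ≠ 0 := by rintro rfl; simp at hq
      refine mul_ne_zero ?_ (pow_ne_zero n hqi) hn.symm
      split_ifs
      · exact one_ne_zero
      · exact Nat.cast_ne_zero.2 Fintype.card_ne_zero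

/-- Hom(Δ_r, X) is the fibre for X → pt, and the nonzero polynomial counting it vanishes at only
finitely many q^r. -/
theorem eventually_nonempty_hom (h2 : (2 : F) ≠ 0) {s : ℕ} (hs : s ≤ 1)
    (X : TransSet (OInf F) (VInf F)) : ∀ᶠ r : ℕ in cofinite,
      Nonempty (XSet (F := F) (2 * r + s) 1 0 →[OInf F] X) := by
  obtain ⟨P, hP, h⟩ := exists_hasCount h2 hs ⟨X, _, X.toPt⟩
  refine (eventually_eval_ne_zero hP).mono fun r hr => ?_
  let α : XSet (F := F) (2 * r + s) 1 0 →[OInf F] TransSet.pt (OInf F) (VInf F) :=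
    ⟨fun _ => PUnit.unit, fun _ _ => rfl⟩
  by_contra hne
  rw [not_nonempty_iff] at hne
  apply hr
  rw [← (h r α).2]
  simp

theorem HasCount.unique (h2 : (2 : F) ≠ 0) {s : ℕ} (hs : s ≤ 1) {f : TransMap (OInf F) (VInf F)}
    {P Q : (Zq F)[X]} (hP : HasCount s f P) (hQ : HasCount s f Q) : P = Q :=
  eq_of_eventually_eval_eq ((eventually_nonempty_hom h2 hs f.tgt).mono fun r ⟨α⟩ => by
    rw [← (hP r α).2, ← (hQ r α).2])

/-- The polynomial that counts the lifts along `f`. -/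
noncomputable def countPoly (h2 : (2 : F) ≠ 0) {s : ℕ} (hs : s ≤ 1)
    (f : TransMap (OInf F) (VInf F)) : (Zq F)[X] := (exists_hasCount h2 hs f).choose

theorem hasCount_countPoly (h2 : (2 : F) ≠ 0) {s : ℕ} (hs : s ≤ 1)
    (f : TransMap (OInf F) (VInf F)) : HasCount s f (countPoly h2 hs f) :=
  (exists_hasCount h2 hs f).choose_spec.2

/-- The axioms reflect bijections between sets of lifts for each r, and polynomials that agree at
almost all q^r are equal. -/
theorem isMeasure_countPoly (h2 : (2 : F) ≠ 0) {s : ℕ} (hs : s ≤ 1) :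
    IsMeasure (countPoly (F := F) h2 hs) where
  iso f hf := (hasCount_countPoly h2 hs _).unique h2 hs (hasCount_of_bijective s f hf)
  comp f g := (hasCount_countPoly h2 hs _).unique h2 hs
    ((hasCount_countPoly h2 hs _).comp (hasCount_countPoly h2 hs _))
  baseChange := by
    intro Y X X' f h n Y' f' h' hbc
    refine eq_of_eventually_eval_eq ((eventually_nonempty_hom h2 hs X').mono fun r ⟨α⟩ => ?_)
    have hΔ := isTransSmooth_xSet (F := F) h2 (2 * r + s) 1 0
    have := hΔ.pretransitive
    have := hΔ.nonempty
    obtain ⟨e⟩ := homFiber_baseChange hbc α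
    have h1 := fun i => hasCount_countPoly h2 hs ⟨Y' i, X', f' i⟩ r α
    have h3 : ∀ i, Finite (HomFiber (f' i) α) := fun i => (h1 i).1
    rw [← (hasCount_countPoly h2 hs ⟨Y, X, f⟩ r (h.comp α)).2, ← Nat.card_congr e, Nat.card_sigma,
      Nat.cast_sum, eval_finsetSum]
    exact Finset.sum_congr rfl fun i _ => (h1 i).2

end CountPoly

/-! ### The universal property of the measure ring -/

section ThetaLift

variable {G : Type u} [Group G] {Ω : Type u} [MulAction G Ω]

theorem isMeasure_cls : IsMeasure (Theta.cls (G := G) (Ω := Ω)) where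
  iso f hf := by
    have := Ideal.Quotient.eq.2 (Ideal.subset_span (ThetaRel.iso (Ω := Ω) f hf))
    rw [map_one] at this
    exact this
  comp f g := by
    have := Ideal.Quotient.eq.2 (Ideal.subset_span (ThetaRel.comp (Ω := Ω) f g))
    rw [map_mul] at this
    exact this
  baseChange := by
    intro Y X X' f h n Y' f' h' hbc
    have := Ideal.Quotient.eq.2 (Ideal.subset_span (ThetaRel.baseChange (Ω := Ω) f h Y' f' h' hbc))
    rw [map_sum] at this
    exact this

theorem IsMeasure.map {k : Type v} [CommRing k] {k' : Type w} [CommRing k']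
    {μ : TransMap G Ω → k} (hμ : IsMeasure μ) (φ : k →+* k') : IsMeasure fun f => φ (μ f) where
  iso f hf := by rw [hμ.iso f hf, map_one]
  comp f g := by rw [hμ.comp, map_mul]
  baseChange := by
    intro Y X X' f h n Y' f' h' hbc
    rw [hμ.baseChange f h Y' f' h' hbc, map_sum]

/-- The universal property of `Θ(G, Ω)`. -/
noncomputable def IsMeasure.lift {k : Type v} [CommRing k] {μ : TransMap G Ω → k}
    (hμ : IsMeasure μ) : Theta G Ω →+* k :=
  Ideal.Quotient.lift _ (MvPolynomial.eval₂Hom (Int.castRingHom k) μ) (by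
    intro p hp
    have : Ideal.span {p | ThetaRel G Ω p} ≤
        RingHom.ker (MvPolynomial.eval₂Hom (Int.castRingHom k) μ) := by
      rw [Ideal.span_le]
      rintro _ (⟨f, hf⟩ | ⟨f, g⟩ | ⟨f, h, Y', f', h', hbc⟩)
      · simp [RingHom.mem_ker, hμ.iso f hf]
      · simp [RingHom.mem_ker, hμ.comp f g]
      · simp [RingHom.mem_ker, hμ.baseChange f h Y' f' h' hbc]
    exact this hp)

theorem IsMeasure.lift_cls {k : Type v} [CommRing k] {μ : TransMap G Ω → k}
    (hμ : IsMeasure μ) (f : TransMap G Ω) : hμ.lift (Theta.cls f) = μ f := by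
  rw [IsMeasure.lift, Theta.cls]
  exact (Ideal.Quotient.lift_mk _ _ _).trans (by simp)

theorem Theta.hom_ext {k : Type v} [CommRing k] {φ ψ : Theta G Ω →+* k}
    (h : ∀ f, φ (Theta.cls f) = ψ (Theta.cls f)) : φ = ψ := by
  apply Ideal.Quotient.ringHom_ext
  apply MvPolynomial.ringHom_ext
  · intro n; simp
  · exact h

end ThetaLift

/-! ### Counting homomorphisms and numbers of embeddings -/

section CountingHom

variable {F : Type u} [Field F] [Fintype F]

/-- Equivariant maps between sets of embeddings are given by composition with embeddings. -/
theorem card_hom_xSet (h2 : (2 : F) ≠ 0) {a b m : ℕ} {ε : Fˣ} :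
    Nat.card (XSet (F := F) m 1 0 →[OInf F] XSet (F := F) a ε b) = numEmb a ε b m (1 : Fˣ) 0 := by
  classical
  have hΔ := isTransSmooth_xSet (F := F) h2 m 1 0
  have := hΔ.pretransitive
  obtain ⟨j⟩ := hΔ.nonempty
  have hle : ∀ i : XSet (F := F) a ε b, MulAction.stabilizer (OInf F) j ≤
      MulAction.stabilizer (OInf F) i ↔ ∀ x, i.1 x ∈ j.range := by
    intro i
    rw [stabilizer_qEmb, stabilizer_qEmb]
    constructor
    · intro h x
      have := mem_span_of_fixingSubgroup_le h2 h (i.1 x) (by simp)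
      rwa [XSet.span_range] at this
    · intro h g hg
      rw [mem_fixingSubgroup_finset] at hg ⊢
      intro v hv
      obtain ⟨x, rfl⟩ : ∃ x, i.1 x = v := by simpa using hv
      refine OInf.smul_eq_of_span hg _ ?_
      rw [XSet.span_range]
      exact h x
  let T : QEmb (stdForm (F := F) a ε b) (stdForm m (1 : Fˣ) 0) → XSet (F := F) a ε b := fun e =>
    ⟨j.1 ∘ₗ e.1, j.2.1.comp e.2.1, fun x y => (j.2.2 _ _).trans (e.2.2 x y)⟩
  have hT : ∀ e, ∃ ψ : XSet (F := F) m 1 0 →[OInf F] XSet (F := F) a ε b, ψ j = T e := fun e =>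
    exists_equivariant_map j (T e) ((hle _).2 fun x => ⟨e.1 x, rfl⟩)
  choose ψ hψ using hT
  refine (Nat.card_congr (Equiv.ofBijective ψ ⟨fun e e' h => ?_, fun χ => ?_⟩)).symm
  · have h1 : T e = T e' := by rw [← hψ, ← hψ, h]
    refine Subtype.ext (LinearMap.ext fun x => j.2.1 ?_)
    exact LinearMap.congr_fun (congrArg Subtype.val h1) x
  · have h1 := (hle (χ j)).1 (stabilizer_le_of_map χ j)
    let e₀ := LinearEquiv.ofInjective j.1 j.2.1
    let e₁ : (Fin a ⊕ Fin b → F) →ₗ[F] (Fin m ⊕ Fin 0 → F) :=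
      e₀.symm.toLinearMap ∘ₗ (χ j).1.codRestrict j.range h1
    have he : ∀ x, j.1 (e₁ x) = (χ j).1 x := fun x => by
      have : e₀ (e₁ x) = ⟨(χ j).1 x, h1 x⟩ := e₀.apply_symm_apply _
      exact congrArg Subtype.val this
    refine ⟨⟨e₁, fun x y hxy => (χ j).2.1 ?_, fun x y => ?_⟩, equivariant_ext j ?_⟩
    · rw [← he, ← he, hxy]
    · rw [← j.2.2, he, he, (χ j).2.2]
    · exact (hψ _).trans (Subtype.ext (LinearMap.ext he))

theorem isCountingHom_lift (h2 : (2 : F) ≠ 0) {s : ℕ} (hs : s ≤ 1) :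
    IsCountingHom s (isMeasure_countPoly (F := F) h2 hs).lift := by
  refine ⟨fun f => ?_, fun a ε b => ⟨isTransSmooth_xSet h2 a ε b, fun r => ?_⟩⟩
  · refine (eventually_nonempty_hom h2 hs f.tgt).mono fun r ⟨α⟩ => ?_
    have h := hasCount_countPoly h2 hs f r
    refine ⟨Nat.card (HomFiber f.map α), ⟨⟨α⟩, fun β => ⟨(h β).1, ?_⟩⟩, ?_⟩
    · have := (h β).2.trans (h α).2.symm
      exact_mod_cast this
    · rw [IsMeasure.lift_cls, (h α).2]
  · rw [Theta.clsSet, IsMeasure.lift_cls]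
    -- Over a point a base map exists for every r, so the equality holds for all r and not only
    -- eventually.
    let α : XSet (F := F) (2 * r + s) 1 0 →[OInf F] TransSet.pt (OInf F) (VInf F) :=
      ⟨fun _ => PUnit.unit, fun _ _ => rfl⟩
    rw [← (hasCount_countPoly h2 hs _ r α).2, ← card_hom_xSet h2]
    congr 1
    exact Nat.card_congr (Equiv.subtypeUnivEquiv fun ψ => rfl)

end CountingHom

/-! ### The coordinate ring of two crossing lines -/

section Axes

variable (R : Type v) [CommRing R]

/-- The restriction of polynomials in two variables to the coordinate axes. -/
noncomputable def axisHom : MvPolynomial (Fin 2) R →+* R[X] × R[X] :=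
  (MvPolynomial.eval₂Hom C ![X, 0]).prod (MvPolynomial.eval₂Hom C ![0, X])

variable {R}

theorem axisHom_C (a : R) : axisHom R (MvPolynomial.C a) = (C a, C a) := by
  simp [axisHom]

theorem axisHom_X_zero : axisHom R (MvPolynomial.X 0) = (X, 0) := by
  simp [axisHom]

theorem axisHom_X_one : axisHom R (MvPolynomial.X 1) = (0, X) := by
  simp [axisHom]

theorem axisHom_eval_zero (y : MvPolynomial (Fin 2) R) :
    (axisHom R y).1.eval 0 = (axisHom R y).2.eval 0 := by
  have : ((evalRingHom 0).comp ((RingHom.fst _ _).comp (axisHom R))) =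
      (evalRingHom 0).comp ((RingHom.snd _ _).comp (axisHom R)) := by
    apply MvPolynomial.ringHom_ext
    · intro a; simp [axisHom_C]
    · intro i; fin_cases i <;> simp [axisHom_X_zero, axisHom_X_one]
  exact RingHom.congr_fun this y

/-- A polynomial in two variables with the given restrictions to the axes. -/
noncomputable def axisLift (p : R[X] × R[X]) : MvPolynomial (Fin 2) R :=
  p.1.eval₂ MvPolynomial.C (MvPolynomial.X 0) + p.2.eval₂ MvPolynomial.C (MvPolynomial.X 1) -
    MvPolynomial.C (p.1.eval 0)

theorem axisHom_axisLift {p : R[X] × R[X]} (h : p.1.eval 0 = p.2.eval 0) :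
    axisHom R (axisLift p) = p := by
  have e : ∀ (f : R[X]) (z : R[X]), f.eval₂ C z = f.comp z := fun _ _ => rfl
  have hC0 : ((MvPolynomial.eval₂Hom C ![X, 0]).comp MvPolynomial.C : R →+* R[X]) = C := by
    ext1 a; simp
  have hC1 : ((MvPolynomial.eval₂Hom C ![0, X]).comp MvPolynomial.C : R →+* R[X]) = C := by
    ext1 a; simp
  refine Prod.ext ?_ ?_
  · change MvPolynomial.eval₂Hom C ![X, 0] (axisLift p) = _
    rw [axisLift, map_sub, map_add, hom_eval₂, hom_eval₂, hC0]
    simp [e, ← h]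
  · change MvPolynomial.eval₂Hom C ![0, X] (axisLift p) = _
    rw [axisLift, map_sub, map_add, hom_eval₂, hom_eval₂, hC1]
    simp [e]

/-- A polynomial minus its constant term is divisible by its variable. Hence, when y is multiplied
by one variable, the terms of `axisLift` in the other variable contribute only multiples of XY. -/
theorem sub_axisLift_mem (y : MvPolynomial (Fin 2) R) : y - axisLift (axisHom R y) ∈
    Ideal.span {(MvPolynomial.X 0 * MvPolynomial.X 1 : MvPolynomial (Fin 2) R)} := by
  have hdvd : ∀ (f : R[X]) (x : MvPolynomial (Fin 2) R),
      x ∣ f.eval₂ MvPolynomial.C x - MvPolynomial.C (f.eval 0) := by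
    intro f x
    have h1 : (X : R[X]) ∣ f - C (f.eval 0) := by
      rw [X_dvd_iff, coeff_sub, coeff_C_zero, coeff_zero_eq_eval_zero, sub_self]
    simpa using map_dvd (eval₂RingHom MvPolynomial.C x) h1
  induction y using MvPolynomial.induction_on with
  | C a => simp [axisHom_C, axisLift]
  | add p q hp hq =>
    have : p + q - axisLift (axisHom R (p + q)) =
        (p - axisLift (axisHom R p)) + (q - axisLift (axisHom R q)) := by
      simp only [axisLift, map_add, Prod.fst_add, Prod.snd_add, eval₂_add, eval_add]
      ring
    rw [this]
    exact Ideal.add_mem _ hp hq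
  | mul_X p i hp =>
    have h0 := axisHom_eval_zero p
    have key : ∀ i, ∃ z, axisLift (axisHom R p) * MvPolynomial.X i -
        axisLift (axisHom R (p * MvPolynomial.X i)) =
          z * (MvPolynomial.X 0 * MvPolynomial.X 1) := by
      intro i
      obtain ⟨z₀, hz₀⟩ := hdvd (axisHom R p).1 (MvPolynomial.X 0)
      obtain ⟨z₁, hz₁⟩ := hdvd (axisHom R p).2 (MvPolynomial.X 1)
      fin_cases i
      · refine ⟨z₁, ?_⟩
        simp only [Fin.zero_eta, map_mul, axisHom_X_zero, axisLift, Prod.fst_mul, Prod.snd_mul,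
          mul_zero, eval₂_zero, eval_mul, eval_X, map_zero, sub_zero, add_zero, eval₂_mul_X]
        rw [h0]
        linear_combination MvPolynomial.X 0 * hz₁
      · refine ⟨z₀, ?_⟩
        simp only [Fin.mk_one, map_mul, axisHom_X_one, axisLift, Prod.fst_mul, Prod.snd_mul,
          mul_zero, eval₂_zero, eval_zero, map_zero, sub_zero, zero_add, eval₂_mul_X]
        linear_combination MvPolynomial.X 1 * hz₀
    obtain ⟨z, hz⟩ := key i
    have : p * MvPolynomial.X i - axisLift (axisHom R (p * MvPolynomial.X i)) =
        (p - axisLift (axisHom R p)) * MvPolynomial.X i +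
          z * (MvPolynomial.X 0 * MvPolynomial.X 1) := by
      rw [← hz]; ring
    rw [this]
    exact Ideal.add_mem _ (Ideal.mul_mem_right _ _ hp)
      (Ideal.mul_mem_left _ _ (Ideal.mem_span_singleton_self _))

theorem ker_axisHom : RingHom.ker (axisHom R) =
    Ideal.span {(MvPolynomial.X 0 * MvPolynomial.X 1 : MvPolynomial (Fin 2) R)} := by
  apply le_antisymm
  · intro y hy
    have := sub_axisLift_mem y
    rw [(hy : axisHom R y = 0)] at this
    simpa [axisLift] using this
  · rw [Ideal.span_singleton_le_iff_mem, RingHom.mem_ker, map_mul, axisHom_X_zero, axisHom_X_one]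
    simp

end Axes

/-! ### Homomorphisms out of rings with inverted integers -/

section InvNatHom

theorem InvNat.hom_ext {R : Type v} [CommRing R] {S : Type w} [CommRing S] {n : ℕ}
    {φ ψ : InvNat R n →+* S} (h : ∀ x : R, φ (algebraMap R _ x) = ψ (algebraMap R _ x)) : φ = ψ :=
  IsLocalization.ringHom_ext (Submonoid.powers (n : R)) (RingHom.ext h)

theorem InvNat.int_hom_ext {S : Type w} [CommRing S] {n : ℕ} (φ ψ : InvNat ℤ n →+* S) : φ = ψ :=
  InvNat.hom_ext fun x => by simp

theorem InvNat.lift_algebraMap {R : Type v} [CommRing R] {S : Type w} [CommRing S] {n : ℕ}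
    {ψ : R →+* S} {h : IsUnit (n : S)} (x : R) :
    InvNat.lift n ψ h (algebraMap R _ x) = ψ x :=
  IsLocalization.Away.lift_eq _ _ _

end InvNatHom

/-! ### The structure of the universal measure ring -/

section Structure

variable {F : Type u} [Field F] [Fintype F]

/-- With 2 and q invertible, 1, χ and qδ₀ − 1 are linearly independent: the total gives T, and the
values at 1 and at a nonsquare give u and w. -/
theorem QParam.ext_of_val {R : Type v} [CommRing R] (h2 : (2 : F) ≠ 0) {qi hi : R}
    (hq : (Fintype.card F : R) * qi = 1) (hhi : 2 * hi = 1) {p p' : QParam R}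
    (h : ∀ c : F, p.val qi c = p'.val qi c) : p = p' := by
  obtain ⟨ε, hε⟩ := FiniteField.exists_nonsquare (ringChar_ne_two_of h2)
  have hε0 : ε ≠ 0 := by rintro rfl; exact hε (IsSquare.zero)
  have hχε := chi_nonsquare (R := R) hε
  have hT : p.T = p'.T := by
    rw [← p.sum_val h2 hq, ← p'.sum_val h2 hq]
    exact Finset.sum_congr rfl fun c _ => h c
  have h1 := h 1
  have hε := h ε
  simp only [QParam.val, chi_one, one_ne_zero, if_false, hε0, hχε] at h1 hε
  ext
  · exact hT
  · linear_combination hi * (h1 - hε) - (p.u - p'.u) * hhi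
  · linear_combination -hi * (h1 + hε) + 2 * hi * qi * hT - (p.w - p'.w) * hhi

theorem stepMeasure_countPoly (h2 : (2 : F) ≠ 0) {s : ℕ} (hs : s ≤ 1) {qi : Zq F}
    (hq : (Fintype.card F : Zq F) * qi = 1) {v : VInf F} (hv : v ≠ 0) :
    stepMeasure (countPoly h2 hs) ∅ v =
      StepData.eval (C qi) (cParam F (C qi) s X)
        (.perp [] (formInf F v v) (open Classical in if formInf F v v = 0 then 1 else 0)) :=
  (hasCount_countPoly h2 hs _).unique h2 hs
    (exists_hasCount_step h2 hs _ (y := TransSet.base _) (A := ∅) (v := v) (by simp)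
      (TransSet.stabilizer_base _) (by rw [TransSet.proj_base, TransSet.stabilizer_base])
      hq (by simpa using hv) (hasData_empty v))

end Structure

/-! ### The structure of the universal measure ring -/

section UniversalMeasure

variable {F : Type u} [Field F] [Fintype F]

variable (F) in
/-- The ring `Θ(G, 𝐕)[1/2q]`. -/
abbrev ThetaInv : Type (u + 1) := InvNat (ThetaO F) (2 * Fintype.card F)

variable (F) in
/-- The universal measure with values in `Θ(G, 𝐕)[1/2q]`. -/
noncomputable def univMeasure (f : TransMap (OInf F) (VInf F)) :
    ThetaInv F :=
  algebraMap (ThetaO F) _ (Theta.cls f)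

theorem isMeasure_univMeasure : IsMeasure (univMeasure F) :=
  isMeasure_cls.map (algebraMap (ThetaO F) (ThetaInv F))

omit [Field F] in
theorem exists_two_mul_eq_one (R : Type v) [CommRing R] :
    ∃ hi : InvNat R (2 * Fintype.card F), 2 * hi = 1 := by
  obtain ⟨hi, h⟩ := (InvNat.isUnit_of_dvd R (Dvd.intro (Fintype.card F) rfl : 2 ∣ _)).exists_right_inv
  exact ⟨hi, (congrArg (· * hi) Nat.cast_two.symm).trans h⟩

omit [Field F] in
theorem exists_card_mul_eq_one' (R : Type v) [CommRing R] :
    ∃ qi : InvNat R (2 * Fintype.card F), (Fintype.card F : InvNat R (2 * Fintype.card F)) * qi = 1 :=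
  (InvNat.isUnit_of_dvd R (Dvd.intro_left 2 rfl)).exists_right_inv

omit [Fintype F] in
/-- The classes of maps generate `Θ(G, 𝐕)`. -/
theorem Theta.mem_subring (S : Subring (ThetaO F)) (h : ∀ f, Theta.cls f ∈ S) (x : ThetaO F) :
    x ∈ S := by
  obtain ⟨y, rfl⟩ := Ideal.Quotient.mk_surjective x
  induction y using MvPolynomial.induction_on with
  | C a =>
    have : (Ideal.Quotient.mk (Ideal.span {p | ThetaRel (OInf F) (VInf F) p}))
      (MvPolynomial.C a) = (a : ThetaO F) := by simp
    rw [this]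
    exact intCast_mem S a
  | add p q hp hq => rw [map_add]; exact S.add_mem hp hq
  | mul_X p f hp => rw [map_mul]; exact S.mul_mem hp (h f)

/-- A homomorphism from a polynomial ring to `Θ(G, 𝐕)[1/2q]`. -/
noncomputable def axisToTheta (x y : ThetaInv F) :
    MvPolynomial (Fin 2) (Z2q F) →+* ThetaInv F :=
  MvPolynomial.eval₂Hom (InvNat.lift _ (Int.castRingHom _)
    (InvNat.isUnit_natCast (ThetaO F) (2 * Fintype.card F))) ![x, y]

/-- Homomorphisms out of ℤ[1/2q] are unique, so only the images of the two generators matter. -/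
theorem ext_of_axisToTheta {x y : ThetaInv F}
    (hsurj : Function.Surjective (axisToTheta x y)) {S : Type w} [CommRing S]
    {ρ ρ' : ThetaInv F →+* S} (hx : ρ x = ρ' x) (hy : ρ y = ρ' y) :
    ρ = ρ' := by
  have : ρ.comp (axisToTheta x y) = ρ'.comp (axisToTheta x y) := by
    apply MvPolynomial.ringHom_ext
    · exact RingHom.congr_fun (InvNat.int_hom_ext
        ((ρ.comp (axisToTheta x y)).comp MvPolynomial.C)
        ((ρ'.comp (axisToTheta x y)).comp MvPolynomial.C))
    · intro i; fin_cases i <;> simpa [axisToTheta]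
  ext1 z
  obtain ⟨z, rfl⟩ := hsurj z
  exact RingHom.congr_fun this z

/-- By `IsMeasure.mem_subring` all classes lie in the subring generated by 1/q, u and w. The image
contains these, as w is qw divided by q, and it contains the inverse of 2q, so it also contains all
fractions. -/
theorem axisToTheta_surjective (h2 : (2 : F) ≠ 0)
    {qi hi : ThetaInv F}
    (hq : (Fintype.card F : ThetaInv F) * qi = 1) (hhi : 2 * hi = 1)
    {p : QParam (ThetaInv F)}
    (hp : ∀ c, (isMeasure_univMeasure.toQVal h2).ν {v | formInf F v v = c} = p.val qi c) :
    Function.Surjective (axisToTheta ((Fintype.card F : ThetaInv F) * p.w) p.u) := by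
  let τ := axisToTheta ((Fintype.card F : ThetaInv F) * p.w) p.u
  have hinv : ∀ z : ThetaInv F,
      ((2 * Fintype.card F : ℕ) : ThetaInv F) * z = 1 → z ∈ τ.range := by
    intro z hz
    obtain ⟨z', hz'⟩ := (InvNat.isUnit_natCast ℤ (2 * Fintype.card F)).exists_right_inv
    refine ⟨MvPolynomial.C z', ?_⟩
    have h1 := congrArg (fun z => τ (MvPolynomial.C z)) hz'
    simp only [map_mul, map_natCast, map_one] at h1
    calc τ (MvPolynomial.C z') =
        (((2 * Fintype.card F : ℕ) : ThetaInv F) * z) *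
          τ (MvPolynomial.C z') := by rw [hz, one_mul]
      _ = z * (((2 * Fintype.card F : ℕ) : ThetaInv F) *
          τ (MvPolynomial.C z')) := by ring
      _ = z := by rw [h1, mul_one]
  have hqi : qi ∈ τ.range := by
    have h1 : qi * hi ∈ τ.range := hinv _ (by
      push_cast
      linear_combination (2 * hi) * hq + hhi)
    have h3 : qi = 2 * (qi * hi) := by linear_combination -qi * hhi
    rw [h3]
    exact τ.range.mul_mem (ofNat_mem τ.range 2) h1
  have hu : p.u ∈ τ.range := ⟨MvPolynomial.X 1, by simp [τ, axisToTheta]⟩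
  have hw : p.w ∈ τ.range := by
    have h1 : (Fintype.card F : ThetaInv F) * p.w ∈ τ.range := ⟨MvPolynomial.X 0, by simp [τ, axisToTheta]⟩
    have h3 : p.w = qi * ((Fintype.card F : ThetaInv F) * p.w) := by linear_combination -p.w * hq
    rw [h3]
    exact τ.range.mul_mem hqi h1
  have hcls := isMeasure_univMeasure.mem_subring h2 hq hhi hp τ.range hqi hu hw
  have hall : ∀ x : ThetaO F, algebraMap _ _ x ∈ τ.range :=
    Theta.mem_subring (τ.range.comap (algebraMap _ _)) hcls
  intro z
  obtain ⟨x, ⟨_, n, rfl⟩, rfl⟩ := IsLocalization.exists_mk'_eq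
    (Submonoid.powers ((2 * Fintype.card F : ℕ) : ThetaO F)) z
  obtain ⟨i, hi'⟩ := (InvNat.isUnit_natCast (ThetaO F) (2 * Fintype.card F)).exists_right_inv
  have : IsLocalization.mk' (ThetaInv F) x
      (⟨((2 * Fintype.card F : ℕ) : ThetaO F) ^ n, n, rfl⟩ :
        Submonoid.powers ((2 * Fintype.card F : ℕ) : ThetaO F)) = algebraMap _ _ x * i ^ n := by
    rw [IsLocalization.mk'_eq_iff_eq_mul]
    rw [map_pow, map_natCast, mul_assoc, ← mul_pow, mul_comm i, hi', one_pow, mul_one]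
  change _ ∈ τ.range
  exact this ▸ τ.range.mul_mem (hall x) (τ.range.pow_mem (hinv i hi') n)

end UniversalMeasure

/-! ### The universal parameters under the counting homomorphisms -/

section Pair

variable {F : Type u} [Field F] [Fintype F]

theorem fst_pairHom (φ₀ φ₁ : ThetaO F →+* (Zq F)[X]) (x : ThetaO F) :
    (pairHom φ₀ φ₁ (algebraMap _ _ x)).1 = (φ₀ x).map (ZqToZ2q F) := by
  rw [pairHom, InvNat.lift_algebraMap]; rfl

theorem snd_pairHom (φ₀ φ₁ : ThetaO F →+* (Zq F)[X]) (x : ThetaO F) :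
    (pairHom φ₀ φ₁ (algebraMap _ _ x)).2 = (φ₁ x).map (ZqToZ2q F) := by
  rw [pairHom, InvNat.lift_algebraMap]; rfl

/-- The images of the parameters of the universal measure under the counting measures. -/
theorem map_param (h2 : (2 : F) ≠ 0) {s : ℕ} (hs : s ≤ 1)
    {qi : ThetaInv F}
    (hq : (Fintype.card F : ThetaInv F) * qi = 1)
    {p : QParam (ThetaInv F)}
    (hp : ∀ c, (isMeasure_univMeasure.toQVal h2).ν {v | formInf F v v = c} = p.val qi c)
    (ψ : ThetaInv F →+* (Z2q F)[X])
    (hψ : ∀ f, ψ (univMeasure F f) = (countPoly h2 hs f).map (ZqToZ2q F)) :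
    p.map ψ = cParam F (ψ qi) s X := by
  classical
  obtain ⟨qi', hq'⟩ := exists_card_mul_eq_one (F := F)
  obtain ⟨hi, hhi⟩ := exists_two_mul_eq_one (F := F) ℤ
  have hhi' : (2 : (Z2q F)[X]) * C hi = 1 := by
    have := congrArg C hhi
    rwa [map_mul, map_one, map_ofNat] at this
  have hqψ : (Fintype.card F : (Z2q F)[X]) * ψ qi = 1 := by
    have := congrArg ψ hq
    rwa [map_mul, map_one, map_natCast] at this
  have hqe : C (ZqToZ2q F qi') = ψ qi := by
    have h1 := congrArg (fun z => C (ZqToZ2q F z)) hq'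
    simp only [map_mul, map_natCast, map_one] at h1
    linear_combination ψ qi * h1 - C (ZqToZ2q F qi') * hqψ
  refine QParam.ext_of_val h2 hqψ hhi' fun c => ?_
  -- The orbit of a nonzero vector of norm c is the level set without 0, so its step measure is the
  -- level function at c, with the same correction on both sides.
  obtain ⟨v, hv, hvc⟩ : ∃ v : VInf F, v ≠ 0 ∧ formInf F v v = c := by
    refine ⟨normVec 0 c, fun h => ?_, ?_⟩
    · have := DFunLike.congr_fun h (Sum.inl 0)
      simp [normVec] at this
    · rw [formInf_normVec, if_pos rfl, ← two_mul, mul_div_cancel_left₀ _ h2]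
  have h1 : stepMeasure (univMeasure F) ∅ v =
      StepData.eval qi p (.perp [] c (if c = 0 then 1 else 0)) := by
    rw [← isMeasure_univMeasure.toQVal_relOrbit h2,
      (isMeasure_univMeasure.toQVal h2).ν_relOrbit h2 hq hp (by simp) (by simpa using hv)
        (hasData_empty v), hvc]
  have h3 : ψ (stepMeasure (univMeasure F) ∅ v) =
      (stepMeasure (countPoly h2 hs) ∅ v).map (ZqToZ2q F) := hψ _
  rw [h1, stepMeasure_countPoly h2 hs hq' hv, hvc, ← coe_mapRingHom, StepData.map_eval,
    StepData.map_eval, QParam.map_cParam, coe_mapRingHom, map_C, map_X, hqe] at h3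
  exact sub_left_injective h3

end Pair

/-! ### The theorem -/

section Specialization

variable {F : Type u} [Field F] [Fintype F] {k : Type v} [Field k] [CharZero k]

variable (F k) in
/-- The canonical map from `ℤ[1/2q]` to a field of characteristic zero. -/
noncomputable def Z2qToField : Z2q F →+* k :=
  InvNat.lift _ (Int.castRingHom k) (by simp)

theorem isMeasure_muAt (φ : ThetaO F →+* (Zq F)[X]) (t : k) : IsMeasure (muAt φ t) :=
  isMeasure_cls.map ((eval₂RingHom (ZqToField F k) t).comp φ)

theorem eval₂_map_eq_muAt (φ : ThetaO F →+* (Zq F)[X]) (t : k) (f : TransMap (OInf F) (VInf F)) :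
    ((φ (Theta.cls f)).map (ZqToZ2q F)).eval₂ (Z2qToField F k) t = muAt φ t f := by
  rw [eval₂_map, InvNat.int_hom_ext ((Z2qToField F k).comp (ZqToZ2q F)) (ZqToField F k)]
  rfl

theorem ThetaInv.hom_ext {S : Type w} [CommRing S] {ρ ρ' : ThetaInv F →+* S}
    (h : ∀ f, ρ (univMeasure F f) = ρ' (univMeasure F f)) : ρ = ρ' :=
  InvNat.hom_ext fun x => RingHom.congr_fun
    (Theta.hom_ext (φ := ρ.comp (algebraMap _ _)) (ψ := ρ'.comp (algebraMap _ _)) h) x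

end Specialization

theorem mainTheorem10 {F : Type u} [Field F] [Fintype F] (hodd : Odd (Fintype.card F)) :
    ∃ φeven φodd : ThetaO F →+* (Zq F)[X],
      IsCountingHom 0 φeven ∧ IsCountingHom 1 φodd ∧
      Function.Injective (pairHom φeven φodd) ∧
      Set.range (pairHom φeven φodd) = {p | p.1.eval 0 = p.2.eval 0} ∧
      Nonempty (InvNat (ThetaO F) (2 * Fintype.card F) ≃+*
        (MvPolynomial (Fin 2) (Z2q F) ⧸
          Ideal.span {(MvPolynomial.X 0 * MvPolynomial.X 1 : MvPolynomial (Fin 2) (Z2q F))})) ∧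
      ∀ (k : Type v) [Field k] [CharZero k],
        (∀ t : k, IsMeasure (muAt φeven t) ∧ IsMeasure (muAt φodd t)) ∧
        (∀ μ : TransMap (OInf F) (VInf F) → k, IsMeasure μ →
          ∃ t : k, μ = muAt φeven t ∨ μ = muAt φodd t) ∧
        (∀ s t : k, muAt φeven s = muAt φeven t → s = t) ∧
        (∀ s t : k, muAt φodd s = muAt φodd t → s = t) ∧
        (∀ s t : k, muAt φeven s = muAt φodd t ↔ s = 0 ∧ t = 0) := by
  have h2 : (2 : F) ≠ 0 := by
    refine Ring.two_ne_zero fun h => ?_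
    have := FiniteField.even_card_iff_char_two.1 h
    rw [Nat.odd_iff] at hodd
    omega
  let φ₀ := (isMeasure_countPoly (F := F) h2 (zero_le_one)).lift
  let φ₁ := (isMeasure_countPoly (F := F) h2 (le_refl 1)).lift
  refine ⟨φ₀, φ₁, isCountingHom_lift h2 _, isCountingHom_lift h2 _, ?_⟩
  obtain ⟨qi, hq⟩ := exists_card_mul_eq_one' (F := F) (ThetaO F)
  obtain ⟨hi, hhi⟩ := exists_two_mul_eq_one (F := F) (ThetaO F)
  obtain ⟨p, hp⟩ := isMeasure_univMeasure.exists_param h2 hq hhi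
  -- The factor q turns the value w = t/q of the even family into t.
  set x : ThetaInv F := (Fintype.card F : ThetaInv F) * p.w with hx
  have hsurj : Function.Surjective (axisToTheta x p.u) := axisToTheta_surjective h2 hq hhi hp
  have hxy : x * p.u = 0 := by
    rw [hx]
    linear_combination (Fintype.card F : ThetaInv F) *
      (isMeasure_univMeasure.param_relations h2 hq hhi hp).1
  have e₀ := map_param h2 zero_le_one hq hp ((RingHom.fst _ _).comp (pairHom φ₀ φ₁)) (fun f =>
    (fst_pairHom φ₀ φ₁ _).trans (by rw [IsMeasure.lift_cls]))
  have e₁ := map_param h2 le_rfl hq hp ((RingHom.snd _ _).comp (pairHom φ₀ φ₁)) (fun f =>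
    (snd_pairHom φ₀ φ₁ _).trans (by rw [IsMeasure.lift_cls]))
  have hqψ : ∀ ψ : ThetaInv F →+* (Z2q F)[X], (Fintype.card F : (Z2q F)[X]) * ψ qi = 1 := by
    intro ψ
    have := congrArg ψ hq
    rwa [map_mul, map_one, map_natCast] at this
  have hπu : pairHom φ₀ φ₁ p.u = (0, X) := by
    refine Prod.ext ?_ ?_
    · exact (congrArg QParam.u e₀).trans (by simp [cParam])
    · exact (congrArg QParam.u e₁).trans (by simp [cParam])
  have hπx : pairHom φ₀ φ₁ x = (X, 0) := by
    rw [hx, map_mul, map_natCast]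
    refine Prod.ext ?_ ?_
    · have h1 := congrArg QParam.w e₀
      have h3 := hqψ ((RingHom.fst _ _).comp (pairHom φ₀ φ₁))
      simp only [QParam.map, cParam, if_true] at h1
      change (Fintype.card F : (Z2q F)[X]) * (RingHom.fst _ _).comp (pairHom φ₀ φ₁) p.w = X
      rw [h1]
      linear_combination X * h3
    · have h1 := congrArg QParam.w e₁
      simp only [QParam.map, cParam, one_ne_zero, if_false] at h1
      change (Fintype.card F : (Z2q F)[X]) * (RingHom.snd _ _).comp (pairHom φ₀ φ₁) p.w = 0
      rw [h1, mul_zero]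
  have hπ : (pairHom φ₀ φ₁).comp (axisToTheta x p.u) = axisHom (Z2q F) := by
    apply MvPolynomial.ringHom_ext
    · intro a
      rw [axisHom_C]
      refine Prod.ext ?_ ?_
      · exact RingHom.congr_fun (InvNat.int_hom_ext ((RingHom.fst _ _).comp
          (((pairHom φ₀ φ₁).comp (axisToTheta x p.u)).comp MvPolynomial.C)) C) a
      · exact RingHom.congr_fun (InvNat.int_hom_ext ((RingHom.snd _ _).comp
          (((pairHom φ₀ φ₁).comp (axisToTheta x p.u)).comp MvPolynomial.C)) C) a
    · intro i
      fin_cases i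
      · simpa [axisToTheta, axisHom_X_zero] using hπx
      · simpa [axisToTheta, axisHom_X_one] using hπu
  have hπ' : ∀ y, pairHom φ₀ φ₁ (axisToTheta x p.u y) = axisHom (Z2q F) y :=
    RingHom.congr_fun hπ
  -- The kernel contains XY because uw = 0, and lies in the kernel (XY) of `axisHom`, which factors
  -- through this map.
  have hker : RingHom.ker (axisToTheta x p.u) = Ideal.span
      {(MvPolynomial.X 0 * MvPolynomial.X 1 : MvPolynomial (Fin 2) (Z2q F))} := by
    apply le_antisymm
    · rw [← ker_axisHom]
      intro y hy
      rw [RingHom.mem_ker] at hy ⊢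
      rw [← hπ', hy, map_zero]
    · rw [Ideal.span_singleton_le_iff_mem, RingHom.mem_ker, map_mul]
      simpa [axisToTheta] using hxy
  refine ⟨?_, ?_, ?_, ?_⟩
  · rw [injective_iff_map_eq_zero]
    intro z hz
    obtain ⟨y, rfl⟩ := hsurj z
    rw [hπ', ← RingHom.mem_ker, ker_axisHom, ← hker] at hz
    exact hz
  · ext P
    constructor
    · rintro ⟨z, rfl⟩
      obtain ⟨y, rfl⟩ := hsurj z
      rw [hπ']
      exact axisHom_eval_zero y
    · intro hP
      exact ⟨axisToTheta x p.u (axisLift P), by rw [hπ', axisHom_axisLift hP]⟩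
  · exact ⟨((Ideal.quotEquivOfEq hker.symm).trans
      (RingHom.quotientKerEquivOfSurjective hsurj)).symm⟩
  · intro k _ _
    let ev₀ : k → ThetaInv F →+* k := fun t =>
      (eval₂RingHom (Z2qToField F k) t).comp ((RingHom.fst _ _).comp (pairHom φ₀ φ₁))
    let ev₁ : k → ThetaInv F →+* k := fun t =>
      (eval₂RingHom (Z2qToField F k) t).comp ((RingHom.snd _ _).comp (pairHom φ₀ φ₁))
    have hev₀ : ∀ t f, ev₀ t (univMeasure F f) = muAt φ₀ t f := fun t f => by
      rw [← eval₂_map_eq_muAt, ← fst_pairHom φ₀ φ₁]; rfl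
    have hev₁ : ∀ t f, ev₁ t (univMeasure F f) = muAt φ₁ t f := fun t f => by
      rw [← eval₂_map_eq_muAt, ← snd_pairHom φ₀ φ₁]; rfl
    have x₀ : ∀ t, ev₀ t x = t := fun t => by simp [ev₀, hπx]
    have x₁ : ∀ t, ev₁ t x = 0 := fun t => by simp [ev₁, hπx]
    have u₀ : ∀ t, ev₀ t p.u = 0 := fun t => by simp [ev₀, hπu]
    have u₁ : ∀ t, ev₁ t p.u = t := fun t => by simp [ev₁, hπu]
    have hext : ∀ {ρ ρ' : ThetaInv F →+* k} {μ μ' : TransMap (OInf F) (VInf F) → k},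
        (∀ f, ρ (univMeasure F f) = μ f) → (∀ f, ρ' (univMeasure F f) = μ' f) →
        (μ = μ' ↔ ρ x = ρ' x ∧ ρ p.u = ρ' p.u) := by
      intro ρ ρ' μ μ' h h'
      constructor
      · rintro rfl
        have : ρ = ρ' := ThetaInv.hom_ext fun f => (h f).trans (h' f).symm
        rw [this]
        exact ⟨rfl, rfl⟩
      · rintro ⟨h1, h3⟩
        have : ρ = ρ' := ext_of_axisToTheta hsurj h1 h3
        ext f
        rw [← h, ← h', this]
    refine ⟨fun t => ⟨isMeasure_muAt _ t, isMeasure_muAt _ t⟩, fun μ hμ => ?_, fun s t h => ?_,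
      fun s t h => ?_, fun s t => ?_⟩
    · let ρ : ThetaInv F →+* k := InvNat.lift _ hμ.lift (by simp)
      have hρ : ∀ f, ρ (univMeasure F f) = μ f := fun f =>
        (InvNat.lift_algebraMap _).trans (hμ.lift_cls f)
      -- In a field one of the two coordinates vanishes, so the measure lies on one of the axes.
      have h0 : ρ x * ρ p.u = 0 := by rw [← map_mul, hxy, map_zero]
      rcases mul_eq_zero.1 h0 with h0 | h0
      · exact ⟨ρ p.u, Or.inr ((hext hρ (hev₁ _)).2 ⟨by rw [h0, x₁], (u₁ _).symm⟩)⟩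
      · exact ⟨ρ x, Or.inl ((hext hρ (hev₀ _)).2 ⟨(x₀ _).symm, by rw [h0, u₀]⟩)⟩
    · simpa [x₀] using ((hext (hev₀ s) (hev₀ t)).1 h).1
    · simpa [u₁] using ((hext (hev₁ s) (hev₁ t)).1 h).2
    · rw [hext (hev₀ s) (hev₁ t), x₀, x₁, u₀, u₁, eq_comm (a := (0 : k))]
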